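/- **Setting.** Let $T>0$, and let $\alpha,\sigma,f,g:[0,T]\to\mathbb R$ satisfy: $\alpha>0$; $\sigma_0\ge 0$ and $\sigma_t>0$ for $t\in(0,T]$; $f,g$ continuous; $\alpha'=f\alpha$ and $(\sigma^2)'=2f\sigma^2+g^2$ (so that $dx=f(t)x\,dt+g(t)\,dw$ is the forward diffusion with $x_t\mid x_0\sim\mathcal N(\alpha_tx_0,\sigma_t^2I)$). Put $\mathrm{SNR}_t:=\alpha_t^2/\sigma_t^2$ and assume $\mathrm{SNR}_T<\mathrm{SNR}_t$ for $0<t<T$. If $\sigma_0=0$, then $\mathrm{SNR}_0=\infty$ and $\mathrm{SNR}_s/\mathrm{SNR}_0:=0$. Fix $x_T\in\mathbb R^d$ and a data predictor $D_\theta(x,u)=D_\theta(x,u,x_T,T)\in\mathbb R^d$ that is continuous in $(x,u)\in\mathbb R^d\times[0,T]$. The reverse-time Bridge SDE is $$dx_u=\big[f(u)x_u-g(u)^2 s_\theta(x_u,u)+g(u)^2\nabla_{x_u}\log p_u(x_T\mid x_u)\big]du+g(u)\,dw_u,$$ $$s_\theta(x,u)=\frac{\frac{\mathrm{SNR}_T}{\mathrm{SNR}_u}\frac{\alpha_u}{\alpha_T}x_T+\alpha_u\big(1-\frac{\mathrm{SNR}_T}{\mathrm{SNR}_u}\big)D_\theta(x,u)-x}{\sigma_u^2\big(1-\frac{\mathrm{SNR}_T}{\mathrm{SNR}_u}\big)},$$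 where $p_u(\cdot\mid x)$ is the forward transition density from time $u$ to $T$, i.e. the density of $\mathcal N\big(\frac{\alpha_T}{\alpha_u}x,(\sigma_T^2-\frac{\alpha_T^2}{\alpha_u^2}\sigma_u^2)I\big)$, and $w$ is a standard Wiener process in reversed time, relative to a reverse-time filtration $(\mathcal F_u)$ (so $\mathcal F_u\subseteq\mathcal F_v$ for $v\le u$). **Proposition.** Let $0\le t<s\le T$, and let $(x_u)_{u\in[t,s]}$ be an adapted continuous solution of the Bridge SDE on $[t,s]$, started at time $s$ from $x_s$ and run backwards to time $t$. Then there is a standard Gaussian vector $z_t\sim\mathcal N(0,I)$, independent of $\mathcal F_s$ (hence of $x_s$), such that almost surely the exponential-integrator formula $$x_t=\frac{\mathrm{SNR}_s}{\mathrm{SNR}_t}\frac{\alpha_t}{\alpha_s}x_s+\frac{\alpha_t}{\mathrm{SNR}_t}\int_t^s\Big(-\frac{d\,\mathrm{SNR}_u}{du}\Big)D_\theta(x_u,u)\,du+\sigma_t\sqrt{1-\frac{\mathrm{SNR}_s}{\mathrm{SNR}_t}}\;z_t$$ holds (if $\sigma_t=0$, the middle term is replaced by its limit value $\alpha_tD_\theta(x_t,t)$).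 Replacing $D_\theta(x_u,u)$ in it by its zeroth-order Taylor polynomial at $u=s$, namely $D_\theta(x_s,s)$, gives $$\hat x_t=\frac{\mathrm{SNR}_s}{\mathrm{SNR}_t}\frac{\alpha_t}{\alpha_s}x_s+\alpha_t\Big(1-\frac{\mathrm{SNR}_s}{\mathrm{SNR}_t}\Big)D_\theta(x_s,s)+\sigma_t\sqrt{1-\frac{\mathrm{SNR}_s}{\mathrm{SNR}_t}}\;z_t ,$$ and $\hat x_t$ is a first-order approximation of $x_t$ in the following sense. For every $\delta\in[0,T]$ with $\sigma_\delta>0$ there is a constant $C$, depending only on the schedule, $D_\theta$, $x_T$ and $\delta$, such that, whenever $\delta\le t<s\le T$: 1. almost surely, for every $M$ with $\|D_\theta(x_u,u)-D_\theta(x_s,s)\|\le M(s-u)$ for all $u\in[t,s]$, one has $\|x_t-\hat x_t\|\le CM(s-t)^2$; 2. if $\mathbb E\|x_s\|^2<\infty$ and, for some $L$, $\|D_\theta(x,u)-D_\theta(y,v)\|\le L\big(\|x-y\|+(1+\|x\|)|u-v|\big)$ for all $x,y\in\mathbb R^d$, $u,v\in[0,T]$, then $\mathbb E\|x_t-\hat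 x_t\|^2\le C(1+\mathbb E\|x_s\|^2)(s-t)^3$; 3. if moreover $D_\theta(\cdot,u)$ is differentiable for every $u\in[0,T]$, with a derivative that is Lipschitz in $x$ uniformly in $u$, then for every differentiable $\varphi:\mathbb R^d\to\mathbb R$ whose derivative is bounded by $K$ and $K$-Lipschitz, $\varphi(x_t)$ and $\varphi(\hat x_t)$ are integrable and $|\mathbb E\varphi(x_t)-\mathbb E\varphi(\hat x_t)|\le CK(1+\mathbb E\|x_s\|^2)(s-t)^2$. -/

import Mathlib

open MeasureTheory ProbabilityTheory Set Filter

universe w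

noncomputable section

/-- The noise schedule of a diffusion bridge model on `[0, T]`. The forward diffusion is
`dx = f(t) x dt + g(t) dw`, and its coefficients are tied to the perturbation kernel
`x_t | x_0 ∼ N(α_t x_0, σ_t² I)` by `f = (log α)'` and `g² = (σ²)' - 2 (log α)' σ²`. -/
structure BridgeSchedule where
  T : ℝ
  α : ℝ → ℝ
  σ : ℝ → ℝ
  f : ℝ → ℝ
  g : ℝ → ℝ
  T_pos : 0 < T
  α_pos : ∀ t ∈ Icc 0 T, 0 < α t
  σ_zero : 0 ≤ σ 0
  σ_pos : ∀ t ∈ Ioc 0 T, 0 < σ t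
  f_cont : ContinuousOn f (Icc 0 T)
  g_cont : ContinuousOn g (Icc 0 T)
  α_deriv : ∀ t ∈ Icc 0 T, HasDerivWithinAt α (f t * α t) (Icc 0 T) t
  σ_sq_deriv : ∀ t ∈ Icc 0 T,
    HasDerivWithinAt (fun u => σ u ^ 2) (2 * f t * σ t ^ 2 + g t ^ 2) (Icc 0 T) t
  /-- The bridge scores are well defined before the terminal time. -/
  snr_lt : ∀ t ∈ Ioo 0 T, α T ^ 2 / σ T ^ 2 < α t ^ 2 / σ t ^ 2

namespace BridgeSchedule

variable {d : ℕ}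

/-- The signal-to-noise ratio. -/
def snr (S : BridgeSchedule) (t : ℝ) : ℝ := S.α t ^ 2 / S.σ t ^ 2

/-- The transition density `p_t(x_T | x_t)` of the forward diffusion: the density of
`N((α_T / α_t) x_t, (σ_T² - (α_T / α_t)² σ_t²) I)` at `x_T`. -/
def transitionDensity (S : BridgeSchedule) (t : ℝ) (x xT : EuclideanSpace ℝ (Fin d)) : ℝ :=
  let v := S.σ S.T ^ 2 - (S.α S.T / S.α t) ^ 2 * S.σ t ^ 2
  (Real.sqrt (2 * Real.pi * v) ^ d)⁻¹ *
    Real.exp (-‖xT - (S.α S.T / S.α t) • x‖ ^ 2 / (2 * v))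

/-- The score `∇_{x_t} log p_t(x_T | x_t)`. -/
def transitionScore (S : BridgeSchedule) (t : ℝ) (x xT : EuclideanSpace ℝ (Fin d)) :
    EuclideanSpace ℝ (Fin d) :=
  gradient (fun y => Real.log (S.transitionDensity t y xT)) x

/-- The model of the score `∇_{x_t} log p_t(x_t | x_T)` that belongs to the value `x0` predicted
at `(x_t, t)` by an `x_0`-predicting model. -/
def bridgeScore (S : BridgeSchedule) (t : ℝ) (x xT x0 : EuclideanSpace ℝ (Fin d)) :
    EuclideanSpace ℝ (Fin d) :=
  (S.σ t ^ 2 * (1 - S.snr S.T / S.snr t))⁻¹ •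
    ((S.snr S.T / S.snr t * (S.α t / S.α S.T)) • xT
      + (S.α t * (1 - S.snr S.T / S.snr t)) • x0 - x)

/-- The drift `f(x, t) - g(t)² s_θ(x) + g(t)² ∇ log p_t(x_T | x)` of the Bridge SDE. -/
def bridgeDrift (S : BridgeSchedule)
    (D : EuclideanSpace ℝ (Fin d) → ℝ → EuclideanSpace ℝ (Fin d) → ℝ → EuclideanSpace ℝ (Fin d))
    (xT x : EuclideanSpace ℝ (Fin d)) (t : ℝ) : EuclideanSpace ℝ (Fin d) :=
  S.f t • x - S.g t ^ 2 • S.bridgeScore t x xT (D x t xT S.T)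
    + S.g t ^ 2 • S.transitionScore t x xT

/-- The contribution of the data predictions `p u` (to be `D_θ(x_u)`), `u ∈ [t, s]`, to the
exponential-integrator solution at time `t`:
`(α_t / SNR_t) ∫_t^s (-SNR'_u) p(u) du`. If `σ_t = 0` (possible for `t = 0` only), then
`SNR_t = ∞`, and the value is the limit `α_t p(t)` of this expression. -/
def eiDataTerm (S : BridgeSchedule) (t s : ℝ) (p : ℝ → EuclideanSpace ℝ (Fin d)) :
    EuclideanSpace ℝ (Fin d) :=
  open Classical in
  if S.σ t = 0 then S.α t • p t
  else (S.α t / S.snr t) • ∫ u in t..s, (-(deriv S.snr u)) • p u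

/-- The update from `x_s = x` to time `t`, with `x0` the prediction `D_θ(x_s)`, and noise `z`:
`(SNR_s/SNR_t)(α_t/α_s) x + α_t (1 - SNR_s/SNR_t) x0 + σ_t √(1 - SNR_s/SNR_t) z`.
If `σ_t = 0`, the quotient `SNR_s / SNR_t` is `0` in Lean, as it has to be for `SNR_t = ∞`. -/
def firstOrderStep (S : BridgeSchedule) (t s : ℝ) (x x0 z : EuclideanSpace ℝ (Fin d)) :
    EuclideanSpace ℝ (Fin d) :=
  (S.snr s / S.snr t * (S.α t / S.α s)) • x
    + (S.α t * (1 - S.snr s / S.snr t)) • x0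
    + (S.σ t * Real.sqrt (1 - S.snr s / S.snr t)) • z

end BridgeSchedule

/-- `W` is, on `[a, b]`, a standard Wiener process running backwards in time from `b` to `a`,
relative to the reverse-time filtration `ℱ` (`ℱ u ⊆ ℱ v` for `v ≤ u`). -/
structure IsReverseWiener {d : ℕ} {Ω : Type*} {mΩ : MeasurableSpace Ω} (μ : Measure Ω)
    (ℱ : Filtration ℝᵒᵈ mΩ) (a b : ℝ) (W : ℝ → Ω → EuclideanSpace ℝ (Fin d)) : Prop where
  adapted : ∀ u ∈ Icc a b, StronglyMeasurable[ℱ (OrderDual.toDual u)] (W u)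
  hasLaw : ∀ u v, a ≤ u → u ≤ v → v ≤ b →
    HasLaw (fun ω => W u ω - W v ω)
      ((stdGaussian (EuclideanSpace ℝ (Fin d))).map (fun x => Real.sqrt (v - u) • x)) μ
  indep : ∀ u v, a ≤ u → u ≤ v → v ≤ b →
    Indep (MeasurableSpace.comap (fun ω => W u ω - W v ω) inferInstance)
      (ℱ (OrderDual.toDual v)) μ
  cont : ∀ᵐ ω ∂μ, ContinuousOn (fun u => W u ω) (Icc a b)

/-- `I` is the stochastic integral `∫_b^u g dW` (time running from `b` to `u`) of a continuous
deterministic integrand: the limit in probability of the Riemann sums, with `g` evaluated where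
each step starts, along the equidistant partitions from `b` to `u`. -/
def IsStochIntegral {d : ℕ} {Ω : Type*} {mΩ : MeasurableSpace Ω} (μ : Measure Ω)
    (g : ℝ → ℝ) (W : ℝ → Ω → EuclideanSpace ℝ (Fin d)) (b u : ℝ)
    (I : Ω → EuclideanSpace ℝ (Fin d)) : Prop :=
  TendstoInMeasure μ
    (fun (n : ℕ) ω => ∑ i ∈ Finset.range n,
      g (b + i * ((u - b) / n)) •
        (W (b + (i + 1 : ℕ) * ((u - b) / n)) ω - W (b + i * ((u - b) / n)) ω))
    atTop I

/-- `X` is, on `[a, b]`, a solution of the reverse-time Bridge SDE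
`dX_u = bridgeDrift(X_u, u) du + g(u) dW_u`, started at time `b` and driven by the reverse-time
Wiener process `W`. -/
structure IsBridgeSDESolution {d : ℕ} {Ω : Type*} {mΩ : MeasurableSpace Ω} (μ : Measure Ω)
    (S : BridgeSchedule)
    (D : EuclideanSpace ℝ (Fin d) → ℝ → EuclideanSpace ℝ (Fin d) → ℝ → EuclideanSpace ℝ (Fin d))
    (xT : EuclideanSpace ℝ (Fin d)) (ℱ : Filtration ℝᵒᵈ mΩ) (a b : ℝ)
    (W X : ℝ → Ω → EuclideanSpace ℝ (Fin d)) : Prop where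
  wiener : IsReverseWiener μ ℱ a b W
  adapted : ∀ u ∈ Icc a b, StronglyMeasurable[ℱ (OrderDual.toDual u)] (X u)
  cont : ∀ᵐ ω ∂μ, ContinuousOn (fun u => X u ω) (Icc a b)
  drift_integrable : ∀ᵐ ω ∂μ,
    IntervalIntegrable (fun u => S.bridgeDrift D xT (X u ω) u) volume a b
  eqn : ∀ u ∈ Icc a b, IsStochIntegral μ S.g W b u
    (fun ω => X u ω - X b ω - ∫ v in b..u, S.bridgeDrift D xT (X v ω) v)

/-- `p(x, u)` is Lipschitz in `x`, and Lipschitz in `u ∈ [0, T]` with a constant of linear growth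
in `x`. -/
def IsLipschitzPredictor {d : ℕ} (T : ℝ)
    (p : EuclideanSpace ℝ (Fin d) → ℝ → EuclideanSpace ℝ (Fin d)) : Prop :=
  ∃ L : ℝ, ∀ u ∈ Icc 0 T, ∀ v ∈ Icc 0 T, ∀ x y,
    ‖p x u - p y v‖ ≤ L * (‖x - y‖ + (1 + ‖x‖) * |u - v|)

/-- `p(x, u)` is differentiable in `x`, with a derivative that is Lipschitz in `x`. -/
def HasLipschitzDerivative {d : ℕ} (T : ℝ)
    (p : EuclideanSpace ℝ (Fin d) → ℝ → EuclideanSpace ℝ (Fin d)) : Prop :=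
  ∃ L : ℝ, ∀ u ∈ Icc 0 T, Differentiable ℝ (fun x => p x u) ∧
    ∀ x y, ‖fderiv ℝ (fun x => p x u) x - fderiv ℝ (fun x => p x u) y‖ ≤ L * ‖x - y‖

end

/-! In the drift of the Bridge SDE the dependence on x_T cancels: with V = σ_T² - (α_T/α_u)² σ_u²,
both the modelled score and ∇ log p_u(x_T | x) contain x_T with the coefficient (α_T/α_u)/V, and
they enter with opposite signs. What remains is dx = [f x + (g²/σ²)(x - α D)] du + g dw
(`bridgeDrift_eq`), which is linear in x apart from D. Its integrating factor is κ = SNR/α = α/σ²,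
because κ' = -κ(f + g²/σ²) and κ α g²/σ² = -SNR'. Hence κ_t x_t = κ_s x_s + ∫_t^s (-SNR') D du + N,
where N is the stochastic integral of κ g. It is centred Gaussian and independent of the past, with
covariance (∫ κ² g²) I = (SNR_t - SNR_s) I. Division by κ_t gives the formula.

Stochastic integrals are known only as limits in probability of Riemann sums, so N is reached
without Itô calculus. "Gaussian with covariance v I and independent of m" is encoded by
characteristic functions on the events of m, a property stable under independent sums and under
limits. Abel summation along a path turns sums of κ ΔI into κ I - ∫ κ' I
(`isIndepGaussian_smul_sub_integral`), and `smul_sub_integral_smul_remainder` identifies this with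
the expression above. If σ_t = 0, then t = 0, and the formula follows from the one at times r ↓ 0:
the weights -SNR'/SNR_r concentrate at 0 and the noise variance tends to 0.

The error of the step is exactly e = (α_t/SNR_t) ∫_t^s (-SNR'_u)(D(x_u,u) - D(x_s,s)) du, with a
weight bounded on [δ, T]; the pathwise bound is immediate. In mean square, Grönwall gives E‖x_u -
x_s‖² = O(s-u), so E‖e‖² = O((s-t)³). The weak error gains half an order: to leading order D(x_u,u)
- D(x_s,s) is linear in a Gaussian vector independent of the past, which has mean zero against
Dφ(x_s) (`abs_integral_functional_increment_le`). Only the drift and the quadratic terms survive,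
both of order s-u before the integration in u (`weak_error_le`). -/

noncomputable section

/-! ### Calculus of the signal-to-noise ratio and reduction of the drift -/

namespace BridgeSchedule

variable {d : ℕ} (S : BridgeSchedule)

/-- The rate `-SNR'_u = α² g² / σ⁴` at which the signal-to-noise ratio decreases. -/
def snrRate (u : ℝ) : ℝ := S.α u ^ 2 * S.g u ^ 2 / (S.σ u ^ 2) ^ 2

/-- The integrating factor `SNR_u / α_u = α_u / σ_u²` of the Bridge SDE. -/
def intFactor (u : ℝ) : ℝ := S.α u / S.σ u ^ 2

/-- The coefficient `g² / σ²` of the data-dependent part of the Bridge SDE. -/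
def pullRate (u : ℝ) : ℝ := S.g u ^ 2 / S.σ u ^ 2

/-- The drift of the Bridge SDE at `x`, after cancellation of the terms in `x_T`, if `p` is the
predicted datum. -/
def reducedDrift (u : ℝ) (x p : EuclideanSpace ℝ (Fin d)) : EuclideanSpace ℝ (Fin d) :=
  S.f u • x + S.pullRate u • (x - S.α u • p)

variable {S}

theorem σ_pos_of_le {δ u : ℝ} (hδ : δ ∈ Icc 0 S.T) (hσ : 0 < S.σ δ) (hu : u ∈ Icc δ S.T) :
    0 < S.σ u := by
  rcases eq_or_lt_of_le (hδ.1.trans hu.1) with h | h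
  · have : δ = u := le_antisymm hu.1 (h ▸ hδ.1)
    exact this ▸ hσ
  · exact S.σ_pos u ⟨h, hu.2⟩

theorem continuousOn_α : ContinuousOn S.α (Icc 0 S.T) :=
  fun t ht => (S.α_deriv t ht).continuousWithinAt

theorem continuousOn_σ_sq : ContinuousOn (fun u => S.σ u ^ 2) (Icc 0 S.T) :=
  fun t ht => (S.σ_sq_deriv t ht).continuousWithinAt

theorem Icc_subset_Icc_T {δ : ℝ} (hδ : δ ∈ Icc 0 S.T) : Icc δ S.T ⊆ Icc 0 S.T :=
  Icc_subset_Icc_left hδ.1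

theorem continuousOn_pullRate {δ : ℝ} (hδ : δ ∈ Icc 0 S.T) (hσ : 0 < S.σ δ) :
    ContinuousOn S.pullRate (Icc δ S.T) :=
  ((S.g_cont.mono (Icc_subset_Icc_T hδ)).pow 2).div
    (continuousOn_σ_sq.mono (Icc_subset_Icc_T hδ))
    fun _ hu => pow_ne_zero 2 (σ_pos_of_le hδ hσ hu).ne'

theorem continuousOn_intFactor {δ : ℝ} (hδ : δ ∈ Icc 0 S.T) (hσ : 0 < S.σ δ) :
    ContinuousOn S.intFactor (Icc δ S.T) :=
  (continuousOn_α.mono (Icc_subset_Icc_T hδ)).div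
    (continuousOn_σ_sq.mono (Icc_subset_Icc_T hδ))
    fun _ hu => pow_ne_zero 2 (σ_pos_of_le hδ hσ hu).ne'

theorem continuousOn_snr {δ : ℝ} (hδ : δ ∈ Icc 0 S.T) (hσ : 0 < S.σ δ) :
    ContinuousOn S.snr (Icc δ S.T) :=
  ((continuousOn_α.mono (Icc_subset_Icc_T hδ)).pow 2).div
    (continuousOn_σ_sq.mono (Icc_subset_Icc_T hδ))
    fun _ hu => pow_ne_zero 2 (σ_pos_of_le hδ hσ hu).ne'

theorem continuousOn_snrRate {δ : ℝ} (hδ : δ ∈ Icc 0 S.T) (hσ : 0 < S.σ δ) :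
    ContinuousOn S.snrRate (Icc δ S.T) :=
  (((continuousOn_α.mono (Icc_subset_Icc_T hδ)).pow 2).mul
    ((S.g_cont.mono (Icc_subset_Icc_T hδ)).pow 2)).div
    ((continuousOn_σ_sq.mono (Icc_subset_Icc_T hδ)).pow 2)
    fun _ hu => pow_ne_zero 2 (pow_ne_zero 2 (σ_pos_of_le hδ hσ hu).ne')

theorem snrRate_nonneg (u : ℝ) : 0 ≤ S.snrRate u := by
  unfold snrRate; positivity

theorem snr_pos {u : ℝ} (hu : u ∈ Icc 0 S.T) (hσ : 0 < S.σ u) : 0 < S.snr u := by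
  have := S.α_pos u hu
  unfold snr; positivity

theorem snrRate_eq (u : ℝ) : S.snrRate u = S.intFactor u ^ 2 * S.g u ^ 2 := by
  unfold snrRate intFactor; ring

/-- The terms in f of (α²)' and (σ²)' cancel in the quotient, so only g² drives the signal-to-noise
ratio. -/
theorem hasDerivWithinAt_snr {u : ℝ} (hu : u ∈ Icc 0 S.T) (hσ : 0 < S.σ u) :
    HasDerivWithinAt S.snr (-S.snrRate u) (Icc 0 S.T) u := by
  have h := ((S.α_deriv u hu).pow 2).div (S.σ_sq_deriv u hu) (pow_ne_zero 2 hσ.ne')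
  refine (h.congr_deriv ?_).congr (fun _ _ => rfl) rfl
  unfold snrRate
  have := hσ.ne'
  simp only [Pi.pow_apply]
  field_simp
  push_cast
  ring

/-- The logarithmic derivative is minus the coefficient of x in `reducedDrift`; this is what makes
α/σ² an integrating factor. -/
theorem hasDerivWithinAt_intFactor {u : ℝ} (hu : u ∈ Icc 0 S.T) (hσ : 0 < S.σ u) :
    HasDerivWithinAt S.intFactor (-(S.intFactor u * (S.f u + S.pullRate u))) (Icc 0 S.T) u := by
  have h := (S.α_deriv u hu).div (S.σ_sq_deriv u hu) (pow_ne_zero 2 hσ.ne')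
  refine (h.congr_deriv ?_).congr (fun _ _ => rfl) rfl
  unfold intFactor pullRate
  have := hσ.ne'
  field_simp
  ring

theorem deriv_snr {u : ℝ} (hu : u ∈ Ioo 0 S.T) : deriv S.snr u = -S.snrRate u :=
  ((hasDerivWithinAt_snr (Ioo_subset_Icc_self hu) (S.σ_pos u ⟨hu.1, hu.2.le⟩)).hasDerivAt
    (Icc_mem_nhds hu.1 hu.2)).deriv

theorem integral_snrRate {t s : ℝ} (ht : t ∈ Icc 0 S.T) (hσ : 0 < S.σ t) (hts : t ≤ s)
    (hs : s ≤ S.T) : ∫ u in t..s, S.snrRate u = S.snr t - S.snr s := by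
  have hsub : Icc t s ⊆ Icc t S.T := Icc_subset_Icc_right hs
  have hc := (continuousOn_snrRate ht hσ).mono hsub
  have := intervalIntegral.integral_eq_sub_of_hasDerivAt_of_le hts
    ((continuousOn_snr ht hσ).mono hsub)
    (f' := fun u => -S.snrRate u) (fun u hu => ?_) ?_
  · rw [intervalIntegral.integral_neg] at this
    linarith
  · exact (hasDerivWithinAt_snr ⟨ht.1.trans hu.1.le, hu.2.le.trans hs⟩
      (σ_pos_of_le ht hσ ⟨hu.1.le, hu.2.le.trans hs⟩)).hasDerivAt
      (Icc_mem_nhds (ht.1.trans_lt hu.1) (hu.2.trans_le hs))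
  · exact (hc.intervalIntegrable_of_Icc hts).neg

theorem snr_le {t s : ℝ} (ht : t ∈ Icc 0 S.T) (hσ : 0 < S.σ t) (hts : t ≤ s) (hs : s ≤ S.T) :
    S.snr s ≤ S.snr t := by
  have h := integral_snrRate ht hσ hts hs
  have := intervalIntegral.integral_nonneg (μ := volume) hts (fun u _ => S.snrRate_nonneg u)
  linarith

theorem eiDataTerm_eq {t s : ℝ} (ht : 0 ≤ t) (hσ : 0 < S.σ t) (hts : t ≤ s) (hs : s ≤ S.T)
    (p : ℝ → EuclideanSpace ℝ (Fin d)) :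
    S.eiDataTerm t s p = (S.α t / S.snr t) • ∫ u in t..s, S.snrRate u • p u := by
  unfold eiDataTerm
  rw [if_neg hσ.ne']
  congr 1
  refine intervalIntegral.integral_congr_ae' ?_ ?_
  -- At s = T the two-sided `deriv` need not be the one-sided derivative; a single point does not
  -- matter to the integral.
  · have : ∀ᵐ u : ℝ, u ≠ s := by simp [ae_iff, measure_singleton]
    filter_upwards [this] with u hu hu'
    rw [deriv_snr ⟨ht.trans_lt hu'.1, (lt_of_le_of_ne hu'.2 hu).trans_le hs⟩, neg_neg]
  · refine Eventually.of_forall fun u hu => ?_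
    rw [Ioc_eq_empty (not_lt.mpr hts)] at hu
    exact hu.elim

theorem eiDataTerm_const {t s : ℝ} (ht : 0 ≤ t) (hts : t < s) (hs : s ≤ S.T)
    (x0 : EuclideanSpace ℝ (Fin d)) :
    S.eiDataTerm t s (fun _ => x0) = (S.α t * (1 - S.snr s / S.snr t)) • x0 := by
  have htT : t ∈ Icc 0 S.T := ⟨ht, hts.le.trans hs⟩
  by_cases h0 : S.σ t = 0
  -- Here `snr t` is a division by zero, so `snr s / snr t = 0` and both sides are α_t x0.
  · simp [eiDataTerm, h0, snr]
  · have hσ : 0 < S.σ t := by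
      rcases eq_or_lt_of_le ht with h | h
      · subst h; exact lt_of_le_of_ne S.σ_zero (Ne.symm h0)
      · exact S.σ_pos t ⟨h, htT.2⟩
    rw [eiDataTerm_eq ht hσ hts.le hs, intervalIntegral.integral_smul_const,
      integral_snrRate htT hσ hts.le hs, smul_smul]
    have := (snr_pos htT hσ).ne'
    congr 1
    field_simp

theorem div_snr {t : ℝ} : S.α t / S.snr t = S.σ t ^ 2 / S.α t := by
  unfold snr
  by_cases h : S.α t = 0
  · simp [h]
  by_cases h' : S.σ t = 0
  · simp [h']
  field_simp

theorem hasGradientAt_log_gaussian {c v a : ℝ} (hc : 0 < c)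
    (xT x : EuclideanSpace ℝ (Fin d)) :
    HasGradientAt (fun y => Real.log (c * Real.exp (-‖xT - a • y‖ ^ 2 / (2 * v))))
      ((a / v) • (xT - a • x)) x := by
  have h1 : (fun y : EuclideanSpace ℝ (Fin d) =>
      Real.log (c * Real.exp (-‖xT - a • y‖ ^ 2 / (2 * v))))
      = fun y => Real.log c + -(2 * v)⁻¹ * ‖xT - a • y‖ ^ 2 := by
    funext y
    rw [Real.log_mul hc.ne' (Real.exp_pos _).ne', Real.log_exp]
    ring
  rw [h1, hasGradientAt_iff_hasFDerivAt]
  have h2 : HasFDerivAt (fun y : EuclideanSpace ℝ (Fin d) => xT - a • y)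
      (-(a • ContinuousLinearMap.id ℝ _)) x :=
    ((hasFDerivAt_id x).const_smul a).const_sub xT
  refine ((h2.norm_sq.const_mul (-(2 * v)⁻¹)).const_add (Real.log c)).congr_fderiv ?_
  ext y
  simp
  ring

/-- With a = α_T/α_u and V = σ_T² - a² σ_u² one has 1 - SNR_T/SNR_u = V/σ_T². The coefficients of
x_T are then a/V in both scores and cancel, while those of x combine to g² (σ_T² - a² σ_u²)/(σ_u² V)
= g²/σ_u². The endpoint T is excluded because V vanishes there. -/
theorem bridgeDrift_eq
    (D : EuclideanSpace ℝ (Fin d) → ℝ → EuclideanSpace ℝ (Fin d) → ℝ → EuclideanSpace ℝ (Fin d))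
    (xT x : EuclideanSpace ℝ (Fin d)) {u : ℝ} (hu : u ∈ Ioo 0 S.T) :
    S.bridgeDrift D xT x u = S.reducedDrift u x (D x u xT S.T) := by
  have hu' : u ∈ Icc 0 S.T := Ioo_subset_Icc_self hu
  have hT : S.T ∈ Icc 0 S.T := ⟨S.T_pos.le, le_rfl⟩
  have hα := S.α_pos u hu'
  have hαT := S.α_pos _ hT
  have hσ := S.σ_pos u ⟨hu.1, hu.2.le⟩
  have hσT := S.σ_pos _ ⟨S.T_pos, le_rfl⟩
  have hlt := S.snr_lt u hu
  have hv : 0 < S.σ S.T ^ 2 - (S.α S.T / S.α u) ^ 2 * S.σ u ^ 2 := by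
    rw [div_lt_div_iff₀ (by positivity) (by positivity)] at hlt
    have : (S.α S.T / S.α u) ^ 2 * S.σ u ^ 2 < S.σ S.T ^ 2 := by
      rw [div_pow, div_mul_eq_mul_div, div_lt_iff₀ (by positivity)]
      linarith
    linarith
  have hscore : S.transitionScore u x xT
      = ((S.α S.T / S.α u) / (S.σ S.T ^ 2 - (S.α S.T / S.α u) ^ 2 * S.σ u ^ 2)) •
        (xT - (S.α S.T / S.α u) • x) := by
    unfold transitionScore transitionDensity
    exact (hasGradientAt_log_gaussian (by positivity) xT x).gradient
  have hr : S.snr S.T / S.snr u = (S.α S.T / S.α u) ^ 2 * S.σ u ^ 2 / S.σ S.T ^ 2 := by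
    unfold snr; field_simp
  have h1r : 1 - S.snr S.T / S.snr u
      = (S.σ S.T ^ 2 - (S.α S.T / S.α u) ^ 2 * S.σ u ^ 2) / S.σ S.T ^ 2 := by
    rw [hr]; field_simp
  unfold bridgeDrift bridgeScore reducedDrift pullRate
  rw [hscore, h1r, hr]
  -- With V as an atom and σ_T² eliminated in its favour, the claim is a rational identity in each
  -- coordinate.
  generalize hV : S.σ S.T ^ 2 - (S.α S.T / S.α u) ^ 2 * S.σ u ^ 2 = V at *
  have hsT : S.σ S.T ^ 2 = V + (S.α S.T / S.α u) ^ 2 * S.σ u ^ 2 := by linarith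
  have hne : V + (S.α S.T / S.α u) ^ 2 * S.σ u ^ 2 ≠ 0 := by rw [← hsT]; positivity
  rw [hsT]
  ext i
  simp only [PiLp.add_apply, PiLp.sub_apply, PiLp.smul_apply, smul_eq_mul]
  have hne' : V * S.α u ^ 2 + S.α S.T ^ 2 * S.σ u ^ 2 ≠ 0 := by positivity
  field_simp
  ring

end BridgeSchedule
end

/-! ### Gaussian vectors independent of a σ-algebra -/

noncomputable section

set_option linter.unusedSectionVars false

section IndepGaussian

variable {Ω E : Type*} {m m' mΩ : MeasurableSpace Ω} {μ : Measure Ω}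
  [NormedAddCommGroup E] [InnerProductSpace ℝ E] [FiniteDimensional ℝ E]
  [MeasurableSpace E] [BorelSpace E]

/-- `Y` is a centred Gaussian vector with covariance `v I`, independent of the σ-algebra `m`;
expressed by characteristic functions. -/
structure IsIndepGaussian {mΩ : MeasurableSpace Ω} (μ : Measure Ω) (m : MeasurableSpace Ω) (v : ℝ)
    (Y : Ω → E) : Prop where
  aemeasurable : AEMeasurable Y μ
  integral_cexp : ∀ A, MeasurableSet[m] A → ∀ ξ : E,
    ∫ ω in A, Complex.exp (inner ℝ (Y ω) ξ * Complex.I) ∂μ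
      = μ.real A * Complex.exp (-(v * ‖ξ‖ ^ 2 / 2 : ℝ))

theorem charFun_stdGaussian_map_sqrt_smul {v : ℝ} (hv : 0 ≤ v) (ξ : E) :
    charFun ((stdGaussian E).map fun x => Real.sqrt v • x) ξ
      = Complex.exp (-(v * ‖ξ‖ ^ 2 / 2 : ℝ)) := by
  rw [charFun_map_smul, charFun_stdGaussian]
  congr 1
  rw [norm_smul, Real.norm_of_nonneg (Real.sqrt_nonneg _)]
  rw [show v * ‖ξ‖ ^ 2 / 2 = (Real.sqrt v * ‖ξ‖) ^ 2 / 2 by rw [mul_pow, Real.sq_sqrt hv]]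
  push_cast
  ring

theorem measurable_smul_const_left (c : ℝ) : Measurable fun x : E => c • x :=
  (continuous_const_smul c).measurable

theorem norm_cexp_inner_mul_I (y ξ : E) : ‖Complex.exp (inner ℝ y ξ * Complex.I)‖ = 1 :=
  Complex.norm_exp_ofReal_mul_I _

theorem continuous_cexp_inner (ξ : E) :
    Continuous fun y : E => Complex.exp (inner ℝ y ξ * Complex.I) := by
  fun_prop

namespace IsIndepGaussian

variable {v : ℝ} {Y : Ω → E}

/-- Finite measures are determined by their characteristic functions. This factorised law on every
event of m contains both the law of Y (take A = Ω) and its independence of m. -/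
theorem map_restrict [IsFiniteMeasure μ] (h : IsIndepGaussian μ m v Y) (hv : 0 ≤ v)
    {A : Set Ω} (hA : MeasurableSet[m] A) :
    (μ.restrict A).map Y = μ A • (stdGaussian E).map (fun x => Real.sqrt v • x) := by
  have : IsFiniteMeasure (μ A • (stdGaussian E).map (fun x => Real.sqrt v • x)) :=
    Measure.smul_finite _ (measure_ne_top _ _)
  refine Measure.ext_of_charFun (funext fun ξ => ?_)
  rw [charFun_apply, integral_map h.aemeasurable.restrict
    (continuous_cexp_inner ξ).aestronglyMeasurable, h.integral_cexp A hA, charFun_apply,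
    integral_smul_measure, ← charFun_apply, charFun_stdGaussian_map_sqrt_smul hv]
  simp [Measure.real]

theorem hasLaw [IsProbabilityMeasure μ] (h : IsIndepGaussian μ m v Y) (hv : 0 ≤ v) :
    HasLaw Y ((stdGaussian E).map (fun x => Real.sqrt v • x)) μ where
  aemeasurable := h.aemeasurable
  map_eq := by
    have := h.map_restrict hv (@MeasurableSet.univ _ m)
    simpa using this

theorem indep [IsProbabilityMeasure μ] (hm : m ≤ mΩ) (h : IsIndepGaussian μ m v Y) (hv : 0 ≤ v) :
    Indep (MeasurableSpace.comap Y inferInstance) m μ := by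
  rw [Indep_iff]
  rintro _ A ⟨B, hB, rfl⟩ hA
  have h1 := congrArg (fun ν => ν B) (h.map_restrict hv hA)
  have h2 := congrArg (fun ν => ν B) (h.hasLaw hv).map_eq
  simp only [Measure.smul_apply, smul_eq_mul] at h1 h2
  rw [Measure.map_apply_of_aemeasurable h.aemeasurable.restrict hB,
    Measure.restrict_apply' (hm A hA)] at h1
  rw [Measure.map_apply_of_aemeasurable h.aemeasurable hB] at h2
  rw [h1, h2, mul_comm]

theorem of_hasLaw [IsProbabilityMeasure μ] (hm : m ≤ mΩ) (hv : 0 ≤ v)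
    (hY : HasLaw Y ((stdGaussian E).map (fun x => Real.sqrt v • x)) μ)
    (hi : Indep (MeasurableSpace.comap Y inferInstance) m μ) : IsIndepGaussian μ m v Y where
  aemeasurable := hY.aemeasurable
  integral_cexp A hA ξ := by
    have hf : (μ.restrict A).map Y = μ A • (stdGaussian E).map (fun x => Real.sqrt v • x) := by
      ext B hB
      rw [Measure.map_apply_of_aemeasurable hY.aemeasurable.restrict hB,
        Measure.restrict_apply' (hm A hA), (Indep_iff _ _ _).1 hi _ A ⟨B, hB, rfl⟩ hA,
        ← Measure.map_apply_of_aemeasurable hY.aemeasurable hB, hY.map_eq, Measure.smul_apply,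
        smul_eq_mul, mul_comm]
    have h := congrArg (fun ν => charFun ν ξ) hf
    simp only [charFun_apply] at h
    rw [integral_map hY.aemeasurable.restrict (continuous_cexp_inner ξ).aestronglyMeasurable,
      integral_smul_measure, ← charFun_apply, charFun_stdGaussian_map_sqrt_smul hv] at h
    rw [h]
    simp [Measure.real]

theorem congr (h : IsIndepGaussian μ m v Y) {Y' : Ω → E} (hY : Y =ᵐ[μ] Y') :
    IsIndepGaussian μ m v Y' where
  aemeasurable := h.aemeasurable.congr hY
  integral_cexp A hA ξ := by
    rw [← h.integral_cexp A hA ξ]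
    refine integral_congr_ae (ae_restrict_of_ae ?_)
    filter_upwards [hY] with ω hω
    rw [hω]

theorem const_smul (h : IsIndepGaussian μ m v Y) (c : ℝ) :
    IsIndepGaussian μ m (c ^ 2 * v) (fun ω => c • Y ω) where
  aemeasurable := h.aemeasurable.const_smul c
  integral_cexp A hA ξ := by
    have := h.integral_cexp A hA (c • ξ)
    simp only [inner_smul_right, norm_smul, mul_pow, Real.norm_eq_abs, sq_abs] at this
    simp only [real_inner_smul_left]
    rw [this]
    congr 4
    ring

theorem zero [IsProbabilityMeasure μ] : IsIndepGaussian μ m 0 (fun _ => (0 : E)) where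
  aemeasurable := aemeasurable_const
  integral_cexp A hA ξ := by simp

theorem ae_eq_zero [IsProbabilityMeasure μ] (h : IsIndepGaussian μ m 0 Y) : ∀ᵐ ω ∂μ, Y ω = 0 := by
  have h1 := (h.hasLaw le_rfl).map_eq
  simp only [Real.sqrt_zero, zero_smul, Measure.map_const, measure_univ, one_smul] at h1
  exact HasLaw.ae_eq_of_dirac ⟨h.aemeasurable, h1⟩

theorem indepFun [IsProbabilityMeasure μ] (hm : m ≤ mΩ) (h : IsIndepGaussian μ m v Y) (hv : 0 ≤ v)
    {β : Type*} [MeasurableSpace β] {Z : Ω → β} (hZ : Measurable[m] Z) : IndepFun Z Y μ := by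
  rw [IndepFun_iff_Indep]
  exact indep_of_indep_of_le_left (h.indep hm hv).symm hZ.comap_le

/-- The variable 1_A exp(i⟨Y, ξ⟩) is measurable for m', hence independent of Y', and the expectation
of the product factorises. Thus increments over successive time steps can be added one at a time. -/
theorem add [IsProbabilityMeasure μ] {v' : ℝ} {Y' : Ω → E}
    (hmm : m ≤ m') (hm : m' ≤ mΩ) (h : IsIndepGaussian μ m v Y) (hY : Measurable[m'] Y)
    (h' : IsIndepGaussian μ m' v' Y') (hv' : 0 ≤ v') :
    IsIndepGaussian μ m (v + v') (fun ω => Y ω + Y' ω) where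
  aemeasurable := h.aemeasurable.add h'.aemeasurable
  integral_cexp A hA ξ := by
    have hA' : MeasurableSet A := hm _ (hmm _ hA)
    let Z : Ω → ℂ := A.indicator fun ω => Complex.exp (inner ℝ (Y ω) ξ * Complex.I)
    have hZ : Measurable[m'] Z :=
      ((continuous_cexp_inner ξ).measurable.comp hY).indicator (hmm _ hA)
    have hi : IndepFun Z (fun ω => Complex.exp (inner ℝ (Y' ω) ξ * Complex.I)) μ :=
      (h'.indepFun hm hv' hZ).comp measurable_id (continuous_cexp_inner ξ).measurable
    have h1 := hi.integral_mul_eq_mul_integral (hZ.mono hm le_rfl).aestronglyMeasurable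
      ((continuous_cexp_inner ξ).measurable.comp_aemeasurable
        h'.aemeasurable).aestronglyMeasurable
    have h2 := h'.integral_cexp univ MeasurableSet.univ ξ
    simp only [Measure.restrict_univ, probReal_univ, Complex.ofReal_one, one_mul] at h2
    rw [h2, show ∫ ω, Z ω ∂μ = _ from integral_indicator hA', h.integral_cexp A hA ξ] at h1
    have h3 : Z * (fun ω => Complex.exp (inner ℝ (Y' ω) ξ * Complex.I))
        = A.indicator fun ω => Complex.exp (inner ℝ (Y ω + Y' ω) ξ * Complex.I) := by
      funext ω
      by_cases hω : ω ∈ A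
      · simp only [Z, Pi.mul_apply, indicator_of_mem hω, inner_add_left]
        rw [← Complex.exp_add]
        push_cast
        ring_nf
      · simp [Z, hω]
    rw [h3, integral_indicator hA'] at h1
    rw [h1, mul_assoc, ← Complex.exp_add]
    congr 2
    push_cast
    ring

/-- The exponentials have modulus 1, so dominated convergence passes to the limit in the defining
identity on each event. -/
theorem of_tendsto_ae [IsProbabilityMeasure μ] {Y : ℕ → Ω → E} {v : ℕ → ℝ}
    {Z : Ω → E} {c : ℝ} (h : ∀ n, IsIndepGaussian μ m (v n) (Y n))
    (hv : Tendsto v atTop (nhds c)) (hY : ∀ᵐ ω ∂μ, Tendsto (fun n => Y n ω) atTop (nhds (Z ω))) :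
    IsIndepGaussian μ m c Z where
  aemeasurable := aemeasurable_of_tendsto_metrizable_ae _ (fun n => (h n).aemeasurable) hY
  integral_cexp A hA ξ := by
    have h1 : Tendsto (fun n => ∫ ω in A, Complex.exp (inner ℝ (Y n ω) ξ * Complex.I) ∂μ) atTop
        (nhds (∫ ω in A, Complex.exp (inner ℝ (Z ω) ξ * Complex.I) ∂μ)) := by
      refine tendsto_integral_of_dominated_convergence (fun _ => 1) (fun n => ?_) (by simp)
        (fun n => Eventually.of_forall fun ω => (norm_cexp_inner_mul_I _ _).le) ?_
      · exact ((continuous_cexp_inner ξ).measurable.comp_aemeasurable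
          (h n).aemeasurable.restrict).aestronglyMeasurable
      · refine ae_restrict_of_ae ?_
        filter_upwards [hY] with ω hω
        exact ((continuous_cexp_inner ξ).tendsto _).comp hω
    refine tendsto_nhds_unique h1 ?_
    simp_rw [fun n => (h n).integral_cexp A hA ξ]
    refine tendsto_const_nhds.mul ((Complex.continuous_exp.tendsto _).comp ?_)
    refine (Tendsto.neg ?_)
    exact (Complex.continuous_ofReal.tendsto _).comp ((hv.mul_const _).div_const _)

theorem of_tendstoInMeasure [IsProbabilityMeasure μ] {Y : ℕ → Ω → E} {v : ℕ → ℝ}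
    {Z : Ω → E} {c : ℝ} (h : ∀ n, IsIndepGaussian μ m (v n) (Y n))
    (hv : Tendsto v atTop (nhds c)) (hY : TendstoInMeasure μ Y atTop Z) :
    IsIndepGaussian μ m c Z := by
  obtain ⟨ns, hns, hlim⟩ := hY.exists_seq_tendsto_ae
  exact of_tendsto_ae (fun n => h (ns n)) (hv.comp hns.tendsto_atTop) hlim

theorem memLp_two [IsProbabilityMeasure μ] (h : IsIndepGaussian μ m v Y) (hv : 0 ≤ v) :
    MemLp Y 2 μ := by
  have h1 : MemLp (fun x : E => Real.sqrt v • x) 2 (stdGaussian E) :=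
    (IsGaussian.memLp_two_id (μ := stdGaussian E)).const_smul _
  have h2 : MemLp id 2 (μ.map Y) := by
    rw [(h.hasLaw hv).map_eq, memLp_map_measure_iff aestronglyMeasurable_id
      (measurable_smul_const_left _).aemeasurable]
    exact h1
  exact (memLp_map_measure_iff aestronglyMeasurable_id h.aemeasurable).1 h2

theorem integral_norm_sq [IsProbabilityMeasure μ] (h : IsIndepGaussian μ m v Y) (hv : 0 ≤ v) :
    ∫ ω, ‖Y ω‖ ^ 2 ∂μ = v * ∫ x, ‖x‖ ^ 2 ∂(stdGaussian E) := by
  have h1 := (h.hasLaw hv).integral_comp (f := fun x : E => ‖x‖ ^ 2)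
    (by fun_prop)
  simp only [Function.comp_def] at h1
  rw [h1, integral_map (measurable_smul_const_left _).aemeasurable (by fun_prop),
    ← integral_const_mul]
  refine integral_congr_ae (Eventually.of_forall fun x => ?_)
  simp only [norm_smul, mul_pow, Real.norm_eq_abs, sq_abs, Real.sq_sqrt hv]

theorem integral_eq_zero [IsProbabilityMeasure μ] (h : IsIndepGaussian μ m v Y) (hv : 0 ≤ v) :
    ∫ ω, Y ω ∂μ = 0 := by
  rw [(h.hasLaw hv).integral_eq, integral_map (measurable_smul_const_left _).aemeasurable
    (by fun_prop), integral_smul, integral_id_stdGaussian, smul_zero]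

/-- A bounded `m`-measurable random linear functional annihilates `Y` in the mean. -/
theorem integral_apply_eq_zero [IsProbabilityMeasure μ] (hm : m ≤ mΩ)
    (h : IsIndepGaussian μ m v Y) (hv : 0 ≤ v) {Z : Ω → E →L[ℝ] ℝ} (hZ : Measurable[m] Z)
    {K : ℝ} (hK : ∀ ω, ‖Z ω‖ ≤ K) : ∫ ω, Z ω (Y ω) ∂μ = 0 := by
  have hZi : Integrable Z μ :=
    Integrable.of_bound (hZ.mono hm le_rfl).aestronglyMeasurable K (Eventually.of_forall hK)
  have := (h.indepFun hm hv hZ).integral_bilin hZi ((h.memLp_two hv).integrable one_le_two)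
    (ContinuousLinearMap.id ℝ (E →L[ℝ] ℝ))
  simpa [h.integral_eq_zero hv] using this

end IsIndepGaussian
end IndepGaussian

theorem IsReverseWiener.isIndepGaussian_sub {d : ℕ} {Ω : Type*} {mΩ : MeasurableSpace Ω}
    {μ : Measure Ω} [IsProbabilityMeasure μ] {ℱ : Filtration ℝᵒᵈ mΩ} {a b : ℝ}
    {W : ℝ → Ω → EuclideanSpace ℝ (Fin d)} (hW : IsReverseWiener μ ℱ a b W) {u v : ℝ}
    (hau : a ≤ u) (huv : u ≤ v) (hvb : v ≤ b) :
    IsIndepGaussian μ (ℱ (OrderDual.toDual v)) (v - u) (fun ω => W u ω - W v ω) :=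
  .of_hasLaw (ℱ.le _) (sub_nonneg.2 huv) (hW.hasLaw u v hau huv hvb) (hW.indep u v hau huv hvb)

end

/-! ### Equidistant partitions and Riemann sums -/

noncomputable section

set_option linter.unusedSectionVars false

section Grid

/-- The `i`-th point of the equidistant partition from `a` to `b` into `n` steps. -/
def gridPoint (a b : ℝ) (n i : ℕ) : ℝ := a + i * ((b - a) / n)

theorem gridPoint_zero (a b : ℝ) (n : ℕ) : gridPoint a b n 0 = a := by simp [gridPoint]

theorem gridPoint_self (a b : ℝ) {n : ℕ} (hn : n ≠ 0) : gridPoint a b n n = b := by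
  unfold gridPoint; field_simp; ring

theorem gridPoint_succ_sub (a b : ℝ) (n i : ℕ) :
    gridPoint a b n (i + 1) - gridPoint a b n i = (b - a) / n := by
  unfold gridPoint; push_cast; ring

/-- The stochastic integral up to each point of a coarse grid is a limit along partitions of its own
interval. Taking i * k steps for the i-th point places all these partitions on one common grid of n
* k steps. -/
theorem gridPoint_gridPoint {a b : ℝ} {n i k : ℕ} (hi : i ≠ 0) (j : ℕ) :
    gridPoint a (gridPoint a b n i) (i * k) j = gridPoint a b (n * k) j := by
  unfold gridPoint; push_cast
  by_cases hk : k = 0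
  · simp [hk]
  by_cases hn : n = 0
  · simp [hn]
  field_simp
  ring

theorem gridPoint_cell {a b : ℝ} {n k : ℕ} (hk : k ≠ 0) (i l : ℕ) :
    gridPoint (gridPoint a b n i) (gridPoint a b n (i + 1)) k l
      = gridPoint a b (n * k) (i * k + l) := by
  unfold gridPoint; push_cast
  by_cases hn : n = 0
  · simp [hn]
  field_simp
  ring

theorem gridPoint_mem_uIcc (a b : ℝ) {n i : ℕ} (hi : i ≤ n) : gridPoint a b n i ∈ uIcc a b := by
  rcases Nat.eq_zero_or_pos n with hn | hn
  · subst hn; simp [gridPoint]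
  have hn' : (0 : ℝ) < n := by exact_mod_cast hn
  have h1 : (i : ℝ) / n ≤ 1 := (div_le_one hn').2 (by exact_mod_cast hi)
  have h0 : (0 : ℝ) ≤ (i : ℝ) / n := by positivity
  have : gridPoint a b n i = a + (i / n : ℝ) • (b - a) := by
    unfold gridPoint; rw [smul_eq_mul]; ring
  rw [this, ← segment_eq_uIcc]
  exact (segment_eq_image' ℝ a b) ▸ ⟨_, ⟨h0, h1⟩, rfl⟩

theorem gridPoint_succ_le {a b : ℝ} (hab : b ≤ a) (n i : ℕ) :
    gridPoint a b n (i + 1) ≤ gridPoint a b n i := by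
  have := gridPoint_succ_sub a b n i
  have : (b - a) / n ≤ 0 := div_nonpos_of_nonpos_of_nonneg (by linarith) (by positivity)
  linarith

theorem Finset.sum_range_mul_eq_sum_sum {M : Type*} [AddCommMonoid M] (f : ℕ → M) (n k : ℕ) :
    ∑ j ∈ Finset.range (n * k), f j
      = ∑ i ∈ Finset.range n, ∑ l ∈ Finset.range k, f (i * k + l) := by
  induction n with
  | zero => simp
  | succ n ih => rw [Finset.sum_range_succ, ← ih, Nat.succ_mul, Finset.sum_range_add]

/-- Convergence of Riemann sums in which only the first argument of the integrand is sampled. -/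
theorem tendsto_sum_integral_gridPoint {F : Type*} [NormedAddCommGroup F] [NormedSpace ℝ F]
    {a b : ℝ} {H : ℝ → ℝ → F}
    (hH : ContinuousOn (Function.uncurry H) (uIcc a b ×ˢ uIcc a b)) {e : ℕ} (he : e ≤ 1) :
    Tendsto (fun n : ℕ => ∑ i ∈ Finset.range n,
      ∫ v in gridPoint a b n i..gridPoint a b n (i + 1), H (gridPoint a b n (i + e)) v)
      atTop (nhds (∫ v in a..b, H v v)) := by
  have hdiag : ContinuousOn (fun v => H v v) (uIcc a b) :=
    hH.comp (f := fun v => (v, v)) (by fun_prop) fun v hv => ⟨hv, hv⟩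
  have huc := (isCompact_uIcc.prod isCompact_uIcc).uniformContinuousOn_of_continuous hH
  rw [Metric.uniformContinuousOn_iff] at huc
  rw [Metric.tendsto_atTop]
  intro ε hε
  -- This tolerance, summed over a total length |b - a|, is at most ε / 2; the summand 1 keeps the
  -- denominator positive when a = b.
  obtain ⟨η, hη, hη'⟩ := huc (ε / (2 * (|b - a| + 1))) (by positivity)
  obtain ⟨N, hN⟩ := exists_nat_gt (|b - a| / η)
  refine ⟨N + 1, fun n hn => ?_⟩
  have hn0 : n ≠ 0 := by omega
  have hnpos : (0 : ℝ) < n := by exact_mod_cast Nat.pos_of_ne_zero hn0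
  have hmesh : |b - a| / n < η := by
    rw [div_lt_iff₀ hη] at hN
    rw [div_lt_iff₀ hnpos]
    have : (N : ℝ) < n := by exact_mod_cast hn
    nlinarith
  have hsub : ∀ i, i < n → uIcc (gridPoint a b n i) (gridPoint a b n (i + 1)) ⊆ uIcc a b :=
    fun i hi => uIcc_subset_uIcc (gridPoint_mem_uIcc a b hi.le) (gridPoint_mem_uIcc a b hi)
  have hsplit : ∫ v in a..b, H v v = ∑ i ∈ Finset.range n,
      ∫ v in gridPoint a b n i..gridPoint a b n (i + 1), H v v := by
    rw [intervalIntegral.sum_integral_adjacent_intervals, gridPoint_zero, gridPoint_self a b hn0]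
    exact fun i hi => (hdiag.mono (hsub i hi)).intervalIntegrable
  rw [dist_eq_norm, hsplit, ← Finset.sum_sub_distrib]
  have hterm : ∀ i ∈ Finset.range n,
      ‖(∫ v in gridPoint a b n i..gridPoint a b n (i + 1), H (gridPoint a b n (i + e)) v)
        - ∫ v in gridPoint a b n i..gridPoint a b n (i + 1), H v v‖
      ≤ ε / (2 * (|b - a| + 1)) * (|b - a| / n) := by
    intro i hi
    have hi' := Finset.mem_range.1 hi
    have hq : gridPoint a b n (i + e) ∈ uIcc a b := gridPoint_mem_uIcc a b (by omega)
    have hq' : gridPoint a b n (i + e)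
        ∈ uIcc (gridPoint a b n i) (gridPoint a b n (i + 1)) := by
      interval_cases e
      · exact left_mem_uIcc
      · exact right_mem_uIcc
    rw [← intervalIntegral.integral_sub]
    · have := intervalIntegral.norm_integral_le_of_norm_le_const
        (a := gridPoint a b n i) (b := gridPoint a b n (i + 1))
        (f := fun v => H (gridPoint a b n (i + e)) v - H v v)
        (C := ε / (2 * (|b - a| + 1))) (fun v hv => ?_)
      · rwa [gridPoint_succ_sub, abs_div, Nat.abs_cast] at this
      · have hv' := uIoc_subset_uIcc hv
        have hvab := hsub i hi' hv'
        rw [← dist_eq_norm]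
        refine (hη' (_, v) ⟨hq, hvab⟩ (v, v) ⟨hvab, hvab⟩ ?_).le
        rw [Prod.dist_eq, dist_self, max_eq_left dist_nonneg]
        refine lt_of_le_of_lt ?_ hmesh
        calc dist (gridPoint a b n (i + e)) v
            ≤ dist (gridPoint a b n i) (gridPoint a b n (i + 1)) :=
              Real.dist_le_of_mem_uIcc hq' hv'
          _ = |b - a| / n := by
              rw [dist_comm, Real.dist_eq, gridPoint_succ_sub, abs_div, Nat.abs_cast]
    · refine ContinuousOn.intervalIntegrable ?_
      exact hH.comp (f := fun v => (gridPoint a b n (i + e), v)) (by fun_prop)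
        fun v hv => ⟨hq, hsub i hi' hv⟩
    · exact (hdiag.mono (hsub i hi')).intervalIntegrable
  refine lt_of_le_of_lt ((norm_sum_le _ _).trans (Finset.sum_le_sum hterm)) ?_
  rw [Finset.sum_const, Finset.card_range, nsmul_eq_mul]
  have h1 : (n : ℝ) * (ε / (2 * (|b - a| + 1)) * (|b - a| / n))
      = ε / 2 * (|b - a| / (|b - a| + 1)) := by field_simp
  rw [h1]
  have h2 : |b - a| / (|b - a| + 1) ≤ 1 := by
    rw [div_le_one (by positivity)]; linarith
  nlinarith

theorem tendsto_riemann_sum_gridPoint {F : Type*} [NormedAddCommGroup F] [NormedSpace ℝ F]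
    [CompleteSpace F]
    {a b : ℝ} {h : ℝ → F} (hh : ContinuousOn h (uIcc a b)) :
    Tendsto (fun n : ℕ => ∑ i ∈ Finset.range n, ((b - a) / n) • h (gridPoint a b n i))
      atTop (nhds (∫ v in a..b, h v)) := by
  have := tendsto_sum_integral_gridPoint (H := fun p _ => h p) (a := a) (b := b) (e := 0)
    (hh.comp (f := Prod.fst) continuousOn_fst fun p hp => hp.1) (by norm_num)
  simpa [gridPoint_succ_sub] using this

/-- The discrete form of ∫ κ dJ = κ J - ∫ J dκ. On the right J is sampled at the end of each step.
-/
theorem sum_range_smul_sub_by_parts {F : Type*} [AddCommGroup F] [Module ℝ F]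
    (κ : ℕ → ℝ) (J : ℕ → F) (n : ℕ) :
    ∑ i ∈ Finset.range n, κ i • (J (i + 1) - J i)
      = κ n • J n - κ 0 • J 0 - ∑ i ∈ Finset.range n, (κ (i + 1) - κ i) • J (i + 1) := by
  induction n with
  | zero => simp
  | succ n ih =>
    rw [Finset.sum_range_succ, ih, Finset.sum_range_succ]
    module

end Grid

/-! ### Linear operations and convergence in measure -/

section TendstoInMeasure

variable {Ω F : Type*} {mΩ : MeasurableSpace Ω} {μ : Measure Ω} [NormedAddCommGroup F]
  [NormedSpace ℝ F] {ι : Type*} {l : Filter ι}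

theorem tendstoInMeasure_const (g : Ω → F) : TendstoInMeasure μ (fun _ : ι => g) l g := by
  rw [tendstoInMeasure_iff_norm]
  intro ε hε
  simpa [not_le.2 hε] using tendsto_const_nhds

theorem tendstoInMeasure_add {f f' : ι → Ω → F} {g g' : Ω → F} (h : TendstoInMeasure μ f l g)
    (h' : TendstoInMeasure μ f' l g') :
    TendstoInMeasure μ (fun i ω => f i ω + f' i ω) l (fun ω => g ω + g' ω) := by
  rw [tendstoInMeasure_iff_norm] at *
  intro ε hε
  have := (h (ε / 2) (by positivity)).add (h' (ε / 2) (by positivity))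
  rw [add_zero] at this
  refine tendsto_of_tendsto_of_tendsto_of_le_of_le tendsto_const_nhds this
    (fun _ => zero_le) fun i => ?_
  refine (measure_mono fun ω hω => ?_).trans (measure_union_le _ _)
  simp only [mem_ofPred_eq, mem_union] at hω ⊢
  by_contra! hc
  have : ‖f i ω + f' i ω - (g ω + g' ω)‖ ≤ ‖f i ω - g ω‖ + ‖f' i ω - g' ω‖ := by
    rw [add_sub_add_comm]; exact norm_add_le _ _
  linarith [hc.1, hc.2]

theorem tendstoInMeasure_const_smul {f : ι → Ω → F} {g : Ω → F} (h : TendstoInMeasure μ f l g)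
    (c : ℝ) : TendstoInMeasure μ (fun i ω => c • f i ω) l (fun ω => c • g ω) := by
  rcases eq_or_ne c 0 with rfl | hc
  · simpa using tendstoInMeasure_const (l := l) (fun _ : Ω => (0 : F))
  rw [tendstoInMeasure_iff_norm] at *
  intro ε hε
  have hc' : 0 < |c| := abs_pos.2 hc
  simpa only [← smul_sub, norm_smul, Real.norm_eq_abs, div_le_iff₀' hc']
    using h (ε / |c|) (by positivity)

theorem tendstoInMeasure_sum {f : ℕ → ι → Ω → F} {g : ℕ → Ω → F} (n : ℕ)
    (h : ∀ j < n, TendstoInMeasure μ (f j) l (g j)) :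
    TendstoInMeasure μ (fun i ω => ∑ j ∈ Finset.range n, f j i ω) l
      (fun ω => ∑ j ∈ Finset.range n, g j ω) := by
  induction n with
  | zero => simpa using tendstoInMeasure_const (l := l) (fun _ : Ω => (0 : F))
  | succ n ih =>
    simp_rw [Finset.sum_range_succ]
    exact tendstoInMeasure_add (ih fun j hj => h j (by omega)) (h n (by omega))

end TendstoInMeasure

/-! ### Stochastic integrals of deterministic integrands -/

section StochIntegral

variable {d : ℕ} {Ω : Type*} {mΩ : MeasurableSpace Ω} {μ : Measure Ω} [IsProbabilityMeasure μ]
  {ℱ : Filtration ℝᵒᵈ mΩ} {t s : ℝ} {W : ℝ → Ω → EuclideanSpace ℝ (Fin d)}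

theorem IsReverseWiener.mono {a b a' : ℝ} (hW : IsReverseWiener μ ℱ a b W) (ha : a ≤ a') :
    IsReverseWiener μ ℱ a' b W where
  adapted u hu := hW.adapted u ⟨ha.trans hu.1, hu.2⟩
  hasLaw u v hu := hW.hasLaw u v (ha.trans hu)
  indep u v hu := hW.indep u v (ha.trans hu)
  cont := hW.cont.mono fun _ h => h.mono (Icc_subset_Icc_left ha)

/-- Induction on the number of steps: the sum so far is known at the grid point reached, and the
next increment is independent of that σ-algebra. The measurability is part of the claim because the
induction needs it. Grid times decrease from s while the σ-algebras grow. -/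
theorem IsReverseWiener.isIndepGaussian_sum (hW : IsReverseWiener μ ℱ t s W) (hts : t ≤ s)
    (n : ℕ) (c : ℕ → ℝ) {j : ℕ} (hj : j ≤ n) :
    IsIndepGaussian μ (ℱ (OrderDual.toDual s)) (∑ i ∈ Finset.range j, c i ^ 2 * ((s - t) / n))
      (fun ω => ∑ i ∈ Finset.range j,
        c i • (W (gridPoint s t n (i + 1)) ω - W (gridPoint s t n i) ω)) ∧
    Measurable[ℱ (OrderDual.toDual (gridPoint s t n j))] (fun ω => ∑ i ∈ Finset.range j,
        c i • (W (gridPoint s t n (i + 1)) ω - W (gridPoint s t n i) ω)) := by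
  have hmem : ∀ i ≤ n, gridPoint s t n i ∈ Icc t s := fun i hi => by
    have := gridPoint_mem_uIcc s t hi
    rwa [uIcc_of_ge hts] at this
  induction j with
  | zero =>
    simp only [Finset.range_zero, Finset.sum_empty]
    exact ⟨.zero, measurable_const⟩
  | succ j ih =>
    obtain ⟨h1, h2⟩ := ih (by omega)
    simp_rw [Finset.sum_range_succ]
    have hle := gridPoint_succ_le hts n j
    have hmm : ℱ (OrderDual.toDual (gridPoint s t n j))
        ≤ ℱ (OrderDual.toDual (gridPoint s t n (j + 1))) := ℱ.mono hle
    have hinc := (hW.isIndepGaussian_sub (hmem (j + 1) hj).1 hle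
      (hmem j (by omega)).2).const_smul (c j)
    have hlen : gridPoint s t n j - gridPoint s t n (j + 1) = (s - t) / n := by
      have := gridPoint_succ_sub s t n j
      rw [← neg_sub, this, ← neg_div, neg_sub]
    rw [hlen] at hinc
    refine ⟨h1.add (ℱ.mono (hmem j (by omega)).2) (ℱ.le _) h2 hinc ?_, ?_⟩
    · have : 0 ≤ s - t := by linarith
      positivity
    · refine (h2.mono hmm le_rfl).add
        ((measurable_smul_const_left (c j)).comp (Measurable.sub ?_ ?_))
      · exact (hW.adapted _ (hmem (j + 1) hj)).measurable
      · exact (hW.adapted _ (hmem j (by omega))).measurable.mono hmm le_rfl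

/-- The sums `∑ κ ΔI` over a fixed partition, for `I` a stochastic integral of `g`. -/
theorem isIndepGaussian_sum_smul_sub (hW : IsReverseWiener μ ℱ t s W) (hts : t ≤ s)
    {g κ : ℝ → ℝ} (hg : ContinuousOn g (Icc t s)) {I : ℝ → Ω → EuclideanSpace ℝ (Fin d)}
    (hIs : ∀ ω, I s ω = 0) (hI : ∀ u ∈ Icc t s, IsStochIntegral μ g W s u (I u)) {n : ℕ}
    (hn : n ≠ 0) :
    IsIndepGaussian μ (ℱ (OrderDual.toDual s))
      (∑ i ∈ Finset.range n, ∫ v in gridPoint s t n (i + 1)..gridPoint s t n i,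
        κ (gridPoint s t n i) ^ 2 * g v ^ 2)
      (fun ω => ∑ i ∈ Finset.range n, κ (gridPoint s t n i) •
        (I (gridPoint s t n (i + 1)) ω - I (gridPoint s t n i) ω)) := by
  have hmem : ∀ i ≤ n, gridPoint s t n i ∈ Icc t s := fun i hi => by
    have := gridPoint_mem_uIcc s t hi
    rwa [uIcc_of_ge hts] at this
  -- `G i k` is the Riemann sum for I at the i-th coarse point with i * k steps, written on the
  -- common grid of n * k steps. Differences of consecutive `G i k` are therefore sums over single
  -- coarse cells.
  let G : ℕ → ℕ → Ω → EuclideanSpace ℝ (Fin d) := fun i k ω =>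
    ∑ j ∈ Finset.range (i * k), g (gridPoint s t (n * k) j) •
      (W (gridPoint s t (n * k) (j + 1)) ω - W (gridPoint s t (n * k) j) ω)
  have hG : ∀ i ≤ n, TendstoInMeasure μ (G i) atTop (I (gridPoint s t n i)) := by
    intro i hi
    rcases Nat.eq_zero_or_pos i with rfl | hi0
    · have h0 : I (gridPoint s t n 0) = fun _ => 0 := by
        funext ω; rw [gridPoint_zero]; exact hIs ω
      rw [h0]
      simpa [G] using tendstoInMeasure_const (l := atTop)
        (fun _ : Ω => (0 : EuclideanSpace ℝ (Fin d)))
    · have h1 := (hI _ (hmem i hi))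
      have h2 := TendstoInMeasure.comp (ns := fun k : ℕ => i * k) h1
        (tendsto_id.const_mul_atTop' hi0)
      refine h2.congr_left fun k => Eventually.of_forall fun ω => ?_
      refine Finset.sum_congr rfl fun j _ => ?_
      have e1 := gridPoint_gridPoint (a := s) (b := t) (n := n) (k := k) hi0.ne' j
      have e2 := gridPoint_gridPoint (a := s) (b := t) (n := n) (k := k) hi0.ne' (j + 1)
      rw [← e1, ← e2]
      rfl
  let Q : ℕ → Ω → EuclideanSpace ℝ (Fin d) := fun k ω =>
    ∑ i ∈ Finset.range n, κ (gridPoint s t n i) • (G (i + 1) k ω + (-1 : ℝ) • G i k ω)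
  have hQ : TendstoInMeasure μ Q atTop (fun ω => ∑ i ∈ Finset.range n, κ (gridPoint s t n i) •
        (I (gridPoint s t n (i + 1)) ω + (-1 : ℝ) • I (gridPoint s t n i) ω)) :=
    tendstoInMeasure_sum n fun i hi => tendstoInMeasure_const_smul
      (tendstoInMeasure_add (hG (i + 1) hi) (tendstoInMeasure_const_smul (hG i hi.le) _)) _
  simp only [neg_one_smul, ← sub_eq_add_neg] at hQ
  -- The variance of `Q k`: κ is frozen on coarse cells while g is sampled on the fine grid, so a
  -- Riemann sum for g² appears in each cell.
  let V : ℕ → ℝ := fun k => ∑ i ∈ Finset.range n, ∑ l ∈ Finset.range k,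
    (κ (gridPoint s t n i) * g (gridPoint s t (n * k) (i * k + l))) ^ 2
      * ((s - t) / (n * k : ℕ))
  have hV : Tendsto V atTop (nhds (∑ i ∈ Finset.range n,
      ∫ v in gridPoint s t n (i + 1)..gridPoint s t n i, κ (gridPoint s t n i) ^ 2 * g v ^ 2)) := by
    refine tendsto_finsetSum _ fun i hi => ?_
    have hi' := Finset.mem_range.1 hi
    have hsub : uIcc (gridPoint s t n i) (gridPoint s t n (i + 1)) ⊆ Icc t s := by
      rw [← uIcc_of_ge hts]
      exact uIcc_subset_uIcc (gridPoint_mem_uIcc s t hi'.le) (gridPoint_mem_uIcc s t hi')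
    have h1 := (tendsto_riemann_sum_gridPoint (a := gridPoint s t n i)
      (b := gridPoint s t n (i + 1)) (h := fun v => κ (gridPoint s t n i) ^ 2 * g v ^ 2)
      (((hg.mono hsub).pow 2).const_mul _)).neg
    rw [← intervalIntegral.integral_symm] at h1
    refine h1.congr' ?_
    filter_upwards [eventually_ne_atTop 0] with k hk
    rw [← Finset.sum_neg_distrib]
    refine Finset.sum_congr rfl fun l _ => ?_
    rw [gridPoint_cell hk, gridPoint_succ_sub, smul_eq_mul]
    push_cast
    field_simp
    ring
  -- The shift to k + 1 avoids cells with no fine steps.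
  refine IsIndepGaussian.of_tendstoInMeasure (Y := fun k => Q (k + 1)) (v := fun k => V (k + 1))
    (fun k => ?_) (hV.comp (tendsto_add_atTop_nat 1)) (hQ.comp (tendsto_add_atTop_nat 1))
  -- Integer division of the fine index j by k + 1 recovers the coarse cell that contains it.
  have h := (hW.isIndepGaussian_sum hts (n * (k + 1))
    (fun j => κ (gridPoint s t n (j / (k + 1))) * g (gridPoint s t (n * (k + 1)) j)) le_rfl).1
  have hdiv : ∀ i l, l ∈ Finset.range (k + 1) → (i * (k + 1) + l) / (k + 1) = i := by
    intro i l hl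
    rw [mul_comm, Nat.mul_add_div (Nat.succ_pos k), Nat.div_eq_of_lt (Finset.mem_range.1 hl),
      add_zero]
  rw [Finset.sum_range_mul_eq_sum_sum] at h
  simp_rw [Finset.sum_range_mul_eq_sum_sum] at h
  convert! h using 1
  · refine Finset.sum_congr rfl fun i _ => Finset.sum_congr rfl fun l hl => ?_
    rw [hdiv i l hl]
  · funext ω
    refine Finset.sum_congr rfl fun i _ => ?_
    simp only [G, Nat.succ_mul i]
    rw [Finset.sum_range_add, neg_one_smul, add_neg_cancel_comm, Finset.smul_sum]
    refine Finset.sum_congr rfl fun l hl => ?_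
    rw [hdiv i l hl, smul_smul]

/-- Integration by parts: `∫ κ dI` for a continuous stochastic integral `I = ∫ g dW` and a
`C¹` weight `κ` is Gaussian with variance `∫ κ² g²`, and independent of the past. -/
theorem isIndepGaussian_smul_sub_integral (hW : IsReverseWiener μ ℱ t s W) (hts : t ≤ s)
    {g κ κ' : ℝ → ℝ} (hg : ContinuousOn g (Icc t s)) (hκ' : ContinuousOn κ' (Icc t s))
    (hκ : ∀ u ∈ Icc t s, HasDerivWithinAt κ (κ' u) (Icc t s) u)
    {I : ℝ → Ω → EuclideanSpace ℝ (Fin d)}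
    (hIs : ∀ ω, I s ω = 0) (hI : ∀ u ∈ Icc t s, IsStochIntegral μ g W s u (I u))
    (hIc : ∀ᵐ ω ∂μ, ContinuousOn (fun u => I u ω) (Icc t s)) :
    IsIndepGaussian μ (ℱ (OrderDual.toDual s)) (∫ u in t..s, κ u ^ 2 * g u ^ 2)
      (fun ω => κ t • I t ω - ∫ u in s..t, κ' u • I u ω) := by
  have huI : uIcc s t = Icc t s := uIcc_of_ge hts
  have hκc : ContinuousOn κ (Icc t s) := fun u hu => (hκ u hu).continuousWithinAt
  refine IsIndepGaussian.of_tendsto_ae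
    (fun n => isIndepGaussian_sum_smul_sub (κ := κ) hW hts hg hIs hI (Nat.succ_ne_zero n)) ?_ ?_
  -- The variances converge, with κ sampled at the start of each step (`e := 0`). The sign accounts
  -- for the grid running downwards from s to t.
  · have h := (tendsto_sum_integral_gridPoint (a := s) (b := t) (e := 0)
      (H := fun p v => κ p ^ 2 * g v ^ 2) ?_ (by norm_num)).neg
    · rw [← intervalIntegral.integral_symm] at h
      refine (h.comp (tendsto_add_atTop_nat 1)).congr fun n => ?_
      simp only [Function.comp_apply, add_zero]
      rw [← Finset.sum_neg_distrib]
      exact Finset.sum_congr rfl fun i _ => (intervalIntegral.integral_symm _ _).symm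
    · rw [huI]
      exact ((hκc.comp continuousOn_fst fun p hp => hp.1).pow 2).mul
        ((hg.comp continuousOn_snd fun p hp => hp.2).pow 2)
  · filter_upwards [hIc] with ω hω
    -- Along a continuous path, Abel summation leaves I at the end of each step (`e := 1`) times an
    -- increment of κ, which is the integral of κ' over the step.
    have h := (tendsto_sum_integral_gridPoint (a := s) (b := t) (e := 1)
      (H := fun p v => κ' v • I p ω) ?_ le_rfl)
    · refine ((h.const_sub (κ t • I t ω)).comp (tendsto_add_atTop_nat 1)).congr fun n => ?_
      simp only [Function.comp_apply]
      have hbp := sum_range_smul_sub_by_parts (fun i => κ (gridPoint s t (n + 1) i))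
        (fun i => I (gridPoint s t (n + 1) i) ω) (n + 1)
      simp only [gridPoint_self s t (Nat.succ_ne_zero n), gridPoint_zero, hIs, smul_zero,
        sub_zero] at hbp
      rw [Nat.succ_eq_add_one, hbp]
      congr 1
      refine Finset.sum_congr rfl fun i hi => ?_
      have hi' := Finset.mem_range.1 hi
      have hsub : Icc (gridPoint s t (n + 1) (i + 1)) (gridPoint s t (n + 1) i) ⊆ Icc t s := by
        rw [← huI, ← uIcc_of_ge (gridPoint_succ_le hts (n + 1) i)]
        exact uIcc_subset_uIcc (gridPoint_mem_uIcc s t hi'.le) (gridPoint_mem_uIcc s t hi')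
      rw [intervalIntegral.integral_smul_const]
      congr 1
      have hle := gridPoint_succ_le hts (n + 1) i
      have hF := intervalIntegral.integral_eq_sub_of_hasDerivAt_of_le hle (hκc.mono hsub)
        (f' := κ') (fun u hu => ?_) ((hκ'.mono hsub).intervalIntegrable_of_Icc hle)
      · rw [intervalIntegral.integral_symm, hF, neg_sub]
      · have hl := (hsub (left_mem_Icc.2 hle)).1
        have hr := (hsub (right_mem_Icc.2 hle)).2
        exact (hκ u ⟨hl.trans hu.1.le, hu.2.le.trans hr⟩).hasDerivAt
          (Icc_mem_nhds (hl.trans_lt hu.1) (hu.2.trans_le hr))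
    · rw [huI]
      exact (hκ'.comp continuousOn_snd fun p hp => hp.2).smul
        (hω.comp continuousOn_fst fun p hp => hp.1)

theorem isIndepGaussian_of_isStochIntegral (hW : IsReverseWiener μ ℱ t s W) (hts : t ≤ s)
    {g : ℝ → ℝ} (hg : ContinuousOn g (Icc t s)) {I : ℝ → Ω → EuclideanSpace ℝ (Fin d)}
    (hIs : ∀ ω, I s ω = 0) (hI : ∀ u ∈ Icc t s, IsStochIntegral μ g W s u (I u))
    (hIc : ∀ᵐ ω ∂μ, ContinuousOn (fun u => I u ω) (Icc t s)) :
    IsIndepGaussian μ (ℱ (OrderDual.toDual s)) (∫ u in t..s, g u ^ 2) (I t) := by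
  have := isIndepGaussian_smul_sub_integral (κ := fun _ => 1) (κ' := fun _ => 0) hW hts hg
    continuousOn_const (fun u _ => hasDerivWithinAt_const _ _ _) hIs hI hIc
  simpa using this

end StochIntegral
end

/-! ### Variation of constants and the exact solution for σ_t > 0 -/

noncomputable section

set_option linter.unusedSectionVars false

/-- Variation of constants: `κ I - ∫ κ' I` for the remainder `I u = x u - x s - ∫_s^u b`. -/
theorem smul_sub_integral_smul_remainder {E : Type*} [NormedAddCommGroup E] [NormedSpace ℝ E]
    [CompleteSpace E] {t s : ℝ} (hts : t ≤ s) {κ κ' : ℝ → ℝ} {x b : ℝ → E}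
    (hκ' : ContinuousOn κ' (Icc t s))
    (hκ : ∀ u ∈ Icc t s, HasDerivWithinAt κ (κ' u) (Icc t s) u)
    (hx : ContinuousOn x (Icc t s)) (hb : ContinuousOn b (Icc t s)) :
    κ t • (x t - x s - ∫ v in s..t, b v)
        - ∫ u in s..t, κ' u • (x u - x s - ∫ v in s..u, b v)
      = κ t • x t - κ s • x s - ∫ u in s..t, (κ' u • x u + κ u • b u) := by
  have hκc : ContinuousOn κ (Icc t s) := fun u hu => (hκ u hu).continuousWithinAt
  have huI : uIcc s t = Icc t s := uIcc_of_ge hts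
  have hbi : IntervalIntegrable b volume s t := by
    rw [← huI] at hb; exact hb.intervalIntegrable
  have hprim : ContinuousOn (fun u => ∫ v in s..u, b v) (Icc t s) := by
    have := intervalIntegral.continuousOn_primitive_interval' hbi left_mem_uIcc
    rwa [huI] at this
  set B : ℝ → E := fun u => ∫ v in s..u, b v with hB
  -- The path x is not differentiable, but x_s + B is, so the product rule applies to κ (x_s + B).
  -- The terms in which x itself occurs match algebraically.
  have hF : ∫ u in t..s, (κ' u • (x s + B u) + κ u • b u)
      = κ s • (x s + B s) - κ t • (x s + B t) := by
    refine intervalIntegral.integral_eq_sub_of_hasDerivAt_of_le hts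
      (hκc.smul (continuousOn_const.add hprim)) (fun u hu => ?_) ?_
    · have hu' : Icc t s ∈ nhds u := Icc_mem_nhds hu.1 hu.2
      have h1 : HasDerivAt B (b u) u := by
        refine intervalIntegral.integral_hasDerivAt_right ?_
          (hb.stronglyMeasurableAtFilter_nhdsWithin measurableSet_Icc u |>.filter_mono ?_)
          (hb.continuousAt hu')
        · refine hbi.mono_set ?_
          rw [huI, uIcc_of_ge hu.2.le]
          exact Icc_subset_Icc_left hu.1.le
        · rw [nhdsWithin_eq_nhds.2 hu']
      have h2 := ((hκ u (Ioo_subset_Icc_self hu)).hasDerivAt hu').smul (h1.const_add (x s))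
      refine h2.congr_deriv ?_
      rw [add_comm]
    · exact ((hκ'.smul (continuousOn_const.add hprim)).add
        (hκc.smul hb)).intervalIntegrable_of_Icc hts
  have hI1 : IntervalIntegrable (fun u => κ' u • (x s + B u) + κ u • b u) volume s t :=
    ((hκ'.smul (continuousOn_const.add hprim)).add
      (hκc.smul hb)).intervalIntegrable_of_Icc hts |>.symm
  have hI2 : IntervalIntegrable (fun u => κ' u • (x u - x s - B u)) volume s t :=
    (hκ'.smul ((hx.sub continuousOn_const).sub hprim)).intervalIntegrable_of_Icc hts |>.symm
  have hsum : ∫ u in s..t, (κ' u • x u + κ u • b u)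
      = (∫ u in s..t, κ' u • (x u - x s - B u))
        + ∫ u in s..t, (κ' u • (x s + B u) + κ u • b u) := by
    rw [← intervalIntegral.integral_add hI2 hI1]
    congr 1
    funext u
    module
  rw [hsum, intervalIntegral.integral_symm t s (f := fun u => κ' u • (x s + B u) + κ u • b u), hF]
  have hBs : B s = 0 := by simp [hB]
  rw [hBs]
  module

section Exact

variable {d : ℕ} {S : BridgeSchedule}
    {D : EuclideanSpace ℝ (Fin d) → ℝ → EuclideanSpace ℝ (Fin d) → ℝ → EuclideanSpace ℝ (Fin d)}
    {xT : EuclideanSpace ℝ (Fin d)} {t s : ℝ}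
    {Ω : Type*} {mΩ : MeasurableSpace Ω} {μ : Measure Ω} [IsProbabilityMeasure μ]
    {ℱ : Filtration ℝᵒᵈ mΩ} {W X : ℝ → Ω → EuclideanSpace ℝ (Fin d)}

/-- The martingale part `X_u - X_s - ∫_s^u (drift)` of a solution of the Bridge SDE. -/
def bridgeNoise (S : BridgeSchedule)
    (D : EuclideanSpace ℝ (Fin d) → ℝ → EuclideanSpace ℝ (Fin d) → ℝ → EuclideanSpace ℝ (Fin d))
    (xT : EuclideanSpace ℝ (Fin d)) (s : ℝ) (X : ℝ → Ω → EuclideanSpace ℝ (Fin d)) (u : ℝ) (ω : Ω) :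
    EuclideanSpace ℝ (Fin d) :=
  X u ω - X s ω - ∫ v in s..u, S.reducedDrift v (X v ω) (D (X v ω) v xT S.T)

theorem bridgeNoise_self (ω : Ω) : bridgeNoise S D xT s X s ω = 0 := by
  simp [bridgeNoise]

/-- The two drifts agree on the open interval (0, T). The endpoint s, which may be the singular time
T, is a null set. -/
theorem integral_bridgeDrift_eq {u : ℝ} (hu : 0 ≤ u) (hus : u ≤ s) (hs : s ≤ S.T)
    (x : ℝ → EuclideanSpace ℝ (Fin d)) :
    ∫ v in s..u, S.bridgeDrift D xT (x v) v
      = ∫ v in s..u, S.reducedDrift v (x v) (D (x v) v xT S.T) := by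
  refine intervalIntegral.integral_congr_ae' ?_ ?_
  · refine Eventually.of_forall fun v hv => ?_
    rw [Ioc_eq_empty (not_lt.mpr hus)] at hv
    exact hv.elim
  · have : ∀ᵐ v : ℝ, v ≠ s := by simp [ae_iff, measure_singleton]
    filter_upwards [this] with v hv hv'
    exact S.bridgeDrift_eq D xT (x v)
      ⟨hu.trans_lt hv'.1, (lt_of_le_of_ne hv'.2 hv).trans_le hs⟩

theorem IsBridgeSDESolution.isStochIntegral_bridgeNoise
    (hX : IsBridgeSDESolution μ S D xT ℱ t s W X) (ht : 0 ≤ t) (hs : s ≤ S.T) {u : ℝ}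
    (hu : u ∈ Icc t s) : IsStochIntegral μ S.g W s u (bridgeNoise S D xT s X u) := by
  have h := hX.eqn u hu
  have he : (fun ω => X u ω - X s ω - ∫ v in s..u, S.bridgeDrift D xT (X v ω) v)
      = bridgeNoise S D xT s X u := by
    funext ω
    rw [bridgeNoise, integral_bridgeDrift_eq (ht.trans hu.1) hu.2 hs fun v => X v ω]
  rwa [he] at h

theorem IsBridgeSDESolution.mono {t' : ℝ} (hX : IsBridgeSDESolution μ S D xT ℱ t s W X)
    (ht : t ≤ t') (hts : t' ≤ s) : IsBridgeSDESolution μ S D xT ℱ t' s W X where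
  wiener := hX.wiener.mono ht
  adapted u hu := hX.adapted u ⟨ht.trans hu.1, hu.2⟩
  cont := hX.cont.mono fun _ h => h.mono (Icc_subset_Icc_left ht)
  drift_integrable := hX.drift_integrable.mono fun _ h => h.mono_set (by
    rw [uIcc_of_le hts, uIcc_of_le (ht.trans hts)]; exact Icc_subset_Icc_left ht)
  eqn u hu := hX.eqn u ⟨ht.trans hu.1, hu.2⟩

theorem continuousOn_predictor
    (hD : ContinuousOn (fun q : EuclideanSpace ℝ (Fin d) × ℝ => D q.1 q.2 xT S.T)
      (Set.univ ×ˢ Set.Icc 0 S.T)) (ht : 0 ≤ t) (hs : s ≤ S.T)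
    {x : ℝ → EuclideanSpace ℝ (Fin d)} (hx : ContinuousOn x (Icc t s)) :
    ContinuousOn (fun u => D (x u) u xT S.T) (Icc t s) :=
  hD.comp (f := fun u => (x u, u)) (hx.prodMk continuousOn_id)
    fun _ hu => ⟨mem_univ _, ht.trans hu.1, hu.2.trans hs⟩

theorem continuousOn_reducedDrift {δ : ℝ} (hδ : δ ∈ Icc 0 S.T) (hσ : 0 < S.σ δ) (hδt : δ ≤ t)
    (hs : s ≤ S.T) {x p : ℝ → EuclideanSpace ℝ (Fin d)} (hx : ContinuousOn x (Icc t s))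
    (hp : ContinuousOn p (Icc t s)) :
    ContinuousOn (fun u => S.reducedDrift u (x u) (p u)) (Icc t s) := by
  have hsub : Icc t s ⊆ Icc δ S.T := Icc_subset_Icc hδt hs
  have hsub' : Icc t s ⊆ Icc 0 S.T := hsub.trans (Icc_subset_Icc_left hδ.1)
  exact ((S.f_cont.mono hsub').smul hx).add
    (((S.continuousOn_pullRate hδ hσ).mono hsub).smul
      (hx.sub ((S.continuousOn_α.mono hsub').smul hp)))

theorem continuousOn_bridgeNoise
    (hD : ContinuousOn (fun q : EuclideanSpace ℝ (Fin d) × ℝ => D q.1 q.2 xT S.T)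
      (Set.univ ×ˢ Set.Icc 0 S.T)) (ht : 0 ≤ t) (hσ : 0 < S.σ t) (hts : t ≤ s) (hs : s ≤ S.T)
    {ω : Ω} (hx : ContinuousOn (fun u => X u ω) (Icc t s)) :
    ContinuousOn (fun u => bridgeNoise S D xT s X u ω) (Icc t s) := by
  have hb := continuousOn_reducedDrift ⟨ht, hts.trans hs⟩ hσ le_rfl hs hx
    (continuousOn_predictor hD ht hs hx)
  have huI : uIcc s t = Icc t s := uIcc_of_ge hts
  have hbi := (hb.intervalIntegrable_of_Icc hts (μ := volume)).symm
  have := intervalIntegral.continuousOn_primitive_interval' hbi left_mem_uIcc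
  rw [huI] at this
  exact (hx.sub continuousOn_const).sub this

theorem isIndepGaussian_bridgeNoise
    (hD : ContinuousOn (fun q : EuclideanSpace ℝ (Fin d) × ℝ => D q.1 q.2 xT S.T)
      (Set.univ ×ˢ Set.Icc 0 S.T)) (ht : 0 ≤ t) (hσ : 0 < S.σ t) (hs : s ≤ S.T)
    (hX : IsBridgeSDESolution μ S D xT ℱ t s W X) {u : ℝ} (hu : u ∈ Icc t s) :
    IsIndepGaussian μ (ℱ (OrderDual.toDual s)) (∫ v in u..s, S.g v ^ 2)
      (bridgeNoise S D xT s X u) := by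
  have hX' := hX.mono hu.1 hu.2
  have hσu := S.σ_pos_of_le ⟨ht, (hu.1.trans hu.2).trans hs⟩ hσ ⟨hu.1, hu.2.trans hs⟩
  refine isIndepGaussian_of_isStochIntegral hX'.wiener hu.2
    (S.g_cont.mono (Icc_subset_Icc (ht.trans hu.1) hs)) bridgeNoise_self
    (fun v hv => hX'.isStochIntegral_bridgeNoise (ht.trans hu.1) hs hv) ?_
  filter_upwards [hX'.cont] with ω hω
  exact continuousOn_bridgeNoise hD (ht.trans hu.1) hσu hu.2 hs hω

/-- The weighted martingale part of the Bridge SDE is `√(SNR_t - SNR_s)` times a standard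
Gaussian vector. -/
theorem isIndepGaussian_intFactor
    (hD : ContinuousOn (fun q : EuclideanSpace ℝ (Fin d) × ℝ => D q.1 q.2 xT S.T)
      (Set.univ ×ˢ Set.Icc 0 S.T)) (ht : 0 ≤ t) (hσ : 0 < S.σ t) (hts : t ≤ s) (hs : s ≤ S.T)
    (hX : IsBridgeSDESolution μ S D xT ℱ t s W X) :
    IsIndepGaussian μ (ℱ (OrderDual.toDual s)) (S.snr t - S.snr s)
      (fun ω => S.intFactor t • X t ω - S.intFactor s • X s ω
        - ∫ u in t..s, S.snrRate u • D (X u ω) u xT S.T) := by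
  have htT : t ∈ Icc 0 S.T := ⟨ht, hts.trans hs⟩
  have hsub : Icc t s ⊆ Icc t S.T := Icc_subset_Icc_right hs
  have hsub' : Icc t s ⊆ Icc 0 S.T := Icc_subset_Icc ht hs
  have hκ' : ContinuousOn (fun u => -(S.intFactor u * (S.f u + S.pullRate u))) (Icc t s) :=
    (((S.continuousOn_intFactor htT hσ).mono hsub).mul ((S.f_cont.mono hsub').add
      ((S.continuousOn_pullRate htT hσ).mono hsub))).neg
  have hκ : ∀ u ∈ Icc t s, HasDerivWithinAt S.intFactor
      (-(S.intFactor u * (S.f u + S.pullRate u))) (Icc t s) u := fun u hu =>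
    (S.hasDerivWithinAt_intFactor (hsub' hu) (S.σ_pos_of_le htT hσ (hsub hu))).mono hsub'
  have h := isIndepGaussian_smul_sub_integral hX.wiener hts (S.g_cont.mono hsub') hκ' hκ
    (I := bridgeNoise S D xT s X) bridgeNoise_self
    (fun u hu => hX.isStochIntegral_bridgeNoise ht hs hu)
    (by filter_upwards [hX.cont] with ω hω using continuousOn_bridgeNoise hD ht hσ hts hs hω)
  -- κ² g² = -SNR', so the variance integrates to SNR_t - SNR_s.
  simp_rw [← S.snrRate_eq] at h
  rw [S.integral_snrRate htT hσ hts hs] at h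
  refine h.congr ?_
  filter_upwards [hX.cont] with ω hω
  have hp := continuousOn_predictor hD ht hs hω
  rw [show S.intFactor t • bridgeNoise S D xT s X t ω = _ from rfl]
  have := smul_sub_integral_smul_remainder hts hκ' hκ hω
    (continuousOn_reducedDrift htT hσ le_rfl hs hω hp)
  simp only [bridgeNoise]
  rw [this, intervalIntegral.integral_symm t s, ← intervalIntegral.integral_neg]
  congr 1
  refine intervalIntegral.integral_congr fun u _ => ?_
  simp only [BridgeSchedule.reducedDrift]
  -- In κ' x + κ b the terms in x cancel by the choice of κ, and -κ (g²/σ²) α D remains.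
  have hr : S.snrRate u = S.intFactor u * S.pullRate u * S.α u := by
    unfold BridgeSchedule.snrRate BridgeSchedule.intFactor BridgeSchedule.pullRate; ring
  rw [hr]
  module

/-- When the noise coefficient of the formula vanishes, the equation does not determine z. A
normalised Wiener increment over [t, s] then supplies one without enlarging the probability space.
-/
theorem exists_stdGaussian (hts : t < s) (hW : IsReverseWiener μ ℱ t s W) :
    ∃ z : Ω → EuclideanSpace ℝ (Fin d), IsIndepGaussian μ (ℱ (OrderDual.toDual s)) 1 z := by
  have h := (hW.isIndepGaussian_sub le_rfl hts.le le_rfl).const_smul (Real.sqrt (s - t))⁻¹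
  rw [inv_pow, Real.sq_sqrt (sub_nonneg.2 hts.le), inv_mul_cancel₀ (sub_pos.2 hts).ne'] at h
  exact ⟨_, h⟩

theorem exists_exact_solution_of_pos
    (hD : ContinuousOn (fun q : EuclideanSpace ℝ (Fin d) × ℝ => D q.1 q.2 xT S.T)
      (Set.univ ×ˢ Set.Icc 0 S.T)) (ht : 0 ≤ t) (hσ : 0 < S.σ t) (hts : t < s) (hs : s ≤ S.T)
    (hX : IsBridgeSDESolution μ S D xT ℱ t s W X) :
    ∃ z : Ω → EuclideanSpace ℝ (Fin d), IsIndepGaussian μ (ℱ (OrderDual.toDual s)) 1 z ∧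
      ∀ᵐ ω ∂μ, X t ω = (S.snr s / S.snr t * (S.α t / S.α s)) • X s ω
            + S.eiDataTerm t s (fun u => D (X u ω) u xT S.T)
            + (S.σ t * Real.sqrt (1 - S.snr s / S.snr t)) • z ω := by
  have htT : t ∈ Icc 0 S.T := ⟨ht, hts.le.trans hs⟩
  have hsT : s ∈ Icc 0 S.T := ⟨ht.trans hts.le, hs⟩
  have hG := isIndepGaussian_intFactor hD ht hσ hts.le hs hX
  set N : Ω → EuclideanSpace ℝ (Fin d) := fun ω => S.intFactor t • X t ω
    - S.intFactor s • X s ω - ∫ u in t..s, S.snrRate u • D (X u ω) u xT S.T with hN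
  have hV : 0 ≤ S.snr t - S.snr s := sub_nonneg.2 (S.snr_le htT hσ hts.le hs)
  have hαt := S.α_pos t htT
  have hαs := S.α_pos s hsT
  have hσs := S.σ_pos s ⟨ht.trans_lt hts, hs⟩
  have hsnr := S.snr_pos htT hσ
  obtain ⟨z, hz, hzN⟩ : ∃ z : Ω → EuclideanSpace ℝ (Fin d),
      IsIndepGaussian μ (ℱ (OrderDual.toDual s)) 1 z ∧
      ∀ᵐ ω ∂μ, N ω = Real.sqrt (S.snr t - S.snr s) • z ω := by
    -- SNR need not decrease strictly, since g may vanish on [t, s]. In that case N has variance 0,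
    -- and any standard Gaussian independent of the past will do.
    rcases hV.eq_or_lt with h0 | hpos
    · obtain ⟨z, hz⟩ := exists_stdGaussian hts hX.wiener
      refine ⟨z, hz, ?_⟩
      rw [← h0] at hG ⊢
      simpa using hG.ae_eq_zero
    · have h := hG.const_smul (Real.sqrt (S.snr t - S.snr s))⁻¹
      rw [inv_pow, Real.sq_sqrt hV, inv_mul_cancel₀ hpos.ne'] at h
      refine ⟨_, h, Eventually.of_forall fun ω => ?_⟩
      rw [smul_smul, mul_inv_cancel₀ (Real.sqrt_pos.2 hpos).ne', one_smul]
  refine ⟨z, hz, ?_⟩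
  filter_upwards [hzN] with ω hω
  rw [S.eiDataTerm_eq ht hσ hts.le hs]
  have hsol : S.intFactor t • X t ω = S.intFactor s • X s ω
      + (∫ u in t..s, S.snrRate u • D (X u ω) u xT S.T)
      + Real.sqrt (S.snr t - S.snr s) • z ω := by
    rw [← hω]; simp only [hN]; module
  -- α_t/SNR_t is the inverse of the integrating factor at t; multiplication by it solves for X_t.
  have hinv : S.α t / S.snr t * S.intFactor t = 1 := by
    rw [S.div_snr, BridgeSchedule.intFactor]
    field_simp
  have hsnoise : S.σ t * Real.sqrt (1 - S.snr s / S.snr t)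
      = S.α t / S.snr t * Real.sqrt (S.snr t - S.snr s) := by
    have h1 : S.snr t - S.snr s = (S.α t / S.σ t) ^ 2 * (1 - S.snr s / S.snr t) := by
      rw [div_pow]
      change _ = S.snr t * _
      field_simp
    rw [h1, Real.sqrt_mul (sq_nonneg _), Real.sqrt_sq (by positivity), S.div_snr]
    field_simp
  have hlin : S.snr s / S.snr t * (S.α t / S.α s) = S.α t / S.snr t * S.intFactor s := by
    unfold BridgeSchedule.snr BridgeSchedule.intFactor
    field_simp
  rw [hsnoise, hlin]
  simp only [mul_smul (S.α t / S.snr t)]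
  rw [← smul_add, ← smul_add, ← hsol, smul_smul, hinv, one_smul]

end Exact
end

/-! ### The exact solution when σ_t = 0 -/

noncomputable section

set_option linter.unusedSectionVars false

section Zero

variable {d : ℕ} {S : BridgeSchedule}
    {D : EuclideanSpace ℝ (Fin d) → ℝ → EuclideanSpace ℝ (Fin d) → ℝ → EuclideanSpace ℝ (Fin d)}
    {xT : EuclideanSpace ℝ (Fin d)} {t s : ℝ}
    {Ω : Type*} {mΩ : MeasurableSpace Ω} {μ : Measure Ω} [IsProbabilityMeasure μ]
    {ℱ : Filtration ℝᵒᵈ mΩ} {W X : ℝ → Ω → EuclideanSpace ℝ (Fin d)}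

theorem BridgeSchedule.tendsto_σ_sq_zero (h0 : S.σ 0 = 0) {r : ℕ → ℝ}
    (hr : ∀ n, r n ∈ Icc 0 S.T) (hr0 : Tendsto r atTop (nhds 0)) :
    Tendsto (fun n => S.σ (r n) ^ 2) atTop (nhds 0) := by
  have h := (S.continuousOn_σ_sq 0 ⟨le_rfl, S.T_pos.le⟩).tendsto.comp
    (tendsto_nhdsWithin_iff.2 ⟨hr0, Eventually.of_forall hr⟩)
  simpa [h0, Function.comp_def] using h

theorem BridgeSchedule.tendsto_α_zero {r : ℕ → ℝ}
    (hr : ∀ n, r n ∈ Icc 0 S.T) (hr0 : Tendsto r atTop (nhds 0)) :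
    Tendsto (fun n => S.α (r n)) atTop (nhds (S.α 0)) :=
  (S.continuousOn_α 0 ⟨le_rfl, S.T_pos.le⟩).tendsto.comp
    (tendsto_nhdsWithin_iff.2 ⟨hr0, Eventually.of_forall hr⟩)

theorem BridgeSchedule.tendsto_inv_snr_zero (h0 : S.σ 0 = 0) {r : ℕ → ℝ}
    (hr : ∀ n, r n ∈ Icc 0 S.T) (hr0 : Tendsto r atTop (nhds 0)) :
    Tendsto (fun n => (S.snr (r n))⁻¹) atTop (nhds 0) := by
  have hα : S.α 0 ≠ 0 := (S.α_pos 0 ⟨le_rfl, S.T_pos.le⟩).ne'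
  have h := (S.tendsto_σ_sq_zero h0 hr hr0).div ((S.tendsto_α_zero hr hr0).pow 2)
    (pow_ne_zero 2 hα)
  rw [zero_div] at h
  exact h.congr fun n => by simp [BridgeSchedule.snr]

/-- If `σ_0 = 0`, the data term at time `r → 0` picks the prediction at time `0`. -/
theorem BridgeSchedule.tendsto_data_term (h0 : S.σ 0 = 0) (hs0 : 0 < s) (hs : s ≤ S.T)
    {r : ℕ → ℝ} (hr : ∀ n, r n ∈ Ioo 0 s) (hr0 : Tendsto r atTop (nhds 0))
    {p : ℝ → EuclideanSpace ℝ (Fin d)} (hp : ContinuousOn p (Icc 0 s)) :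
    Tendsto (fun n => S.eiDataTerm (r n) s p) atTop (nhds (S.α 0 • p 0)) := by
  have hrT : ∀ n, r n ∈ Icc 0 S.T := fun n => ⟨(hr n).1.le, (hr n).2.le.trans hs⟩
  have hσ : ∀ n, 0 < S.σ (r n) := fun n => S.σ_pos _ ⟨(hr n).1, (hrT n).2⟩
  have hinv := S.tendsto_inv_snr_zero h0 hrT hr0
  have hα := S.tendsto_α_zero hrT hr0
  have hint : ∀ {a b : ℝ} {q : ℝ → EuclideanSpace ℝ (Fin d)}, 0 < a → a ≤ b → b ≤ s →
      ContinuousOn q (Icc 0 s) →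
      IntervalIntegrable (fun u => S.snrRate u • q u) volume a b := by
    intro a b q ha hab hb hq
    refine ContinuousOn.intervalIntegrable_of_Icc hab (ContinuousOn.fun_smul ?_ ?_)
    · exact (S.continuousOn_snrRate ⟨ha.le, hab.trans (hb.trans hs)⟩
        (S.σ_pos a ⟨ha, hab.trans (hb.trans hs)⟩)).mono (Icc_subset_Icc_right (hb.trans hs))
    · exact hq.mono (Icc_subset_Icc ha.le hb)
  -- The weights -SNR'_u/SNR_r on [r, s] have total mass 1 - SNR_s/SNR_r → 1. After subtraction of
  -- the constant p(0), it remains to show that their integral against q, where q(0) = 0, tends to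
  -- 0.
  set q : ℝ → EuclideanSpace ℝ (Fin d) := fun u => p u - p 0 with hq
  have hqc : ContinuousOn q (Icc 0 s) := hp.sub continuousOn_const
  have hsplit : ∀ n, S.eiDataTerm (r n) s p
      = (S.α (r n) * (S.snr (r n))⁻¹) • (∫ u in r n..s, S.snrRate u • q u)
        + (S.α (r n) * (1 - S.snr s * (S.snr (r n))⁻¹)) • p 0 := by
    intro n
    rw [← div_eq_mul_inv, ← div_eq_mul_inv,
      ← S.eiDataTerm_const (hr n).1.le (hr n).2 hs (p 0),
      S.eiDataTerm_eq (hr n).1.le (hσ n) (hr n).2.le hs,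
      S.eiDataTerm_eq (hr n).1.le (hσ n) (hr n).2.le hs, ← smul_add,
      ← intervalIntegral.integral_add (hint (hr n).1 (hr n).2.le le_rfl hqc)
        (hint (hr n).1 (hr n).2.le le_rfl continuousOn_const)]
    congr 2
    funext u
    rw [hq, ← smul_add, sub_add_cancel]
  simp_rw [hsplit]
  have hsecond : Tendsto (fun n => (S.α (r n) * (1 - S.snr s * (S.snr (r n))⁻¹)) • p 0) atTop
      (nhds (S.α 0 • p 0)) := by
    have := (hα.mul ((hinv.const_mul (S.snr s)).const_sub 1)).smul_const (p 0)
    simpa using this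
  suffices hfirst : Tendsto (fun n => (S.snr (r n))⁻¹ • (∫ u in r n..s, S.snrRate u • q u)) atTop
      (nhds 0) by
    have := (hα.smul hfirst).add hsecond
    simpa [smul_smul] using this
  rw [Metric.tendsto_atTop]
  intro ε hε
  have hq0 : Tendsto q (nhdsWithin 0 (Icc 0 s)) (nhds 0) := by
    have := (hqc 0 ⟨le_rfl, hs0.le⟩).tendsto
    simpa [hq] using this
  -- The integral is cut at a fixed time e: on [r, e] q is small and the mass is at most 1, and on
  -- [e, s] a fixed integral is multiplied by 1/SNR_r → 0.
  obtain ⟨η, hη, hη'⟩ := Metric.tendsto_nhdsWithin_nhds.1 hq0 (ε / 2) (by positivity)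
  set e := min (η / 2) s with he
  have he0 : 0 < e := lt_min (by positivity) hs0
  have hes : e ≤ s := min_le_right _ _
  have hqe : ∀ u ∈ Icc 0 e, ‖q u‖ ≤ ε / 2 := by
    intro u hu
    have := hη' ⟨hu.1, hu.2.trans hes⟩ (by
      rw [Real.dist_eq, sub_zero, abs_of_nonneg hu.1]
      linarith [hu.2.trans (min_le_left (η / 2) s)])
    rw [dist_zero_right] at this
    exact this.le
  have htail := (hinv.smul_const (∫ u in e..s, S.snrRate u • q u))
  rw [zero_smul] at htail
  obtain ⟨N₁, hN₁⟩ := Metric.tendsto_atTop.1 htail (ε / 2) (by positivity)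
  obtain ⟨N₂, hN₂⟩ := eventually_atTop.1 (hr0.eventually (gt_mem_nhds he0))
  refine ⟨max N₁ N₂, fun n hn => ?_⟩
  have h1 := hN₁ n (le_of_max_le_left hn)
  have hre : r n < e := hN₂ n (le_of_max_le_right hn)
  rw [dist_zero_right] at h1 ⊢
  rw [← intervalIntegral.integral_add_adjacent_intervals (hint (hr n).1 hre.le hes hqc)
    (hint he0 hes le_rfl hqc), smul_add]
  have hsnr := S.snr_pos (hrT n) (hσ n)
  have hhead : ‖(S.snr (r n))⁻¹ • ∫ u in r n..e, S.snrRate u • q u‖ ≤ ε / 2 := by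
    rw [norm_smul, norm_inv, Real.norm_of_nonneg hsnr.le]
    have hb : ‖∫ u in r n..e, S.snrRate u • q u‖ ≤ ∫ u in r n..e, S.snrRate u * (ε / 2) := by
      refine intervalIntegral.norm_integral_le_of_norm_le hre.le ?_ ?_
      · refine Eventually.of_forall fun u hu => ?_
        rw [norm_smul, Real.norm_of_nonneg (S.snrRate_nonneg u)]
        exact mul_le_mul_of_nonneg_left (hqe u ⟨((hr n).1.trans hu.1).le, hu.2⟩)
          (S.snrRate_nonneg u)
      · refine ContinuousOn.intervalIntegrable_of_Icc hre.le (ContinuousOn.fun_mul ?_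
          continuousOn_const)
        exact (S.continuousOn_snrRate (hrT n) (hσ n)).mono (Icc_subset_Icc_right (hes.trans hs))
    rw [intervalIntegral.integral_mul_const, S.integral_snrRate (hrT n) (hσ n) hre.le
      (hes.trans hs)] at hb
    have hse : 0 < S.snr e := S.snr_pos ⟨he0.le, hes.trans hs⟩ (S.σ_pos e ⟨he0, hes.trans hs⟩)
    rw [inv_mul_le_iff₀ hsnr]
    nlinarith
  exact lt_of_le_of_lt (norm_add_le _ _) (by linarith)

/-- The exponential-integrator formula for the solutions of the Bridge SDE. -/
theorem exists_exact_solution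
    (hD : ContinuousOn (fun q : EuclideanSpace ℝ (Fin d) × ℝ => D q.1 q.2 xT S.T)
      (Set.univ ×ˢ Set.Icc 0 S.T)) (ht : 0 ≤ t) (hts : t < s) (hs : s ≤ S.T)
    (hX : IsBridgeSDESolution μ S D xT ℱ t s W X) :
    ∃ z : Ω → EuclideanSpace ℝ (Fin d), IsIndepGaussian μ (ℱ (OrderDual.toDual s)) 1 z ∧
      ∀ᵐ ω ∂μ, X t ω = (S.snr s / S.snr t * (S.α t / S.α s)) • X s ω
            + S.eiDataTerm t s (fun u => D (X u ω) u xT S.T)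
            + (S.σ t * Real.sqrt (1 - S.snr s / S.snr t)) • z ω := by
  by_cases h0 : S.σ t = 0
  swap
  · refine exists_exact_solution_of_pos hD ht ?_ hts hs hX
    rcases eq_or_lt_of_le ht with h | h
    · subst h; exact lt_of_le_of_ne S.σ_zero (Ne.symm h0)
    · exact S.σ_pos t ⟨h, hts.le.trans hs⟩
  obtain rfl : t = 0 := by
    by_contra hne
    exact (S.σ_pos t ⟨lt_of_le_of_ne ht (Ne.symm hne), hts.le.trans hs⟩).ne' h0
  -- The factor σ_0 = 0 removes z from the formula, so its choice is free.
  obtain ⟨z, hz⟩ := exists_stdGaussian hts hX.wiener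
  refine ⟨z, hz, ?_⟩
  let r : ℕ → ℝ := fun n => s / ((n : ℝ) + 2)
  have hr : ∀ n, r n ∈ Ioo 0 s := fun n => by
    refine ⟨by positivity, ?_⟩
    rw [div_lt_iff₀ (by positivity)]
    have : (0 : ℝ) ≤ n := by positivity
    nlinarith
  have hr0 : Tendsto r atTop (nhds 0) :=
    tendsto_const_nhds.div_atTop (tendsto_atTop_add_const_right _ _ tendsto_natCast_atTop_atTop)
  have hrT : ∀ n, r n ∈ Icc 0 S.T := fun n => ⟨(hr n).1.le, (hr n).2.le.trans hs⟩
  have hσ : ∀ n, 0 < S.σ (r n) := fun n => S.σ_pos _ ⟨(hr n).1, (hrT n).2⟩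
  choose y hy hyX using fun n => exists_exact_solution_of_pos hD (hr n).1.le (hσ n) (hr n).2 hs
    (hX.mono (hr n).1.le (hr n).2.le)
  have hα0 : S.α 0 ≠ 0 := (S.α_pos 0 (⟨le_rfl, S.T_pos.le⟩)).ne'
  have hratio : Tendsto (fun n => S.snr s / S.snr (r n)) atTop (nhds 0) := by
    have := (S.tendsto_inv_snr_zero h0 hrT hr0).const_mul (S.snr s)
    simpa [div_eq_mul_inv] using this
  -- By the formula at the times r_n, this variable is the almost sure limit of the noise terms.
  -- Their variances σ_r² (1 - SNR_s/SNR_r) tend to 0, so it vanishes almost surely.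
  have hY : IsIndepGaussian μ (ℱ (OrderDual.toDual s)) 0
      (fun ω => X 0 ω - S.α 0 • D (X 0 ω) 0 xT S.T) := by
    refine IsIndepGaussian.of_tendsto_ae
      (fun n => (hy n).const_smul (S.σ (r n) * Real.sqrt (1 - S.snr s / S.snr (r n)))) ?_ ?_
    · have h1 := (S.tendsto_σ_sq_zero h0 hrT hr0).mul
        (((Real.continuous_sqrt.tendsto _).comp (hratio.const_sub 1)).pow 2)
      rw [zero_mul] at h1
      refine h1.congr fun n => ?_
      simp only [Function.comp_apply]
      ring
    · filter_upwards [hX.cont, ae_all_iff.2 hyX] with ω hω hω'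
      have hp := continuousOn_predictor hD le_rfl hs hω
      have h1 : Tendsto (fun n => X (r n) ω) atTop (nhds (X 0 ω)) :=
        (hω 0 ⟨le_rfl, hts.le⟩).tendsto.comp (tendsto_nhdsWithin_iff.2
          ⟨hr0, Eventually.of_forall fun n => ⟨(hr n).1.le, (hr n).2.le⟩⟩)
      have h2 := S.tendsto_data_term h0 hts hs hr hr0 hp
      have h3 := (hratio.mul ((S.tendsto_α_zero hrT hr0).div_const (S.α s))).smul_const (X s ω)
      have h4 := (h1.sub h3).sub h2
      rw [zero_mul, zero_smul, sub_zero] at h4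
      refine h4.congr fun n => ?_
      nth_rewrite 1 [hω' n]
      abel
  filter_upwards [hY.ae_eq_zero] with ω hω
  rw [sub_eq_zero] at hω
  simp only [BridgeSchedule.eiDataTerm, h0, if_true, zero_mul, zero_smul, add_zero,
    BridgeSchedule.snr]
  simpa using hω

end Zero
end

/-! ### Grönwall, Cauchy–Schwarz and Taylor estimates -/

noncomputable section

set_option linter.unusedSectionVars false

section Deterministic

theorem hasDerivAt_integral_left {a : ℝ → ℝ} (ha : Continuous a) (u s : ℝ) :
    HasDerivAt (fun u => ∫ v in u..s, a v) (-a u) u :=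
  intervalIntegral.integral_hasDerivAt_left (ha.intervalIntegrable _ _)
    (ha.stronglyMeasurableAtFilter _ _) ha.continuousAt

/-- Integrated form of the backward Grönwall inequality. -/
theorem integral_le_exp_mul_integral {a h : ℝ → ℝ} {c t s : ℝ} (hc : 0 ≤ c) (ha : Continuous a)
    (hh : Continuous h) (hh0 : ∀ u ∈ Icc t s, 0 ≤ h u)
    (hle : ∀ u ∈ Icc t s, a u ≤ h u + c * ∫ v in u..s, a v) {u : ℝ} (hu : u ∈ Icc t s) :
    ∫ v in u..s, a v ≤ Real.exp (c * (s - t)) * ∫ v in u..s, h v := by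
  -- ψ' = e^{cu} (c ∫_u^s a - a + h) ≥ 0 by the hypothesis, and ψ(s) = 0; hence ψ ≤ 0 on the
  -- interval.
  let ψ : ℝ → ℝ := fun u => Real.exp (c * u) * (∫ v in u..s, a v)
    - ∫ v in u..s, Real.exp (c * v) * h v
  have hψ : ∀ u, HasDerivAt ψ (Real.exp (c * u) * (c * (∫ v in u..s, a v) - a u + h u)) u := by
    intro u
    have h1 : HasDerivAt (fun u => Real.exp (c * u)) (Real.exp (c * u) * c) u := by
      simpa using ((hasDerivAt_id u).const_mul c).exp
    have h2 := (h1.mul (hasDerivAt_integral_left ha u s)).sub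
      (hasDerivAt_integral_left (a := fun v => Real.exp (c * v) * h v) (by fun_prop) u s)
    refine h2.congr_deriv ?_
    ring
  have hmono : MonotoneOn ψ (Icc u s) := by
    refine monotoneOn_of_deriv_nonneg (convex_Icc u s)
      (fun v _ => (hψ v).continuousAt.continuousWithinAt)
      (fun v _ => (hψ v).differentiableAt.differentiableWithinAt) fun v hv => ?_
    rw [interior_Icc] at hv
    rw [(hψ v).deriv]
    have := hle v ⟨hu.1.trans hv.1.le, hv.2.le⟩
    exact mul_nonneg (Real.exp_pos _).le (by linarith)
  have h1 : ψ u ≤ ψ s := hmono ⟨le_rfl, hu.2⟩ ⟨hu.2, le_rfl⟩ hu.2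
  have h2 : ψ s = 0 := by simp [ψ]
  have h3 : ∫ v in u..s, Real.exp (c * v) * h v ≤ Real.exp (c * s) * ∫ v in u..s, h v := by
    rw [← intervalIntegral.integral_const_mul]
    refine intervalIntegral.integral_mono_on hu.2
      (Continuous.intervalIntegrable (by fun_prop) _ _)
      (Continuous.intervalIntegrable (by fun_prop) _ _) fun v hv => ?_
    refine mul_le_mul_of_nonneg_right (Real.exp_le_exp.2 ?_) (hh0 v ⟨hu.1.trans hv.1, hv.2⟩)
    exact mul_le_mul_of_nonneg_left hv.2 hc
  have h4 : 0 ≤ ∫ v in u..s, h v :=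
    intervalIntegral.integral_nonneg hu.2 fun v hv => hh0 v ⟨hu.1.trans hv.1, hv.2⟩
  have h5 : Real.exp (c * u) * (∫ v in u..s, a v) ≤ Real.exp (c * s) * ∫ v in u..s, h v := by
    rw [h2] at h1
    simp only [ψ] at h1
    linarith
  have h6 : Real.exp (c * s) = Real.exp (c * u) * Real.exp (c * (s - u)) := by
    rw [← Real.exp_add]; ring_nf
  rw [h6, mul_assoc] at h5
  refine (le_of_mul_le_mul_left h5 (Real.exp_pos _)).trans ?_
  refine mul_le_mul_of_nonneg_right (Real.exp_le_exp.2 ?_) h4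
  exact mul_le_mul_of_nonneg_left (by linarith [hu.1]) hc

/-- Cauchy–Schwarz, obtained by expanding ∫ ((s - t) h - A)² ≥ 0 with A = ∫ h. -/
theorem sq_intervalIntegral_le {h : ℝ → ℝ} (hh : Continuous h) {t s : ℝ} (hts : t ≤ s) :
    (∫ v in t..s, h v) ^ 2 ≤ (s - t) * ∫ v in t..s, h v ^ 2 := by
  rcases hts.eq_or_lt with rfl | hlt
  · simp
  have hpos : 0 < s - t := sub_pos.2 hlt
  set A := ∫ v in t..s, h v with hA
  have h1 : 0 ≤ ∫ v in t..s, ((s - t) * h v - A) ^ 2 :=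
    intervalIntegral.integral_nonneg hts fun v _ => sq_nonneg _
  have h2 : ∫ v in t..s, ((s - t) * h v - A) ^ 2
      = (s - t) ^ 2 * (∫ v in t..s, h v ^ 2) - 2 * (s - t) * A * A + A ^ 2 * (s - t) := by
    have : (fun v => ((s - t) * h v - A) ^ 2)
        = fun v => (s - t) ^ 2 * h v ^ 2 - 2 * (s - t) * A * h v + A ^ 2 := by
      funext v; ring
    rw [this, intervalIntegral.integral_add, intervalIntegral.integral_sub,
      intervalIntegral.integral_const_mul, intervalIntegral.integral_const_mul,
      intervalIntegral.integral_const, smul_eq_mul, ← hA]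
    · ring
    all_goals exact Continuous.intervalIntegrable (by fun_prop) _ _
  rw [h2] at h1
  have h3 : 0 ≤ (s - t) * ((s - t) * (∫ v in t..s, h v ^ 2) - A ^ 2) := by nlinarith
  have := nonneg_of_mul_nonneg_right h3 hpos
  linarith

/-- First-order Taylor bound, with the derivative taken at a third point. -/
theorem norm_sub_sub_fderiv_le {E F : Type*} [NormedAddCommGroup E] [NormedSpace ℝ E]
    [NormedAddCommGroup F] [NormedSpace ℝ F] {f : E → F} (hf : Differentiable ℝ f) {K : ℝ}
    (hK : 0 ≤ K) (hL : ∀ x y, ‖fderiv ℝ f x - fderiv ℝ f y‖ ≤ K * ‖x - y‖) (w x y : E) :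
    ‖f y - f x - fderiv ℝ f w (y - x)‖ ≤ K * (‖y - w‖ + ‖y - x‖) * ‖y - x‖ := by
  refine (convex_segment x y).norm_image_sub_le_of_norm_fderiv_le' (𝕜 := ℝ)
    (fun z _ => hf z) (fun z hz => ?_) (left_mem_segment ℝ x y) (right_mem_segment ℝ x y)
  refine (hL z w).trans (mul_le_mul_of_nonneg_left ?_ hK)
  have h1 : ‖z - y‖ ≤ ‖y - x‖ := by
    obtain ⟨a, b, ha, hb, hab, rfl⟩ := hz
    have : a • x + b • y - y = a • (x - y) := by
      rw [show b = 1 - a by linarith]; module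
    rw [this, norm_smul, Real.norm_of_nonneg ha, norm_sub_rev]
    exact mul_le_of_le_one_left (norm_nonneg _) (by linarith)
  calc ‖z - w‖ ≤ ‖z - y‖ + ‖y - w‖ := norm_sub_le_norm_sub_add_norm_sub _ _ _
    _ ≤ _ := by linarith

end Deterministic

/-! ### Processes with continuous paths and exchange of integrals -/

section Paths

variable {Ω : Type*} {mΩ : MeasurableSpace Ω} {μ : Measure Ω} [IsProbabilityMeasure μ]
  {E : Type*} [NormedAddCommGroup E] [NormedSpace ℝ E] {t s : ℝ}

/-- A measurable process, all of whose paths are continuous. -/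
structure IsContPaths {Ω E : Type*} [MeasurableSpace Ω] [NormedAddCommGroup E]
    (X : ℝ → Ω → E) : Prop where
  cont : ∀ ω, Continuous fun u => X u ω
  meas : ∀ u, StronglyMeasurable (X u)

namespace IsContPaths

variable {X Y : ℝ → Ω → E}

theorem uncurry (hX : IsContPaths X) : StronglyMeasurable (Function.uncurry X) :=
  stronglyMeasurable_uncurry_of_continuous_of_stronglyMeasurable hX.cont hX.meas

theorem const {Z : Ω → E} (hZ : StronglyMeasurable Z) : IsContPaths fun _ => Z :=
  ⟨fun _ => continuous_const, fun _ => hZ⟩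

theorem deterministic {f : ℝ → E} (hf : Continuous f) : IsContPaths fun u (_ : Ω) => f u :=
  ⟨fun _ => hf, fun _ => stronglyMeasurable_const⟩

theorem add (hX : IsContPaths X) (hY : IsContPaths Y) :
    IsContPaths fun u ω => X u ω + Y u ω :=
  ⟨fun ω => (hX.cont ω).add (hY.cont ω), fun u => (hX.meas u).add (hY.meas u)⟩

theorem sub (hX : IsContPaths X) (hY : IsContPaths Y) :
    IsContPaths fun u ω => X u ω - Y u ω :=
  ⟨fun ω => (hX.cont ω).sub (hY.cont ω), fun u => (hX.meas u).sub (hY.meas u)⟩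

theorem norm (hX : IsContPaths X) : IsContPaths fun u ω => ‖X u ω‖ :=
  ⟨fun ω => (hX.cont ω).norm, fun u => (hX.meas u).norm⟩

theorem smul {c : ℝ → Ω → ℝ} (hc : IsContPaths c) (hX : IsContPaths X) :
    IsContPaths fun u ω => c u ω • X u ω :=
  ⟨fun ω => (hc.cont ω).smul (hX.cont ω), fun u => (hc.meas u).smul (hX.meas u)⟩

theorem mul {c c' : ℝ → Ω → ℝ} (hc : IsContPaths c) (hc' : IsContPaths c') :
    IsContPaths fun u ω => c u ω * c' u ω :=
  ⟨fun ω => (hc.cont ω).mul (hc'.cont ω), fun u => (hc.meas u).mul (hc'.meas u)⟩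

theorem sq {c : ℝ → Ω → ℝ} (hc : IsContPaths c) : IsContPaths fun u ω => c u ω ^ 2 := by
  simpa only [pow_two] using hc.mul hc

theorem stronglyMeasurable_integral (hX : IsContPaths X) (a b : ℝ) :
    StronglyMeasurable fun ω => ∫ v in a..b, X v ω := by
  simp only [intervalIntegral]
  exact (hX.uncurry.integral_prod_left (μ := volume.restrict (Ioc a b))).sub
    (hX.uncurry.integral_prod_left (μ := volume.restrict (Ioc b a)))

theorem primitive (hX : IsContPaths X) (s : ℝ) :
    IsContPaths fun u ω => ∫ v in s..u, X v ω :=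
  ⟨fun ω => intervalIntegral.continuous_primitive
      (fun a b => (hX.cont ω).intervalIntegrable a b) s,
    fun u => hX.stronglyMeasurable_integral s u⟩

/-- Continuity of every path gives joint measurability, and an L¹ bound uniform over the bounded
time interval gives integrability on the product. Every exchange of expectation and time integral
rests on this. -/
theorem integrable_uncurry (hX : IsContPaths X) (hts : t ≤ s)
    (hint : ∀ v ∈ Icc t s, Integrable (X v) μ) {B : ℝ}
    (hB : ∀ v ∈ Icc t s, ∫ ω, ‖X v ω‖ ∂μ ≤ B) :
    Integrable (Function.uncurry X) ((volume.restrict (uIoc t s)).prod μ) := by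
  rw [integrable_prod_iff hX.uncurry.aestronglyMeasurable, uIoc_of_le hts]
  constructor
  · filter_upwards [ae_restrict_mem measurableSet_Ioc] with v hv
    exact hint v (Ioc_subset_Icc_self hv)
  · refine Integrable.of_bound
      (hX.uncurry.norm.integral_prod_right (ν := μ)).aestronglyMeasurable B ?_
    filter_upwards [ae_restrict_mem measurableSet_Ioc] with v hv
    rw [Real.norm_of_nonneg (integral_nonneg fun _ => norm_nonneg _)]
    exact hB v (Ioc_subset_Icc_self hv)

theorem integrable_integral (hX : IsContPaths X) (hts : t ≤ s)
    (hint : ∀ v ∈ Icc t s, Integrable (X v) μ) {B : ℝ}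
    (hB : ∀ v ∈ Icc t s, ∫ ω, ‖X v ω‖ ∂μ ≤ B) :
    Integrable (fun ω => ∫ v in t..s, X v ω) μ := by
  have h := (hX.integrable_uncurry hts hint hB).integral_prod_right
  simp only [uIoc_of_le hts] at h
  simp only [intervalIntegral.integral_of_le hts]
  exact h

theorem norm_integral_integral_le (hX : IsContPaths X) (hts : t ≤ s)
    (hint : ∀ v ∈ Icc t s, Integrable (X v) μ) {B B' : ℝ}
    (hB : ∀ v ∈ Icc t s, ∫ ω, ‖X v ω‖ ∂μ ≤ B) (hB' : ∀ v ∈ Icc t s, ‖∫ ω, X v ω ∂μ‖ ≤ B') :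
    ‖∫ ω, (∫ v in t..s, X v ω) ∂μ‖ ≤ B' * (s - t) := by
  rw [← intervalIntegral_integral_swap (hX.integrable_uncurry hts hint hB)]
  have := intervalIntegral.norm_integral_le_of_norm_le_const (a := t) (b := s)
    (f := fun v => ∫ ω, X v ω ∂μ) (C := B') fun v hv => hB' v (by
      rw [uIoc_of_le hts] at hv; exact Ioc_subset_Icc_self hv)
  rwa [abs_of_nonneg (sub_nonneg.2 hts)] at this

theorem integral_integral_le {X : ℝ → Ω → ℝ} (hX : IsContPaths X) (hts : t ≤ s)
    (hint : ∀ v ∈ Icc t s, Integrable (X v) μ) (hX0 : ∀ v ∈ Icc t s, ∀ ω, 0 ≤ X v ω) {B : ℝ}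
    (hB : ∀ v ∈ Icc t s, ∫ ω, X v ω ∂μ ≤ B) :
    Integrable (fun ω => ∫ v in t..s, X v ω) μ ∧ ∫ ω, (∫ v in t..s, X v ω) ∂μ ≤ B * (s - t) := by
  have hB' : ∀ v ∈ Icc t s, ∫ ω, ‖X v ω‖ ∂μ ≤ B := fun v hv => by
    simpa only [Real.norm_of_nonneg (hX0 v hv _)] using hB v hv
  refine ⟨hX.integrable_integral hts hint hB', (Real.le_norm_self _).trans ?_⟩
  refine hX.norm_integral_integral_le hts hint hB' fun v hv => ?_
  exact (norm_integral_le_integral_norm _).trans (hB' v hv)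

end IsContPaths
end Paths
end

/-! ### Moment bounds for increments, predictions and errors -/

noncomputable section

set_option linter.unusedSectionVars false

section Moments

variable {Ω : Type*} {mΩ : MeasurableSpace Ω} {μ : Measure Ω} [IsProbabilityMeasure μ]
  {E : Type*} [NormedAddCommGroup E] [NormedSpace ℝ E] {t s T c G L B : ℝ}
  {X β P : ℝ → Ω → E}

theorem norm_integral_drift_le (hX : IsContPaths X)
    (hβX : ∀ v ∈ Icc t s, ∀ ω, ‖β v ω‖ ≤ c * (1 + ‖X v ω‖)) (hc : 0 ≤ c) {u : ℝ}
    (hu : u ∈ Icc t s) (ω : Ω) :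
    ‖∫ v in s..u, β v ω‖ ≤ ∫ v in u..s, c * (1 + ‖X s ω‖ + ‖X v ω - X s ω‖) := by
  rw [intervalIntegral.integral_symm, norm_neg]
  have hXc := hX.cont ω
  refine intervalIntegral.norm_integral_le_of_norm_le hu.2 ?_
    (Continuous.intervalIntegrable (by fun_prop) _ _)
  refine Eventually.of_forall fun v hv => ?_
  refine (hβX v ⟨hu.1.trans hv.1.le, hv.2⟩ ω).trans (mul_le_mul_of_nonneg_left ?_ hc)
  have : ‖X v ω‖ ≤ ‖X s ω‖ + ‖X v ω - X s ω‖ := norm_le_norm_add_norm_sub' _ _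
  linarith

/-- The constant of the mean-square bound on the increments of a process with drift of linear
growth `c` and noise intensity `G` over times up to `T`. -/
def incrementConst (c G T : ℝ) : ℝ :=
  2 * (2 * G + 4 * c ^ 2 * T) * (1 + c ^ 2 * Real.exp (c * T) ^ 2 * T ^ 2)

theorem incrementConst_nonneg (hG : 0 ≤ G) (hT : 0 ≤ T) : 0 ≤ incrementConst c G T := by
  unfold incrementConst; positivity

/-- Each path satisfies ‖X_u - X_s‖ ≤ h_u + c ∫_u^s ‖X_v - X_s‖ dv, where h collects the noise and
the drift at the starting point. Grönwall is applied path by path, before any expectation, so that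
square integrability of X_u is a conclusion and need not be assumed. -/
theorem integral_norm_increment_sq_le (hX : IsContPaths X) (hβ : IsContPaths β)
    (hβX : ∀ v ∈ Icc t s, ∀ ω, ‖β v ω‖ ≤ c * (1 + ‖X v ω‖)) (hc : 0 ≤ c) (hG : 0 ≤ G)
    (hT : s - t ≤ T)
    (hI : ∀ v ∈ Icc t s, MemLp (fun ω => X v ω - X s ω - ∫ r in s..v, β r ω) 2 μ)
    (hIG : ∀ v ∈ Icc t s, ∫ ω, ‖X v ω - X s ω - ∫ r in s..v, β r ω‖ ^ 2 ∂μ ≤ G * (s - v))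
    (hXs : MemLp (X s) 2 μ) {u : ℝ} (hu : u ∈ Icc t s) :
    Integrable (fun ω => ‖X u ω - X s ω‖ ^ 2) μ ∧
      ∫ ω, ‖X u ω - X s ω‖ ^ 2 ∂μ
        ≤ incrementConst c G T * (1 + ∫ ω, ‖X s ω‖ ^ 2 ∂μ) * (s - u) := by
  set M := ∫ ω, ‖X s ω‖ ^ 2 ∂μ with hM
  have hM0 : 0 ≤ M := integral_nonneg fun _ => by positivity
  have hXs2 : Integrable (fun ω => ‖X s ω‖ ^ 2) μ := hXs.integrable_norm_pow two_ne_zero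
  have hXk : ∀ k : ℝ, Integrable (fun ω => k + ‖X s ω‖ ^ 2) μ := fun k =>
    (integrable_const k).add hXs2
  set h : ℝ → Ω → ℝ := fun v ω => ‖X v ω - X s ω - ∫ r in s..v, β r ω‖
    + c * (s - v) * (1 + ‖X s ω‖) with hh
  have hproc : IsContPaths h :=
    ((hX.sub (.const (hX.meas s))).sub (hβ.primitive s)).norm.add
      ((IsContPaths.deterministic (f := fun v => c * (s - v)) (by fun_prop)).mul
        (.const (stronglyMeasurable_const.add (hX.meas s).norm)))
  have hh0 : ∀ v ∈ Icc t s, ∀ ω, 0 ≤ h v ω := fun v hv ω => by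
    have : 0 ≤ s - v := sub_nonneg.2 hv.2
    simp only [hh]; positivity
  -- 2G comes from the noise and 4c²T from c (s - v)(1 + ‖X_s‖), after squaring and using (s - v)² ≤
  -- T (s - v).
  set C₁ := 2 * G + 4 * c ^ 2 * T with hC₁
  have hTs : ∀ v ∈ Icc t s, 0 ≤ s - v ∧ s - v ≤ T := fun v hv =>
    ⟨sub_nonneg.2 hv.2, by linarith [hv.1]⟩
  have hT0 : 0 ≤ T := (hTs u hu).1.trans (hTs u hu).2
  have hhsq : ∀ v ∈ Icc t s, Integrable (fun ω => h v ω ^ 2) μ ∧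
      ∫ ω, h v ω ^ 2 ∂μ ≤ C₁ * (1 + M) * (s - v) := by
    intro v hv
    obtain ⟨hv0, hvT⟩ := hTs v hv
    have hIi : Integrable (fun ω => ‖X v ω - X s ω - ∫ r in s..v, β r ω‖ ^ 2) μ :=
      (hI v hv).integrable_norm_pow two_ne_zero
    have hdom : Integrable (fun ω => 2 * ‖X v ω - X s ω - ∫ r in s..v, β r ω‖ ^ 2
        + 4 * (c * (s - v)) ^ 2 * (1 + ‖X s ω‖ ^ 2)) μ :=
      (hIi.const_mul _).add ((hXk 1).const_mul _)
    have hle : ∀ ω, h v ω ^ 2 ≤ 2 * ‖X v ω - X s ω - ∫ r in s..v, β r ω‖ ^ 2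
        + 4 * (c * (s - v)) ^ 2 * (1 + ‖X s ω‖ ^ 2) := by
      intro ω
      simp only [hh]
      set p := ‖X v ω - X s ω - ∫ r in s..v, β r ω‖
      have h1 : (p + c * (s - v) * (1 + ‖X s ω‖)) ^ 2
          ≤ 2 * p ^ 2 + 2 * (c * (s - v) * (1 + ‖X s ω‖)) ^ 2 := by
        nlinarith [sq_nonneg (p - c * (s - v) * (1 + ‖X s ω‖))]
      have h2 : (1 + ‖X s ω‖) ^ 2 ≤ 2 * (1 + ‖X s ω‖ ^ 2) := by
        nlinarith [sq_nonneg (1 - ‖X s ω‖)]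
      have h3 := mul_le_mul_of_nonneg_left h2 (sq_nonneg (c * (s - v)))
      rw [mul_pow (c * (s - v))] at h1
      linarith
    have hint : Integrable (fun ω => h v ω ^ 2) μ :=
      hdom.mono' (hproc.sq.meas v).aestronglyMeasurable (Eventually.of_forall fun ω => by
        rw [Real.norm_of_nonneg (sq_nonneg _)]; exact hle ω)
    refine ⟨hint, (integral_mono hint hdom hle).trans ?_⟩
    rw [integral_add (hIi.const_mul _) ((hXk 1).const_mul _),
      integral_const_mul, integral_const_mul, integral_add (integrable_const _) hXs2,
      integral_const, probReal_univ, one_smul, ← hM]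
    have h1 := hIG v hv
    have h2 : (c * (s - v)) ^ 2 ≤ c ^ 2 * T * (s - v) := by
      rw [mul_pow, pow_two (s - v), ← mul_assoc]
      gcongr
    have h3 := mul_le_mul_of_nonneg_right h2 (show 0 ≤ 1 + M by positivity)
    have h4 : 0 ≤ G * (s - v) * M := by positivity
    rw [hC₁]
    nlinarith
  have hu0 := (hTs u hu).1
  have hsub : ∀ v ∈ Icc u s, v ∈ Icc t s := fun v hv => ⟨hu.1.trans hv.1, hv.2⟩
  have hC₁0 : 0 ≤ C₁ := by positivity
  obtain ⟨hint, hintle⟩ := hproc.sq.integral_integral_le (μ := μ) hu.2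
    (fun v hv => (hhsq v (hsub v hv)).1) (fun _ _ _ => sq_nonneg _)
    (B := C₁ * (1 + M) * (s - u)) fun v hv => (hhsq v (hsub v hv)).2.trans (by
      have : s - v ≤ s - u := by linarith [hv.1]
      gcongr)
  set κ := c * Real.exp (c * T) with hκ
  have hpath : ∀ ω, ‖X u ω - X s ω‖ ^ 2
      ≤ 2 * h u ω ^ 2 + 2 * κ ^ 2 * (s - u) * ∫ v in u..s, h v ω ^ 2 := by
    intro ω
    have hXc := hX.cont ω
    have hac : Continuous fun v => ‖X v ω - X s ω‖ := by fun_prop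
    have hstep : ∀ v ∈ Icc t s, ‖X v ω - X s ω‖
        ≤ h v ω + c * ∫ r in v..s, ‖X r ω - X s ω‖ := by
      intro v hv
      have h1 := norm_integral_drift_le hX hβX hc hv ω
      have h2 : ∫ r in v..s, c * (1 + ‖X s ω‖ + ‖X r ω - X s ω‖)
          = c * (s - v) * (1 + ‖X s ω‖) + c * ∫ r in v..s, ‖X r ω - X s ω‖ := by
        rw [intervalIntegral.integral_const_mul, intervalIntegral.integral_add
          (Continuous.intervalIntegrable (by fun_prop) _ _) (hac.intervalIntegrable _ _),
          intervalIntegral.integral_const, smul_eq_mul]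
        ring
      have h3 : ‖X v ω - X s ω‖ ≤ ‖X v ω - X s ω - ∫ r in s..v, β r ω‖
          + ‖∫ r in s..v, β r ω‖ := by
        simpa using norm_add_le (X v ω - X s ω - ∫ r in s..v, β r ω) (∫ r in s..v, β r ω)
      simp only [hh]
      linarith
    have hgr := integral_le_exp_mul_integral hc hac (hproc.cont ω) (fun v hv => hh0 v hv ω)
      hstep hu
    have hH0 : 0 ≤ ∫ v in u..s, h v ω :=
      intervalIntegral.integral_nonneg hu.2 fun v hv => hh0 v (hsub v hv) ω
    have hexp : Real.exp (c * (s - t)) ≤ Real.exp (c * T) :=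
      Real.exp_le_exp.2 (mul_le_mul_of_nonneg_left hT hc)
    have hau : ‖X u ω - X s ω‖ ≤ h u ω + κ * ∫ v in u..s, h v ω := by
      refine (hstep u hu).trans ?_
      have : c * ∫ r in u..s, ‖X r ω - X s ω‖ ≤ c * (Real.exp (c * T) * ∫ v in u..s, h v ω) :=
        mul_le_mul_of_nonneg_left (hgr.trans (mul_le_mul_of_nonneg_right hexp hH0)) hc
      rw [hκ, mul_assoc]
      linarith
    have hcs := sq_intervalIntegral_le (hproc.cont ω) hu.2
    have h1 := pow_le_pow_left₀ (norm_nonneg _) hau 2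
    have h2 : (h u ω + κ * ∫ v in u..s, h v ω) ^ 2
        ≤ 2 * h u ω ^ 2 + 2 * κ ^ 2 * (∫ v in u..s, h v ω) ^ 2 := by
      nlinarith [sq_nonneg (h u ω - κ * ∫ v in u..s, h v ω)]
    have h3 := mul_le_mul_of_nonneg_left hcs (show 0 ≤ 2 * κ ^ 2 by positivity)
    linarith
  have hdom : Integrable (fun ω => 2 * h u ω ^ 2
      + 2 * κ ^ 2 * (s - u) * ∫ v in u..s, h v ω ^ 2) μ :=
    ((hhsq u hu).1.const_mul _).add (hint.const_mul _)
  have hres : Integrable (fun ω => ‖X u ω - X s ω‖ ^ 2) μ :=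
    hdom.mono' ((hX.sub (.const (hX.meas s))).norm.sq.meas u).aestronglyMeasurable
      (Eventually.of_forall fun ω => by
        rw [Real.norm_of_nonneg (sq_nonneg _)]; exact hpath ω)
  refine ⟨hres, (integral_mono hres hdom hpath).trans ?_⟩
  rw [integral_add ((hhsq u hu).1.const_mul _) (hint.const_mul _), integral_const_mul,
    integral_const_mul]
  have h1 := (hhsq u hu).2
  have h2 := mul_le_mul_of_nonneg_left hintle (show 0 ≤ 2 * κ ^ 2 * (s - u) by positivity)
  have h3 : (s - u) * (s - u) ≤ T ^ 2 := by
    have := (hTs u hu).2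
    nlinarith
  have h4 := mul_le_mul_of_nonneg_left h3
    (show 0 ≤ 2 * κ ^ 2 * (C₁ * (1 + M) * (s - u)) by positivity)
  have h5 : incrementConst c G T = 2 * C₁ * (1 + κ ^ 2 * T ^ 2) := by
    rw [incrementConst, hκ, mul_pow]
  rw [h5]
  nlinarith

theorem integral_norm_predictor_sq_le (hP : IsContPaths P)
    (hPL : ∀ v ∈ Icc t s, ∀ ω,
      ‖P v ω - P s ω‖ ≤ L * (‖X v ω - X s ω‖ + (1 + ‖X s ω‖) * (s - v)))
    (hT : s - t ≤ T) {C : ℝ} (hXs : MemLp (X s) 2 μ)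
    (hinc : ∀ v ∈ Icc t s, Integrable (fun ω => ‖X v ω - X s ω‖ ^ 2) μ ∧
      ∫ ω, ‖X v ω - X s ω‖ ^ 2 ∂μ ≤ C * (1 + ∫ ω, ‖X s ω‖ ^ 2 ∂μ) * (s - v))
    {v : ℝ} (hv : v ∈ Icc t s) :
    Integrable (fun ω => ‖P v ω - P s ω‖ ^ 2) μ ∧
      ∫ ω, ‖P v ω - P s ω‖ ^ 2 ∂μ
        ≤ (2 * L ^ 2 * C + 4 * L ^ 2 * T) * (1 + ∫ ω, ‖X s ω‖ ^ 2 ∂μ) * (s - v) := by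
  set M := ∫ ω, ‖X s ω‖ ^ 2 ∂μ with hM
  have hM0 : 0 ≤ M := integral_nonneg fun _ => by positivity
  have hXs2 : Integrable (fun ω => ‖X s ω‖ ^ 2) μ := hXs.integrable_norm_pow two_ne_zero
  have hXk : ∀ k : ℝ, Integrable (fun ω => k + ‖X s ω‖ ^ 2) μ := fun k =>
    (integrable_const k).add hXs2
  have hv0 : 0 ≤ s - v := sub_nonneg.2 hv.2
  have hvT : s - v ≤ T := by linarith [hv.1]
  obtain ⟨hai, hale⟩ := hinc v hv
  have hdom : Integrable (fun ω => 2 * L ^ 2 * ‖X v ω - X s ω‖ ^ 2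
      + 4 * L ^ 2 * (s - v) ^ 2 * (1 + ‖X s ω‖ ^ 2)) μ :=
    (hai.const_mul _).add ((hXk 1).const_mul _)
  have hle : ∀ ω, ‖P v ω - P s ω‖ ^ 2 ≤ 2 * L ^ 2 * ‖X v ω - X s ω‖ ^ 2
      + 4 * L ^ 2 * (s - v) ^ 2 * (1 + ‖X s ω‖ ^ 2) := by
    intro ω
    have h0 := pow_le_pow_left₀ (norm_nonneg _) (hPL v hv ω) 2
    set a := ‖X v ω - X s ω‖
    have h1 : (a + (1 + ‖X s ω‖) * (s - v)) ^ 2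
        ≤ 2 * a ^ 2 + 4 * (s - v) ^ 2 * (1 + ‖X s ω‖ ^ 2) := by
      have h2 : (1 + ‖X s ω‖) ^ 2 ≤ 2 * (1 + ‖X s ω‖ ^ 2) := by
        nlinarith [sq_nonneg (1 - ‖X s ω‖)]
      have h3 := mul_le_mul_of_nonneg_left h2 (sq_nonneg (s - v))
      nlinarith [sq_nonneg (a - (1 + ‖X s ω‖) * (s - v))]
    have h4 := mul_le_mul_of_nonneg_left h1 (sq_nonneg L)
    rw [mul_pow] at h0
    linarith
  have hint : Integrable (fun ω => ‖P v ω - P s ω‖ ^ 2) μ :=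
    hdom.mono' ((hP.sub (.const (hP.meas s))).norm.sq.meas v).aestronglyMeasurable
      (Eventually.of_forall fun ω => by
        rw [Real.norm_of_nonneg (sq_nonneg _)]; exact hle ω)
  refine ⟨hint, (integral_mono hint hdom hle).trans ?_⟩
  rw [integral_add (hai.const_mul _) ((hXk 1).const_mul _),
    integral_const_mul, integral_const_mul, integral_add (integrable_const _) hXs2,
    integral_const, probReal_univ, one_smul, ← hM]
  have h1 := mul_le_mul_of_nonneg_left hale (show 0 ≤ 2 * L ^ 2 by positivity)
  have h2 : (s - v) ^ 2 ≤ T * (s - v) := by nlinarith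
  have h3 := mul_le_mul_of_nonneg_left h2 (show 0 ≤ 4 * L ^ 2 * (1 + M) by positivity)
  nlinarith

/-- Of the three powers of s - t, one comes from Cauchy–Schwarz in time, one from the length of the
interval and one from the mean-square size of P_v - P_s. -/
theorem integral_norm_error_sq_le [CompleteSpace E] (hP : IsContPaths P) {w : ℝ → ℝ}
    (hw : Continuous w)
    (hwB : ∀ v ∈ Icc t s, |w v| ≤ B) (hts : t ≤ s) {R : ℝ} (hR : 0 ≤ R)
    (hPi : ∀ v ∈ Icc t s, Integrable (fun ω => ‖P v ω - P s ω‖ ^ 2) μ ∧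
      ∫ ω, ‖P v ω - P s ω‖ ^ 2 ∂μ ≤ R * (s - v)) :
    MemLp (fun ω => ∫ v in t..s, w v • (P v ω - P s ω)) 2 μ ∧
      ∫ ω, ‖∫ v in t..s, w v • (P v ω - P s ω)‖ ^ 2 ∂μ ≤ B ^ 2 * R * (s - t) ^ 3 := by
  have hdiff : IsContPaths fun v ω => P v ω - P s ω := hP.sub (.const (hP.meas s))
  have hB : 0 ≤ B := (abs_nonneg _).trans (hwB t ⟨le_rfl, hts⟩)
  have hst : 0 ≤ s - t := sub_nonneg.2 hts
  have hproc : IsContPaths fun v ω => w v • (P v ω - P s ω) :=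
    (IsContPaths.deterministic hw).smul hdiff
  obtain ⟨hint, hle⟩ := hdiff.norm.sq.integral_integral_le (μ := μ) hts
    (fun v hv => (hPi v hv).1) (fun _ _ _ => sq_nonneg _) (B := R * (s - t))
    fun v hv => (hPi v hv).2.trans (by
      have : s - v ≤ s - t := by linarith [hv.1]
      gcongr)
  have hpath : ∀ ω, ‖∫ v in t..s, w v • (P v ω - P s ω)‖ ^ 2
      ≤ B ^ 2 * (s - t) * ∫ v in t..s, ‖P v ω - P s ω‖ ^ 2 := by
    intro ω
    have hc := hdiff.norm.cont ω
    have h1 : ‖∫ v in t..s, w v • (P v ω - P s ω)‖ ≤ ∫ v in t..s, B * ‖P v ω - P s ω‖ := by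
      refine intervalIntegral.norm_integral_le_of_norm_le hts (Eventually.of_forall fun v hv => ?_)
        ((hc.const_mul B).intervalIntegrable _ _)
      rw [norm_smul, Real.norm_eq_abs]
      exact mul_le_mul_of_nonneg_right (hwB v (Ioc_subset_Icc_self hv)) (norm_nonneg _)
    rw [intervalIntegral.integral_const_mul] at h1
    have h2 := pow_le_pow_left₀ (norm_nonneg _) h1 2
    have h3 := mul_le_mul_of_nonneg_left (sq_intervalIntegral_le hc hts) (sq_nonneg B)
    rw [mul_pow] at h2
    linarith
  have hdom := hint.const_mul (B ^ 2 * (s - t))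
  have hm : StronglyMeasurable fun ω => ∫ v in t..s, w v • (P v ω - P s ω) :=
    hproc.stronglyMeasurable_integral t s
  have hi : Integrable (fun ω => ‖∫ v in t..s, w v • (P v ω - P s ω)‖ ^ 2) μ :=
    hdom.mono' (hm.norm.pow 2).aestronglyMeasurable (Eventually.of_forall fun ω => by
      rw [Real.norm_of_nonneg (sq_nonneg _)]; exact hpath ω)
  refine ⟨(memLp_two_iff_integrable_sq_norm hm.aestronglyMeasurable).2 hi,
    (integral_mono hi hdom hpath).trans ?_⟩
  rw [integral_const_mul]
  calc B ^ 2 * (s - t) * ∫ ω, (∫ v in t..s, ‖P v ω - P s ω‖ ^ 2) ∂μ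
      ≤ B ^ 2 * (s - t) * (R * (s - t) * (s - t)) :=
        mul_le_mul_of_nonneg_left hle (by positivity)
    _ = B ^ 2 * R * (s - t) ^ 3 := by ring

/-- The drift part has order s - u in mean, whereas the whole increment has only order (s -
u)^{1/2}. First moments are reduced to second ones by y ≤ 1 + y². -/
theorem integral_norm_drift_le (hX : IsContPaths X) (hβ : IsContPaths β)
    (hβX : ∀ v ∈ Icc t s, ∀ ω, ‖β v ω‖ ≤ c * (1 + ‖X v ω‖)) (hc : 0 ≤ c)
    (hT : s - t ≤ T) {C : ℝ} (hC : 0 ≤ C) (hXs : MemLp (X s) 2 μ)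
    (hinc : ∀ v ∈ Icc t s, Integrable (fun ω => ‖X v ω - X s ω‖ ^ 2) μ ∧
      ∫ ω, ‖X v ω - X s ω‖ ^ 2 ∂μ ≤ C * (1 + ∫ ω, ‖X s ω‖ ^ 2 ∂μ) * (s - v))
    {u : ℝ} (hu : u ∈ Icc t s) :
    Integrable (fun ω => ‖∫ v in s..u, β v ω‖) μ ∧
      ∫ ω, ‖∫ v in s..u, β v ω‖ ∂μ
        ≤ c * (3 + C * T) * (1 + ∫ ω, ‖X s ω‖ ^ 2 ∂μ) * (s - u) := by
  set M := ∫ ω, ‖X s ω‖ ^ 2 ∂μ with hM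
  have hM0 : 0 ≤ M := integral_nonneg fun _ => by positivity
  have hXs2 : Integrable (fun ω => ‖X s ω‖ ^ 2) μ := hXs.integrable_norm_pow two_ne_zero
  have hXk : ∀ k : ℝ, Integrable (fun ω => k + ‖X s ω‖ ^ 2) μ := fun k =>
    (integrable_const k).add hXs2
  have hproc : IsContPaths fun v ω => c * (1 + ‖X s ω‖ + ‖X v ω - X s ω‖) :=
    (IsContPaths.deterministic (f := fun _ => c) continuous_const).mul
      ((IsContPaths.const (stronglyMeasurable_const.add (hX.meas s).norm)).add
        (hX.sub (.const (hX.meas s))).norm)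
  have hb : ∀ v ∈ Icc u s, Integrable (fun ω => c * (1 + ‖X s ω‖ + ‖X v ω - X s ω‖)) μ ∧
      ∫ ω, c * (1 + ‖X s ω‖ + ‖X v ω - X s ω‖) ∂μ ≤ c * (3 + C * T) * (1 + M) := by
    intro v hv
    have hv' : v ∈ Icc t s := ⟨hu.1.trans hv.1, hv.2⟩
    obtain ⟨hai, hale⟩ := hinc v hv'
    have hdom : Integrable (fun ω => c * (3 + ‖X s ω‖ ^ 2 + ‖X v ω - X s ω‖ ^ 2)) μ :=
      ((hXk 3).add hai).const_mul _
    have hle : ∀ ω, c * (1 + ‖X s ω‖ + ‖X v ω - X s ω‖)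
        ≤ c * (3 + ‖X s ω‖ ^ 2 + ‖X v ω - X s ω‖ ^ 2) := fun ω => by
      refine mul_le_mul_of_nonneg_left ?_ hc
      nlinarith [sq_nonneg (‖X s ω‖ - 1), sq_nonneg (‖X v ω - X s ω‖ - 1)]
    have hi : Integrable (fun ω => c * (1 + ‖X s ω‖ + ‖X v ω - X s ω‖)) μ :=
      hdom.mono' (hproc.meas v).aestronglyMeasurable (Eventually.of_forall fun ω => by
        rw [Real.norm_of_nonneg (by positivity)]; exact hle ω)
    refine ⟨hi, (integral_mono hi hdom hle).trans ?_⟩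
    rw [integral_const_mul, integral_add (hXk 3) hai,
      integral_add (integrable_const _) hXs2, integral_const, probReal_univ, one_smul, ← hM,
      mul_assoc]
    refine mul_le_mul_of_nonneg_left ?_ hc
    have h1 : C * (1 + M) * (s - v) ≤ C * (1 + M) * T :=
      mul_le_mul_of_nonneg_left (by linarith [hv'.1]) (by positivity)
    nlinarith
  obtain ⟨hint, hle⟩ := hproc.integral_integral_le (μ := μ) hu.2 (fun v hv => (hb v hv).1)
    (fun _ _ _ => by positivity) fun v hv => (hb v hv).2
  have hi : Integrable (fun ω => ‖∫ v in s..u, β v ω‖) μ :=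
    hint.mono' ((hβ.primitive s).norm.meas u).aestronglyMeasurable
      (Eventually.of_forall fun ω => by
        rw [norm_norm]; exact norm_integral_drift_le hX hβX hc hu ω)
  exact ⟨hi, (integral_mono hi hint fun ω => norm_integral_drift_le hX hβX hc hu ω).trans hle⟩

end Moments
end

/-! ### Weak error -/

noncomputable section

set_option linter.unusedSectionVars false

section Weak

variable {Ω : Type*} {m mΩ : MeasurableSpace Ω} {μ : Measure Ω} [IsProbabilityMeasure μ]
  {E : Type*} [NormedAddCommGroup E] [InnerProductSpace ℝ E] [FiniteDimensional ℝ E]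
  [MeasurableSpace E] [BorelSpace E]

theorem continuous_of_norm_sub_le {F F' : Type*} [NormedAddCommGroup F] [NormedAddCommGroup F']
    {f : F → F'} {K : ℝ} (hK : 0 ≤ K) (h : ∀ x y, ‖f x - f y‖ ≤ K * ‖x - y‖) : Continuous f :=
  (LipschitzWith.of_dist_le_mul (K := ⟨K, hK⟩) fun x y => by
    rw [dist_eq_norm, dist_eq_norm]; exact h x y).continuous

theorem stronglyMeasurable_clm_apply {F F' : Type*} [NormedAddCommGroup F] [NormedSpace ℝ F]
    [NormedAddCommGroup F'] [NormedSpace ℝ F'] {Z : Ω → F →L[ℝ] F'} {Y : Ω → F}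
    (hZ : StronglyMeasurable Z) (hY : StronglyMeasurable Y) :
    StronglyMeasurable fun ω => Z ω (Y ω) :=
  (isBoundedBilinearMap_apply (𝕜 := ℝ) (E := F) (F := F')).continuous.comp_stronglyMeasurable
    (hZ.prodMk hY)

/-- The mean of a functional of the increment of `f`, where the increment of the argument is the
sum of a small term and of a Gaussian vector `i` independent of the past. -/
theorem abs_integral_functional_increment_le (hm : m ≤ mΩ) {x y i q : Ω → E} {ρ : Ω → ℝ}
    {f : E → E} {ψ : E → E →L[ℝ] ℝ} {K L L' v : ℝ} (hy : StronglyMeasurable[m] y)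
    (hψc : Continuous ψ) (hψ : ∀ z, ‖ψ z‖ ≤ K) (hf : Differentiable ℝ f)
    (hfL : ∀ z, ‖fderiv ℝ f z‖ ≤ L) (hL' : 0 ≤ L')
    (hf2 : ∀ z z', ‖fderiv ℝ f z - fderiv ℝ f z'‖ ≤ L' * ‖z - z'‖)
    (hi : IsIndepGaussian μ m v i) (hv : 0 ≤ v)
    (hq : ∀ ω, ‖f (y ω) - q ω‖ ≤ ρ ω) (hρ : Integrable ρ μ)
    (hint : Integrable (fun ω => f (x ω) - q ω) μ)
    (hxy : Integrable (fun ω => ‖x ω - y ω‖ ^ 2) μ)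
    (hxyi : Integrable (fun ω => ‖x ω - y ω - i ω‖) μ) :
    |∫ ω, ψ (y ω) (f (x ω) - q ω) ∂μ|
      ≤ K * (∫ ω, ρ ω ∂μ + 2 * L' * ∫ ω, ‖x ω - y ω‖ ^ 2 ∂μ
        + L * ∫ ω, ‖x ω - y ω - i ω‖ ∂μ) := by
  have hK : 0 ≤ K := (norm_nonneg _).trans (hψ 0)
  have hL : 0 ≤ L := (norm_nonneg _).trans (hfL 0)
  have hfc : Continuous (fderiv ℝ f) := continuous_of_norm_sub_le hL' hf2
  -- The part of the increment linear in i is this bounded functional, known to m, applied to i; its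
  -- mean is 0 and it can be subtracted.
  let Z : Ω → E →L[ℝ] ℝ := fun ω => (ψ (y ω)).comp (fderiv ℝ f (y ω))
  have hZm : Measurable[m] Z :=
    ((hψc.clm_comp hfc).measurable).comp hy.measurable
  have hZb : ∀ ω, ‖Z ω‖ ≤ K * L := fun ω =>
    (ContinuousLinearMap.opNorm_comp_le _ _).trans
      (mul_le_mul (hψ _) (hfL _) (norm_nonneg _) hK)
  have hZ0 := hi.integral_apply_eq_zero hm hv hZm hZb
  have hii : Integrable i μ := (hi.memLp_two hv).integrable one_le_two
  have hZi : Integrable (fun ω => Z ω (i ω)) μ := by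
    refine (hii.norm.const_mul (K * L)).mono' ?_ (Eventually.of_forall fun ω => ?_)
    · exact (isBoundedBilinearMap_apply (𝕜 := ℝ) (E := E)
        (F := ℝ)).continuous.comp_aestronglyMeasurable
        ((hZm.mono hm le_rfl).aestronglyMeasurable.prodMk hii.1)
    · exact (Z ω).le_of_opNorm_le (hZb ω) _
  have hψi : Integrable (fun ω => ψ (y ω) (f (x ω) - q ω)) μ := by
    refine (hint.norm.const_mul K).mono' ?_ (Eventually.of_forall fun ω => ?_)
    · exact (isBoundedBilinearMap_apply (𝕜 := ℝ) (E := E)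
        (F := ℝ)).continuous.comp_aestronglyMeasurable
        ((hψc.comp_stronglyMeasurable (hy.mono hm)).aestronglyMeasurable.prodMk hint.1)
    · exact (ψ (y ω)).le_of_opNorm_le (hψ _) _
  have hsub : ∫ ω, ψ (y ω) (f (x ω) - q ω) ∂μ
      = ∫ ω, (ψ (y ω) (f (x ω) - q ω) - Z ω (i ω)) ∂μ := by
    rw [integral_sub hψi hZi, hZ0, sub_zero]
  rw [hsub, ← Real.norm_eq_abs]
  have hdom : Integrable (fun ω => K * (ρ ω + 2 * L' * ‖x ω - y ω‖ ^ 2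
      + L * ‖x ω - y ω - i ω‖)) μ :=
    ((hρ.add (hxy.const_mul _)).add (hxyi.const_mul _)).const_mul _
  refine (norm_integral_le_of_norm_le hdom (Eventually.of_forall fun ω => ?_)).trans ?_
  · have hdec : ψ (y ω) (f (x ω) - q ω) - Z ω (i ω)
        = ψ (y ω) ((f (y ω) - q ω) + (f (x ω) - f (y ω) - fderiv ℝ f (y ω) (x ω - y ω))
          + fderiv ℝ f (y ω) (x ω - y ω - i ω)) := by
      simp only [Z, ContinuousLinearMap.comp_apply, ← map_sub]
      congr 1
      rw [map_sub (fderiv ℝ f (y ω)) (x ω - y ω) (i ω)]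
      abel
    rw [hdec]
    refine ((ψ (y ω)).le_of_opNorm_le (hψ _) _).trans (mul_le_mul_of_nonneg_left ?_ hK)
    refine (norm_add₃_le).trans ?_
    have h2 := norm_sub_sub_fderiv_le hf hL' hf2 (y ω) (y ω) (x ω)
    have h3 := (fderiv ℝ f (y ω)).le_of_opNorm_le (hfL _) (x ω - y ω - i ω)
    have h4 := hq ω
    have h5 : L' * (‖x ω - y ω‖ + ‖x ω - y ω‖) * ‖x ω - y ω‖ = 2 * L' * ‖x ω - y ω‖ ^ 2 := by
      ring
    linarith
  · rw [integral_const_mul, integral_add (f := fun ω => ρ ω + 2 * L' * ‖x ω - y ω‖ ^ 2)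
      (hρ.add (hxy.const_mul _)) (hxyi.const_mul _), integral_add hρ (hxy.const_mul _),
      integral_const_mul, integral_const_mul]

variable {t s T B L L' K C Cd Ce : ℝ} {X J P : ℝ → Ω → E}

/-- The difference φ(X_t) - φ(X_t - e) is compared with Dφ(X_s) e. The remainder is at most K (‖X_t
- X_s‖ + ‖e‖) ‖e‖, with L² orders 1/2 and 3/2 for the increment and e, hence of order 2 in mean. In
E Dφ(X_s) e the expectation is taken under the time integral: each E Dφ(X_s)(P_v - P_s) has order s
- v, because the Gaussian part of the increment has mean zero. -/
theorem weak_error_le (hm : m ≤ mΩ) (hP : IsContPaths P)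
    (hXt : StronglyMeasurable (X t)) (hXm : StronglyMeasurable[m] (X s))
    (hXs : MemLp (X s) 2 μ) {w : ℝ → ℝ} (hw : Continuous w)
    (hwB : ∀ v ∈ Icc t s, |w v| ≤ B) (hts : t < s) (hT : s - t ≤ T) (hL' : 0 ≤ L') (hCe : 0 ≤ Ce)
    {p : E → ℝ → E} (hPp : ∀ v ∈ Icc t s, ∀ ω, P v ω = p (X v ω) v)
    (hp : ∀ v ∈ Icc t s, ∀ x, ‖p x v - p x s‖ ≤ L * ((1 + ‖x‖) * (s - v)))
    (hpd : ∀ v ∈ Icc t s, Differentiable ℝ (fun x => p x v) ∧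
      (∀ x, ‖fderiv ℝ (fun x => p x v) x‖ ≤ L) ∧
      ∀ x y, ‖fderiv ℝ (fun x => p x v) x - fderiv ℝ (fun x => p x v) y‖ ≤ L' * ‖x - y‖)
    (hinc : ∀ v ∈ Icc t s, Integrable (fun ω => ‖X v ω - X s ω‖ ^ 2) μ ∧
      ∫ ω, ‖X v ω - X s ω‖ ^ 2 ∂μ ≤ C * (1 + ∫ ω, ‖X s ω‖ ^ 2 ∂μ) * (s - v))
    (hJ : ∀ v ∈ Icc t s, Integrable (fun ω => ‖J v ω‖) μ ∧
      ∫ ω, ‖J v ω‖ ∂μ ≤ Cd * (1 + ∫ ω, ‖X s ω‖ ^ 2 ∂μ) * (s - v))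
    (hI : ∀ v ∈ Icc t s, ∃ r, 0 ≤ r ∧ IsIndepGaussian μ m r fun ω => X v ω - X s ω - J v ω)
    {R : ℝ} (hR : 0 ≤ R) (hPi : ∀ v ∈ Icc t s, Integrable (fun ω => ‖P v ω - P s ω‖ ^ 2) μ ∧
      ∫ ω, ‖P v ω - P s ω‖ ^ 2 ∂μ ≤ R * (s - v))
    {e : Ω → E} (he : ∀ ω, e ω = ∫ v in t..s, w v • (P v ω - P s ω))
    (he2 : MemLp e 2 μ)
    (heC : ∫ ω, ‖e ω‖ ^ 2 ∂μ ≤ Ce * (1 + ∫ ω, ‖X s ω‖ ^ 2 ∂μ) * (s - t) ^ 3)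
    {φ : E → ℝ} (hφ : Differentiable ℝ φ) (hφK : ∀ x, ‖fderiv ℝ φ x‖ ≤ K)
    (hφL : ∀ x y, ‖fderiv ℝ φ x - fderiv ℝ φ y‖ ≤ K * ‖x - y‖) :
    Integrable (fun ω => φ (X t ω)) μ ∧ Integrable (fun ω => φ (X t ω - e ω)) μ ∧
      |∫ ω, φ (X t ω) ∂μ - ∫ ω, φ (X t ω - e ω) ∂μ|
        ≤ (C + Ce + Ce * T + B * (2 * L + 2 * L' * C + L * Cd)) * K
          * (1 + ∫ ω, ‖X s ω‖ ^ 2 ∂μ) * (s - t) ^ 2 := by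
  set M := ∫ ω, ‖X s ω‖ ^ 2 ∂μ with hM
  have hM0 : 0 ≤ M := integral_nonneg fun _ => by positivity
  have hK : 0 ≤ K := (norm_nonneg _).trans (hφK 0)
  have htm : t ∈ Icc t s := ⟨le_rfl, hts.le⟩
  have hst : 0 < s - t := sub_pos.2 hts
  have hB : 0 ≤ B := (abs_nonneg _).trans (hwB t htm)
  have hL : 0 ≤ L := (norm_nonneg _).trans ((hpd t htm).2.1 0)
  have hXs2 : Integrable (fun ω => ‖X s ω‖ ^ 2) μ := hXs.integrable_norm_pow two_ne_zero
  have hψc : Continuous (fderiv ℝ φ) := continuous_of_norm_sub_le hK hφL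
  have hXsm : StronglyMeasurable (X s) := hXm.mono hm
  -- integrability of the test function
  have hφint : ∀ Y : Ω → E, MemLp Y 2 μ → Integrable (fun ω => φ (Y ω)) μ := by
    intro Y hY
    refine ((integrable_const |φ 0|).add ((hY.integrable one_le_two).norm.const_mul K)).mono'
      (hφ.continuous.comp_aestronglyMeasurable hY.1) (Eventually.of_forall fun ω => ?_)
    have h1 := convex_univ.norm_image_sub_le_of_norm_fderiv_le (𝕜 := ℝ) (f := φ) (C := K)
      (fun x _ => hφ x) (fun x _ => hφK x) (mem_univ 0) (mem_univ (Y ω))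
    rw [sub_zero] at h1
    have h2 : ‖φ (Y ω)‖ ≤ ‖φ 0‖ + ‖φ (Y ω) - φ 0‖ := norm_le_norm_add_norm_sub' _ _
    simp only [Pi.add_apply]
    rw [Real.norm_eq_abs (φ 0)] at h2
    linarith
  obtain ⟨hai, hale⟩ := hinc t htm
  have hΔ2 : MemLp (fun ω => X t ω - X s ω) 2 μ :=
    (memLp_two_iff_integrable_sq_norm (hXt.sub hXsm).aestronglyMeasurable).2 hai
  have hXt2 : MemLp (X t) 2 μ := by
    have := hΔ2.add hXs
    refine this.ae_eq (Eventually.of_forall fun ω => ?_)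
    simp
  have hi1 := hφint _ hXt2
  have hi2 := hφint (fun ω => X t ω - e ω) (hXt2.sub he2)
  refine ⟨hi1, hi2, ?_⟩
  have hei : Integrable e μ := he2.integrable one_le_two
  have he2i : Integrable (fun ω => ‖e ω‖ ^ 2) μ := he2.integrable_norm_pow two_ne_zero
  have hψe : Integrable (fun ω => fderiv ℝ φ (X s ω) (e ω)) μ := by
    refine (hei.norm.const_mul K).mono' ?_ (Eventually.of_forall fun ω => ?_)
    · exact (isBoundedBilinearMap_apply (𝕜 := ℝ) (E := E)
        (F := ℝ)).continuous.comp_aestronglyMeasurable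
        ((hψc.comp_stronglyMeasurable hXsm).aestronglyMeasurable.prodMk hei.1)
    · exact (fderiv ℝ φ (X s ω)).le_of_opNorm_le (hφK _) _
  -- the remainder of the expansion of `φ` at `X s`
  have hrem : |∫ ω, (φ (X t ω) - φ (X t ω - e ω) - fderiv ℝ φ (X s ω) (e ω)) ∂μ|
      ≤ K * ((C + Ce + Ce * T) * (1 + M) * (s - t) ^ 2) := by
    have hdom : Integrable (fun ω => K * ((s - t) * ‖X t ω - X s ω‖ ^ 2
        + ((s - t)⁻¹ + 1) * ‖e ω‖ ^ 2)) μ :=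
      ((hai.const_mul _).add (he2i.const_mul _)).const_mul _
    rw [← Real.norm_eq_abs]
    refine (norm_integral_le_of_norm_le hdom (Eventually.of_forall fun ω => ?_)).trans ?_
    · have h1 := norm_sub_sub_fderiv_le hφ hK hφL (X s ω) (X t ω - e ω) (X t ω)
      rw [sub_sub_cancel, mul_assoc] at h1
      refine h1.trans (mul_le_mul_of_nonneg_left ?_ hK)
      set a := ‖X t ω - X s ω‖
      set b := ‖e ω‖
      -- Young's inequality with weight s - t: both (s - t) a² and b²/(s - t) then have order (s -
      -- t)² in mean.
      have h2 : 0 ≤ (s - t) * (a - (s - t)⁻¹ * b) ^ 2 := by positivity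
      have h3 : (s - t) * (a - (s - t)⁻¹ * b) ^ 2
          = (s - t) * a ^ 2 - 2 * (a * b) + (s - t)⁻¹ * b ^ 2 := by
        field_simp
        ring
      have h4 : 0 ≤ (s - t) * a ^ 2 := by positivity
      have h5 : 0 ≤ (s - t)⁻¹ * b ^ 2 := by positivity
      nlinarith
    · rw [integral_const_mul, integral_add (hai.const_mul _) (he2i.const_mul _),
        integral_const_mul, integral_const_mul]
      refine mul_le_mul_of_nonneg_left ?_ hK
      have h1 := mul_le_mul_of_nonneg_left hale hst.le
      have h2 := mul_le_mul_of_nonneg_left heC (show 0 ≤ (s - t)⁻¹ + 1 by positivity)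
      have h3 : ((s - t)⁻¹ + 1) * (Ce * (1 + M) * (s - t) ^ 3)
          = Ce * (1 + M) * (s - t) ^ 2 + Ce * (1 + M) * (s - t) ^ 2 * (s - t) := by
        field_simp
      have h4 := mul_le_mul_of_nonneg_left hT (show 0 ≤ Ce * (1 + M) * (s - t) ^ 2 by positivity)
      rw [h3] at h2
      nlinarith
  -- the first-order term
  have hfirst : |∫ ω, fderiv ℝ φ (X s ω) (e ω) ∂μ|
      ≤ K * (B * (2 * L + 2 * L' * C + L * Cd) * (1 + M) * (s - t) ^ 2) := by
    have hdiff : IsContPaths fun v ω => P v ω - P s ω := hP.sub (.const (hP.meas s))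
    let Z : ℝ → Ω → ℝ := fun v ω => fderiv ℝ φ (X s ω) (w v • (P v ω - P s ω))
    have hZ : IsContPaths Z :=
      ⟨fun ω => (fderiv ℝ φ (X s ω)).continuous.comp (hw.smul (hdiff.cont ω)),
        fun v => stronglyMeasurable_clm_apply (hψc.comp_stronglyMeasurable hXsm)
          ((hdiff.meas v).const_smul (w v))⟩
    have hPint : ∀ v ∈ Icc t s, Integrable (fun ω => P v ω - P s ω) μ := fun v hv =>
      ((memLp_two_iff_integrable_sq_norm (hdiff.meas v).aestronglyMeasurable).2
        (hPi v hv).1).integrable one_le_two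
    have hZle : ∀ v ∈ Icc t s, ∀ ω, ‖Z v ω‖ ≤ K * B * ‖P v ω - P s ω‖ := fun v hv ω => by
      refine ((fderiv ℝ φ (X s ω)).le_of_opNorm_le (hφK _) _).trans ?_
      rw [norm_smul, Real.norm_eq_abs, mul_assoc]
      gcongr
      exact hwB v hv
    have hZint : ∀ v ∈ Icc t s, Integrable (Z v) μ := fun v hv =>
      ((hPint v hv).norm.const_mul (K * B)).mono' (hZ.meas v).aestronglyMeasurable
        (Eventually.of_forall (hZle v hv))
    -- This crude bound serves only the exchange of integrals; R does not enter the final constant.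
    have hZb : ∀ v ∈ Icc t s, ∫ ω, ‖Z v ω‖ ∂μ ≤ K * B * (1 + R * (s - t)) := by
      intro v hv
      refine (integral_mono (hZint v hv).norm ((hPint v hv).norm.const_mul _)
        (hZle v hv)).trans ?_
      rw [integral_const_mul]
      refine mul_le_mul_of_nonneg_left ?_ (by positivity)
      have h1 : ∫ ω, ‖P v ω - P s ω‖ ∂μ ≤ ∫ ω, (1 + ‖P v ω - P s ω‖ ^ 2) ∂μ := by
        refine integral_mono (hPint v hv).norm ((integrable_const _).add (hPi v hv).1) fun ω => ?_
        show ‖P v ω - P s ω‖ ≤ 1 + ‖P v ω - P s ω‖ ^ 2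
        nlinarith [sq_nonneg (‖P v ω - P s ω‖ - 1), norm_nonneg (P v ω - P s ω)]
      rw [integral_add (integrable_const _) (hPi v hv).1, integral_const, probReal_univ,
        one_smul] at h1
      have h2 : R * (s - v) ≤ R * (s - t) := mul_le_mul_of_nonneg_left (by linarith [hv.1]) hR
      linarith [(hPi v hv).2]
    have hZmean : ∀ v ∈ Icc t s, ‖∫ ω, Z v ω ∂μ‖
        ≤ K * B * (2 * L + 2 * L' * C + L * Cd) * (1 + M) * (s - t) := by
      intro v hv
      have hv0 : 0 ≤ s - v := sub_nonneg.2 hv.2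
      obtain ⟨r, hr, hIv⟩ := hI v hv
      obtain ⟨hd1, hd2, hd3⟩ := hpd v hv
      have hρ : Integrable (fun ω => L * ((1 + ‖X s ω‖) * (s - v))) μ :=
        ((((integrable_const _).add (hXs.integrable one_le_two).norm)).mul_const _).const_mul _
      have hJeq : ∀ ω, X v ω - X s ω - (X v ω - X s ω - J v ω) = J v ω := fun ω => by abel
      have hsm : s ∈ Icc t s := ⟨hts.le, le_rfl⟩
      have hkey := abs_integral_functional_increment_le (μ := μ) hm (x := X v) (q := P s) hXm hψc
        hφK hd1 hd2 hL' hd3 hIv hr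
        (fun ω => by rw [hPp s hsm]; exact hp v hv (X s ω)) hρ
        (by simpa only [hPp v hv] using hPint v hv) (hinc v hv).1
        (by simpa only [hJeq] using (hJ v hv).1)
      simp only [hJeq, ← hPp v hv] at hkey
      have hρle : ∫ ω, L * ((1 + ‖X s ω‖) * (s - v)) ∂μ ≤ L * (2 * (1 + M) * (s - v)) := by
        rw [integral_const_mul, integral_mul_const]
        gcongr
        have h1 : ∫ ω, (1 + ‖X s ω‖) ∂μ ≤ ∫ ω, (2 + ‖X s ω‖ ^ 2) ∂μ := by
          refine integral_mono ((integrable_const _).add (hXs.integrable one_le_two).norm)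
            ((integrable_const _).add hXs2) fun ω => ?_
          show 1 + ‖X s ω‖ ≤ 2 + ‖X s ω‖ ^ 2
          nlinarith [sq_nonneg (‖X s ω‖ - 1)]
        rw [integral_add (integrable_const (2 : ℝ)) hXs2, integral_const, probReal_univ,
          one_smul] at h1
        linarith
      have h2 := mul_le_mul_of_nonneg_left (hinc v hv).2 (show 0 ≤ 2 * L' by positivity)
      have h3 := mul_le_mul_of_nonneg_left (hJ v hv).2 hL
      have hsum := hkey.trans (mul_le_mul_of_nonneg_left
        (add_le_add (add_le_add hρle h2) h3) hK)
      have hZv : ∫ ω, Z v ω ∂μ = w v * ∫ ω, fderiv ℝ φ (X s ω) (P v ω - P s ω) ∂μ := by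
        rw [← integral_const_mul]
        simp [Z]
      rw [hZv, norm_mul, Real.norm_eq_abs, Real.norm_eq_abs]
      have h4 := mul_le_mul (hwB v hv) hsum (abs_nonneg _) hB
      refine h4.trans ?_
      -- C and Cd carry no sign assumption; the signs needed follow from the moments that they bound
      -- at time t.
      have hN : 0 ≤ K * (1 + M) * (2 * L + 2 * L' * C + L * Cd) * (s - t) := by
        have h5 : 0 ≤ C * (1 + M) * (s - t) :=
          (integral_nonneg fun _ => by positivity).trans (hinc t htm).2
        have h6 : 0 ≤ Cd * (1 + M) * (s - t) :=
          (integral_nonneg fun _ => by positivity).trans (hJ t htm).2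
        have h7 : 0 ≤ L * (1 + M) * (s - t) := by positivity
        have h8 : 0 ≤ K * (2 * (L * (1 + M) * (s - t)) + 2 * L' * (C * (1 + M) * (s - t))
          + L * (Cd * (1 + M) * (s - t))) := by positivity
        calc (0 : ℝ) ≤ _ := h8
          _ = _ := by ring
      have hc0 : 0 ≤ K * (1 + M) * (2 * L + 2 * L' * C + L * Cd) :=
        nonneg_of_mul_nonneg_left hN hst
      have h9 : s - v ≤ s - t := by linarith [hv.1]
      calc B * (K * (L * (2 * (1 + M) * (s - v)) + 2 * L' * (C * (1 + M) * (s - v))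
            + L * (Cd * (1 + M) * (s - v))))
          = B * (K * (1 + M) * (2 * L + 2 * L' * C + L * Cd)) * (s - v) := by ring
        _ ≤ B * (K * (1 + M) * (2 * L + 2 * L' * C + L * Cd)) * (s - t) :=
          mul_le_mul_of_nonneg_left h9 (mul_nonneg hB hc0)
        _ = _ := by ring
    have hswap : ∀ ω, fderiv ℝ φ (X s ω) (e ω) = ∫ v in t..s, Z v ω := by
      intro ω
      rw [he ω, ← ContinuousLinearMap.intervalIntegral_comp_comm]
      exact (hw.smul (hdiff.cont ω)).intervalIntegrable _ _
    simp_rw [hswap]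
    have := hZ.norm_integral_integral_le hts.le hZint hZb hZmean
    rw [Real.norm_eq_abs] at this
    refine this.trans (le_of_eq ?_)
    ring
  have hsplit : ∫ ω, φ (X t ω) ∂μ - ∫ ω, φ (X t ω - e ω) ∂μ
      = ∫ ω, (φ (X t ω) - φ (X t ω - e ω) - fderiv ℝ φ (X s ω) (e ω)) ∂μ
        + ∫ ω, fderiv ℝ φ (X s ω) (e ω) ∂μ := by
    rw [integral_sub (f := fun ω => φ (X t ω) - φ (X t ω - e ω)) (hi1.sub hi2) hψe,
      integral_sub hi1 hi2]
    ring
  rw [hsplit]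
  refine (abs_add_le _ _).trans ((add_le_add hrem hfirst).trans (le_of_eq ?_))
  ring

end Weak
end

/-! ### Uniform coefficient bounds, error representation and continuous versions -/

noncomputable section

set_option linter.unusedSectionVars false

/-- A common bound for the coefficients of the Bridge SDE away from the singularity at `σ = 0`. -/
structure BridgeSchedule.IsCoeffBound (S : BridgeSchedule) (δ A : ℝ) : Prop where
  nonneg : 0 ≤ A
  f_le : ∀ u ∈ Icc δ S.T, |S.f u| ≤ A
  pullRate_le : ∀ u ∈ Icc δ S.T, |S.pullRate u| ≤ A
  α_le : ∀ u ∈ Icc δ S.T, |S.α u| ≤ A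
  g_sq_le : ∀ u ∈ Icc δ S.T, S.g u ^ 2 ≤ A
  snrRate_le : ∀ u ∈ Icc δ S.T, S.snrRate u ≤ A
  div_snr_le : ∀ u ∈ Icc δ S.T, |S.α u / S.snr u| ≤ A

theorem BridgeSchedule.exists_isCoeffBound (S : BridgeSchedule) {δ : ℝ} (hδ : δ ∈ Icc 0 S.T)
    (hσ : 0 < S.σ δ) : ∃ A, S.IsCoeffBound δ A := by
  have hsub : Icc δ S.T ⊆ Icc 0 S.T := Icc_subset_Icc_left hδ.1
  obtain ⟨A₁, h₁⟩ := isCompact_Icc.exists_bound_of_continuousOn (S.f_cont.mono hsub)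
  obtain ⟨A₂, h₂⟩ := isCompact_Icc.exists_bound_of_continuousOn (S.continuousOn_pullRate hδ hσ)
  obtain ⟨A₃, h₃⟩ := isCompact_Icc.exists_bound_of_continuousOn (S.continuousOn_α.mono hsub)
  obtain ⟨A₄, h₄⟩ := isCompact_Icc.exists_bound_of_continuousOn ((S.g_cont.mono hsub).pow 2)
  obtain ⟨A₅, h₅⟩ := isCompact_Icc.exists_bound_of_continuousOn (S.continuousOn_snrRate hδ hσ)
  have hdiv : ContinuousOn (fun u => S.α u / S.snr u) (Icc δ S.T) :=
    ((S.continuousOn_σ_sq.div S.continuousOn_α fun u hu => (S.α_pos u hu).ne').mono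
      hsub).congr fun u _ => S.div_snr
  obtain ⟨A₆, h₆⟩ := isCompact_Icc.exists_bound_of_continuousOn hdiv
  have hm : δ ∈ Icc δ S.T := ⟨le_rfl, hδ.2⟩
  have n₁ := (norm_nonneg _).trans (h₁ δ hm)
  have n₂ := (norm_nonneg _).trans (h₂ δ hm)
  have n₃ := (norm_nonneg _).trans (h₃ δ hm)
  have n₄ := (norm_nonneg _).trans (h₄ δ hm)
  have n₅ := (norm_nonneg _).trans (h₅ δ hm)
  have n₆ := (norm_nonneg _).trans (h₆ δ hm)
  refine ⟨A₁ + A₂ + A₃ + A₄ + A₅ + A₆, by positivity, fun u hu => ?_, fun u hu => ?_,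
    fun u hu => ?_, fun u hu => ?_, fun u hu => ?_, fun u hu => ?_⟩
  · have := h₁ u hu; rw [Real.norm_eq_abs] at this; linarith
  · have := h₂ u hu; rw [Real.norm_eq_abs] at this; linarith
  · have := h₃ u hu; rw [Real.norm_eq_abs] at this; linarith
  · have := (Real.le_norm_self _).trans (h₄ u hu)
    simp only [Pi.pow_apply] at this
    linarith
  · have := (Real.le_norm_self _).trans (h₅ u hu); linarith
  · have := h₆ u hu; rw [Real.norm_eq_abs] at this; linarith

section Errors

variable {d : ℕ} {S : BridgeSchedule}
    {D : EuclideanSpace ℝ (Fin d) → ℝ → EuclideanSpace ℝ (Fin d) → ℝ → EuclideanSpace ℝ (Fin d)}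
    {xT : EuclideanSpace ℝ (Fin d)} {δ t s : ℝ}
    {Ω : Type*} {mΩ : MeasurableSpace Ω} {μ : Measure Ω} [IsProbabilityMeasure μ]
    {ℱ : Filtration ℝᵒᵈ mΩ} {W X : ℝ → Ω → EuclideanSpace ℝ (Fin d)}

/-- The exact error of the first-order step. -/
theorem sub_firstOrderStep_eq (ht : 0 ≤ t) (hσ : 0 < S.σ t) (hts : t < s) (hs : s ≤ S.T)
    {x xs z : EuclideanSpace ℝ (Fin d)} {p : ℝ → EuclideanSpace ℝ (Fin d)}
    (hp : ContinuousOn p (Icc t s))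
    (hx : x = (S.snr s / S.snr t * (S.α t / S.α s)) • xs + S.eiDataTerm t s p
      + (S.σ t * Real.sqrt (1 - S.snr s / S.snr t)) • z) :
    x - S.firstOrderStep t s xs (p s) z
      = ∫ u in t..s, (S.α t / S.snr t * S.snrRate u) • (p u - p s) := by
  have htT : t ∈ Icc 0 S.T := ⟨ht, hts.le.trans hs⟩
  have hrate := (S.continuousOn_snrRate htT hσ).mono (Icc_subset_Icc_right hs)
  -- The frozen prediction is rewritten as the same weighted integral, and the terms in x_s and z
  -- cancel because both formulas share them.
  rw [hx, BridgeSchedule.firstOrderStep, ← S.eiDataTerm_const ht hts hs,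
    S.eiDataTerm_eq ht hσ hts.le hs, S.eiDataTerm_eq ht hσ hts.le hs]
  simp_rw [mul_smul, smul_sub]
  rw [intervalIntegral.integral_sub, intervalIntegral.integral_smul,
    intervalIntegral.integral_smul]
  · abel
  · exact ((hrate.fun_smul hp).fun_const_smul _).intervalIntegrable_of_Icc hts.le
  · exact ((hrate.fun_smul continuousOn_const).fun_const_smul _).intervalIntegrable_of_Icc hts.le

theorem norm_sub_firstOrderStep_le {A : ℝ} (hA : S.IsCoeffBound δ A) (ht : 0 ≤ t) (hδt : δ ≤ t)
    (hσ : 0 < S.σ t) (hts : t < s) (hs : s ≤ S.T)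
    {x xs z : EuclideanSpace ℝ (Fin d)} {p : ℝ → EuclideanSpace ℝ (Fin d)}
    (hp : ContinuousOn p (Icc t s))
    (hx : x = (S.snr s / S.snr t * (S.α t / S.α s)) • xs + S.eiDataTerm t s p
      + (S.σ t * Real.sqrt (1 - S.snr s / S.snr t)) • z) {M : ℝ}
    (hM : ∀ u ∈ Icc t s, ‖p u - p s‖ ≤ M * (s - u)) :
    ‖x - S.firstOrderStep t s xs (p s) z‖ ≤ A * A * M * (s - t) ^ 2 := by
  rw [sub_firstOrderStep_eq ht hσ hts hs hp hx]
  have hst : 0 < s - t := sub_pos.2 hts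
  have hA0 := hA.nonneg
  have hM0 : 0 ≤ M := nonneg_of_mul_nonneg_left
    ((norm_nonneg _).trans (hM t ⟨le_rfl, hts.le⟩)) hst
  have h := intervalIntegral.norm_integral_le_of_norm_le_const (a := t) (b := s)
    (f := fun u => (S.α t / S.snr t * S.snrRate u) • (p u - p s)) (C := A * A * (M * (s - t)))
    fun u hu => ?_
  · rw [abs_of_pos hst] at h
    refine h.trans (le_of_eq ?_)
    ring
  · rw [uIoc_of_le hts.le] at hu
    have hu' : u ∈ Icc t s := Ioc_subset_Icc_self hu
    have huδ : u ∈ Icc δ S.T := ⟨hδt.trans hu'.1, hu'.2.trans hs⟩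
    rw [norm_smul, norm_mul, Real.norm_eq_abs, Real.norm_of_nonneg (S.snrRate_nonneg u)]
    have h1 := hA.div_snr_le t ⟨hδt, hts.le.trans hs⟩
    have h2 := hA.snrRate_le u huδ
    have h3 := S.snrRate_nonneg u
    have h4 : ‖p u - p s‖ ≤ M * (s - t) :=
      (hM u hu').trans (mul_le_mul_of_nonneg_left (by linarith [hu'.1]) hM0)
    gcongr

/-- A version of a solution with continuous paths, together with its predictions and drift. -/
theorem IsBridgeSDESolution.exists_contPaths
    (hD : ContinuousOn (fun q : EuclideanSpace ℝ (Fin d) × ℝ => D q.1 q.2 xT S.T)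
      (Set.univ ×ˢ Set.Icc 0 S.T)) (ht : 0 ≤ t) (hσ : 0 < S.σ t) (hts : t ≤ s) (hs : s ≤ S.T)
    (hX : IsBridgeSDESolution μ S D xT ℱ t s W X) :
    ∃ Y β P : ℝ → Ω → EuclideanSpace ℝ (Fin d),
      IsContPaths Y ∧ IsContPaths β ∧ IsContPaths P ∧ Y s = X s ∧
      (∀ᵐ ω ∂μ, ContinuousOn (fun u => X u ω) (Icc t s) ∧ ∀ u ∈ Icc t s, Y u ω = X u ω) ∧
      (∀ u ∈ Icc t s, ∀ ω, P u ω = D (Y u ω) u xT S.T) ∧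
      (∀ u ∈ Icc t s, ∀ ω, β u ω = S.reducedDrift u (Y u ω) (P u ω)) ∧
      ∀ u ∈ Icc t s, IsIndepGaussian μ (ℱ (OrderDual.toDual s)) (∫ v in u..s, S.g v ^ 2)
        (fun ω => Y u ω - Y s ω - ∫ v in s..u, β v ω) := by
  -- Clamping time to [t, s] extends paths and coefficients continuously to all of ℝ.
  let π : ℝ → ℝ := fun u => (projIcc t s hts u : ℝ)
  have hπc : Continuous π := continuous_subtype_val.comp continuous_projIcc
  have hπm : ∀ u, π u ∈ Icc t s := fun u => (projIcc t s hts u).2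
  have hπ : ∀ u ∈ Icc t s, π u = u := fun u hu => by simp only [π, projIcc_of_mem hts hu]
  have hsm : s ∈ Icc t s := ⟨hts, le_rfl⟩
  have htT : t ∈ Icc 0 S.T := ⟨ht, hts.trans hs⟩
  have hsub : Icc t s ⊆ Icc 0 S.T := Icc_subset_Icc ht hs
  have hsub' : Icc t s ⊆ Icc t S.T := Icc_subset_Icc_right hs
  -- A measurable null hull, since the set of discontinuous paths need not be measurable.
  let N : Set Ω := toMeasurable μ {ω | ¬ ContinuousOn (fun u => X u ω) (Icc t s)}
  have hN0 : μ N = 0 := by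
    rw [measure_toMeasurable]; exact hX.cont
  have hNc : ∀ ω ∈ Nᶜ, ContinuousOn (fun u => X u ω) (Icc t s) := fun ω hω => by
    by_contra h
    exact hω (subset_toMeasurable _ _ h)
  have hNm : MeasurableSet Nᶜ := (measurableSet_toMeasurable _ _).compl
  have hXm : ∀ u ∈ Icc t s, StronglyMeasurable (X u) := fun u hu => (hX.adapted u hu).mono (ℱ.le _)
  -- On N the path is frozen at X_s. Thus Y_s = X_s everywhere and Y_s keeps its measurability at
  -- time s, although N need not belong to that σ-algebra.
  let Y : ℝ → Ω → EuclideanSpace ℝ (Fin d) := fun u ω =>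
    X s ω + Nᶜ.indicator (fun ω => X (π u) ω - X s ω) ω
  have hY : IsContPaths Y := by
    refine ⟨fun ω => ?_, fun u => ?_⟩
    · by_cases hω : ω ∈ Nᶜ
      · simp only [Y, indicator_of_mem hω]
        exact continuous_const.add
          (((hNc ω hω).comp_continuous hπc hπm).sub continuous_const)
      · simp only [Y, indicator_of_notMem hω]
        exact continuous_const
    · exact (hXm s hsm).add
        (((hXm _ (hπm u)).sub (hXm s hsm)).indicator hNm)
  let P : ℝ → Ω → EuclideanSpace ℝ (Fin d) := fun u ω => D (Y u ω) (π u) xT S.T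
  have hDπ : Continuous fun q : EuclideanSpace ℝ (Fin d) × ℝ => D q.1 (π q.2) xT S.T :=
    hD.comp_continuous (f := fun q : EuclideanSpace ℝ (Fin d) × ℝ => (q.1, π q.2))
      (continuous_fst.prodMk (hπc.comp continuous_snd)) fun q => ⟨mem_univ _, hsub (hπm _)⟩
  have hP : IsContPaths P :=
    ⟨fun ω => hDπ.comp ((hY.cont ω).prodMk continuous_id), fun u =>
      (hDπ.comp (Continuous.prodMk continuous_id continuous_const)).comp_stronglyMeasurable
        (hY.meas u)⟩
  let β : ℝ → Ω → EuclideanSpace ℝ (Fin d) := fun u ω => S.reducedDrift (π u) (Y u ω) (P u ω)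
  have hfc : IsContPaths fun u (_ : Ω) => S.f (π u) := .deterministic
    ((S.f_cont.mono hsub).comp_continuous hπc hπm)
  have hqc : IsContPaths fun u (_ : Ω) => S.pullRate (π u) := .deterministic
    (((S.continuousOn_pullRate htT hσ).mono hsub').comp_continuous hπc hπm)
  have hαc : IsContPaths fun u (_ : Ω) => S.α (π u) := .deterministic
    ((S.continuousOn_α.mono hsub).comp_continuous hπc hπm)
  have hβ : IsContPaths β := (hfc.smul hY).add (hqc.smul (hY.sub (hαc.smul hP)))
  have hYs : Y s = X s := by
    funext ω
    by_cases hω : ω ∈ Nᶜ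
    · simp only [Y, indicator_of_mem hω, hπ s hsm]; abel
    · simp only [Y, indicator_of_notMem hω, add_zero]
  have hYX : ∀ ω ∈ Nᶜ, ∀ u ∈ Icc t s, Y u ω = X u ω := fun ω hω u hu => by
    simp only [Y, indicator_of_mem hω, hπ u hu]; abel
  have hNae : ∀ᵐ ω ∂μ, ω ∈ Nᶜ := compl_mem_ae_iff.2 hN0
  refine ⟨Y, β, P, hY, hβ, hP, hYs, ?_, fun u hu ω => ?_, fun u hu ω => ?_, fun u hu => ?_⟩
  · filter_upwards [hNae] with ω hω using ⟨hNc ω hω, hYX ω hω⟩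
  · simp only [P, hπ u hu]
  · simp only [β, hπ u hu]
  · refine (isIndepGaussian_bridgeNoise hD ht hσ hs hX hu).congr ?_
    filter_upwards [hNae] with ω hω
    rw [bridgeNoise, hYX ω hω u hu, hYX ω hω s hsm]
    congr 1
    refine intervalIntegral.integral_congr fun v hv => ?_
    rw [uIcc_of_ge hu.2] at hv
    have hv' : v ∈ Icc t s := ⟨hu.1.trans hv.1, hv.2⟩
    simp only [β, P, hπ v hv', hYX ω hω v hv']

theorem norm_reducedDrift_le {A cp : ℝ} (hA : S.IsCoeffBound δ A) {u : ℝ} (hu : u ∈ Icc δ S.T)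
    {x p : EuclideanSpace ℝ (Fin d)} (hp : ‖p‖ ≤ cp * (1 + ‖x‖)) :
    ‖S.reducedDrift u x p‖ ≤ (A + A * (1 + A * cp)) * (1 + ‖x‖) := by
  have hA0 := hA.nonneg
  have h1 := hA.f_le u hu
  have h2 := hA.pullRate_le u hu
  have h3 := hA.α_le u hu
  calc ‖S.reducedDrift u x p‖ ≤ ‖S.f u • x‖ + ‖S.pullRate u • (x - S.α u • p)‖ := norm_add_le _ _
    _ ≤ ‖S.f u • x‖ + |S.pullRate u| * (‖x‖ + ‖S.α u • p‖) := by
      rw [norm_smul (S.pullRate u), Real.norm_eq_abs]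
      gcongr
      exact norm_sub_le _ _
    _ = |S.f u| * ‖x‖ + |S.pullRate u| * (‖x‖ + |S.α u| * ‖p‖) := by
      rw [norm_smul, norm_smul, Real.norm_eq_abs, Real.norm_eq_abs]
    _ ≤ A * (1 + ‖x‖) + A * ((1 + ‖x‖) + A * (cp * (1 + ‖x‖))) := by
      gcongr <;> linarith
    _ = (A + A * (1 + A * cp)) * (1 + ‖x‖) := by ring

end Errors
end

/-! ### Uniform constants and the final assembly -/

noncomputable section

set_option linter.unusedSectionVars false

/-- All constants are formed from the coefficient bound A, the regularity of D, T and the Gaussian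
second moment before t, s, the probability space and the solution are introduced; this gives the
uniformity. -/
theorem exists_error_const {d : ℕ} {S : BridgeSchedule}
    {D : EuclideanSpace ℝ (Fin d) → ℝ → EuclideanSpace ℝ (Fin d) → ℝ → EuclideanSpace ℝ (Fin d)}
    {xT : EuclideanSpace ℝ (Fin d)}
    (hD : ContinuousOn (fun q : EuclideanSpace ℝ (Fin d) × ℝ => D q.1 q.2 xT S.T)
      (Set.univ ×ˢ Set.Icc 0 S.T))
    {δ : ℝ} (hδ : δ ∈ Set.Icc 0 S.T) (hσδ : 0 < S.σ δ)
    (hLip : IsLipschitzPredictor S.T (fun x u => D x u xT S.T)) {L' : ℝ} (hL' : 0 ≤ L') :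
    ∃ C : ℝ, 0 ≤ C ∧ ∀ t s : ℝ, δ ≤ t → t < s → s ≤ S.T →
      ∀ (Ω : Type w) (mΩ : MeasurableSpace Ω) (μ : Measure Ω) [IsProbabilityMeasure μ]
        (ℱ : Filtration ℝᵒᵈ mΩ) (W X : ℝ → Ω → EuclideanSpace ℝ (Fin d))
        (z : Ω → EuclideanSpace ℝ (Fin d)),
        IsBridgeSDESolution μ S D xT ℱ t s W X →
        (∀ᵐ ω ∂μ, X t ω = (S.snr s / S.snr t * (S.α t / S.α s)) • X s ω
            + S.eiDataTerm t s (fun u => D (X u ω) u xT S.T)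
            + (S.σ t * Real.sqrt (1 - S.snr s / S.snr t)) • z ω) →
        MemLp (X s) 2 μ →
        (MemLp (fun ω => X t ω
            - S.firstOrderStep t s (X s ω) (D (X s ω) s xT S.T) (z ω)) 2 μ ∧
          ∫ ω, ‖X t ω - S.firstOrderStep t s (X s ω) (D (X s ω) s xT S.T) (z ω)‖ ^ 2 ∂μ
            ≤ C * (1 + ∫ ω, ‖X s ω‖ ^ 2 ∂μ) * (s - t) ^ 3) ∧
        ((∀ u ∈ Icc 0 S.T, Differentiable ℝ (fun x => D x u xT S.T) ∧
          ∀ x y, ‖fderiv ℝ (fun x => D x u xT S.T) x - fderiv ℝ (fun x => D x u xT S.T) y‖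
            ≤ L' * ‖x - y‖) →
          ∀ (φ : EuclideanSpace ℝ (Fin d) → ℝ) (K : ℝ), Differentiable ℝ φ →
            (∀ x, ‖fderiv ℝ φ x‖ ≤ K) →
            (∀ x y, ‖fderiv ℝ φ x - fderiv ℝ φ y‖ ≤ K * ‖x - y‖) →
            Integrable (fun ω => φ (X t ω)) μ ∧
            Integrable (fun ω => φ (S.firstOrderStep t s (X s ω)
              (D (X s ω) s xT S.T) (z ω))) μ ∧
            |∫ ω, φ (X t ω) ∂μ - ∫ ω, φ (S.firstOrderStep t s (X s ω)
              (D (X s ω) s xT S.T) (z ω)) ∂μ|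
              ≤ C * K * (1 + ∫ ω, ‖X s ω‖ ^ 2 ∂μ) * (s - t) ^ 2) := by
  obtain ⟨A, hA⟩ := S.exists_isCoeffBound hδ hσδ
  obtain ⟨L₀, hL₀⟩ := hLip
  have hA0 := hA.nonneg
  have hT0 := S.T_pos.le
  obtain ⟨L, hL, hpL⟩ : ∃ L : ℝ, 0 ≤ L ∧ ∀ u ∈ Icc 0 S.T, ∀ v ∈ Icc 0 S.T, ∀ x y,
      ‖D x u xT S.T - D y v xT S.T‖ ≤ L * (‖x - y‖ + (1 + ‖x‖) * |u - v|) := by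
    refine ⟨max L₀ 0, le_max_right _ _, fun u hu v hv x y => (hL₀ u hu v hv x y).trans ?_⟩
    exact mul_le_mul_of_nonneg_right (le_max_left _ _) (by positivity)
  -- The linear growth constant of D, by comparison with its value at x = 0, u = 0.
  set cp := ‖D 0 0 xT S.T‖ + L * (1 + S.T) with hcp
  have hcp0 : 0 ≤ cp := by positivity
  have hgrow : ∀ u ∈ Icc 0 S.T, ∀ x, ‖D x u xT S.T‖ ≤ cp * (1 + ‖x‖) := by
    intro u hu x
    have h1 := hpL 0 ⟨le_rfl, hT0⟩ u hu 0 x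
    rw [zero_sub, norm_neg, norm_zero, add_zero, one_mul, zero_sub, abs_neg,
      abs_of_nonneg hu.1] at h1
    have h2 : ‖D x u xT S.T‖ ≤ ‖D 0 0 xT S.T‖ + ‖D 0 0 xT S.T - D x u xT S.T‖ :=
      norm_le_norm_add_norm_sub _ _
    have h3 : L * (‖x‖ + u) ≤ L * (‖x‖ + S.T) := by gcongr; exact hu.2
    have h4 : 0 ≤ (‖D 0 0 xT S.T‖ + L * S.T) * ‖x‖ := by positivity
    rw [hcp]
    nlinarith
  -- Γ is the second moment of a standard Gaussian vector. As ∫_v^s g² ≤ A (s - v), the noise has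
  -- intensity at most A Γ.
  set Γ := ∫ x, ‖x‖ ^ 2 ∂(stdGaussian (EuclideanSpace ℝ (Fin d))) with hΓ
  have hΓ0 : 0 ≤ Γ := integral_nonneg fun _ => by positivity
  set c := A + A * (1 + A * cp) with hc
  have hc0 : 0 ≤ c := by positivity
  set Ci := incrementConst c (A * Γ) S.T with hCi
  have hCi0 : 0 ≤ Ci := incrementConst_nonneg (by positivity) hT0
  set Cp := 2 * L ^ 2 * Ci + 4 * L ^ 2 * S.T with hCp
  have hCp0 : 0 ≤ Cp := by positivity
  set Ce := (A * A) ^ 2 * Cp with hCe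
  have hCe0 : 0 ≤ Ce := by positivity
  set Cw := Ci + Ce + Ce * S.T
    + A * A * (2 * L + 2 * L' * Ci + L * (c * (3 + Ci * S.T))) with hCw
  have hCw0 : 0 ≤ Cw := by positivity
  refine ⟨Ce + Cw, by positivity, ?_⟩
  intro t s hδt hts hs Ω mΩ μ _ ℱ W X z hX hexact hXs
  have ht : 0 ≤ t := hδ.1.trans hδt
  have hσ : 0 < S.σ t := S.σ_pos_of_le hδ hσδ ⟨hδt, hts.le.trans hs⟩
  have hst : 0 < s - t := sub_pos.2 hts
  have hsT : s - t ≤ S.T := by linarith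
  have hsub : Icc t s ⊆ Icc 0 S.T := Icc_subset_Icc ht hs
  have hsubδ : Icc t s ⊆ Icc δ S.T := Icc_subset_Icc hδt hs
  have hsm : s ∈ Icc t s := ⟨hts.le, le_rfl⟩
  have htm : t ∈ Icc t s := ⟨le_rfl, hts.le⟩
  have htδ := hsubδ htm
  obtain ⟨Y, β, P, hY, hβ, hP, hYs, hYX, hPY, hβY, hI⟩ :=
    hX.exists_contPaths hD ht hσ hts.le hs
  set M := ∫ ω, ‖X s ω‖ ^ 2 ∂μ with hM
  have hM0 : 0 ≤ M := integral_nonneg fun _ => by positivity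
  have hMY : ∫ ω, ‖Y s ω‖ ^ 2 ∂μ = M := by rw [hYs]
  have hYs2 : MemLp (Y s) 2 μ := by rw [hYs]; exact hXs
  have hgle : ∀ v ∈ Icc t s, 0 ≤ ∫ r in v..s, S.g r ^ 2 ∧ ∫ r in v..s, S.g r ^ 2 ≤ A * (s - v) := by
    intro v hv
    refine ⟨intervalIntegral.integral_nonneg hv.2 fun _ _ => sq_nonneg _, ?_⟩
    have := intervalIntegral.norm_integral_le_of_norm_le_const (a := v) (b := s)
      (f := fun r => S.g r ^ 2) (C := A) fun r hr => by
        rw [uIoc_of_le hv.2] at hr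
        rw [Real.norm_of_nonneg (sq_nonneg _)]
        exact hA.g_sq_le r (hsubδ ⟨hv.1.trans hr.1.le, hr.2⟩)
    rw [abs_of_nonneg (sub_nonneg.2 hv.2)] at this
    exact (Real.le_norm_self _).trans this
  have hβle : ∀ v ∈ Icc t s, ∀ ω, ‖β v ω‖ ≤ c * (1 + ‖Y v ω‖) := by
    intro v hv ω
    rw [hβY v hv]
    refine norm_reducedDrift_le hA (hsubδ hv) ?_
    rw [hPY v hv]
    exact hgrow v (hsub hv) _
  have hinc : ∀ v ∈ Icc t s, Integrable (fun ω => ‖Y v ω - Y s ω‖ ^ 2) μ ∧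
      ∫ ω, ‖Y v ω - Y s ω‖ ^ 2 ∂μ ≤ Ci * (1 + ∫ ω, ‖Y s ω‖ ^ 2 ∂μ) * (s - v) := fun v hv =>
    integral_norm_increment_sq_le hY hβ hβle hc0 (by positivity) hsT
      (fun r hr => (hI r hr).memLp_two (hgle r hr).1)
      (fun r hr => by
        rw [(hI r hr).integral_norm_sq (hgle r hr).1, ← hΓ]
        calc _ ≤ A * (s - r) * Γ := mul_le_mul_of_nonneg_right (hgle r hr).2 hΓ0
          _ = _ := by ring) hYs2 hv
  have hPi : ∀ v ∈ Icc t s, Integrable (fun ω => ‖P v ω - P s ω‖ ^ 2) μ ∧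
      ∫ ω, ‖P v ω - P s ω‖ ^ 2 ∂μ ≤ Cp * (1 + ∫ ω, ‖Y s ω‖ ^ 2 ∂μ) * (s - v) := fun v hv =>
    integral_norm_predictor_sq_le hP (fun r hr ω => by
      rw [hPY r hr, hPY s hsm, norm_sub_rev]
      have := hpL s (hsub hsm) r (hsub hr) (Y s ω) (Y r ω)
      rwa [norm_sub_rev (Y s ω), abs_of_nonneg (sub_nonneg.2 hr.2)] at this) hsT hYs2 hinc hv
  -- The weight of the error integral, clamped in time so as to be continuous on ℝ.
  let w : ℝ → ℝ := fun v => S.α t / S.snr t * S.snrRate (projIcc t s hts.le v)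
  have hwv : ∀ v ∈ Icc t s, w v = S.α t / S.snr t * S.snrRate v := fun v hv => by
    simp only [w, projIcc_of_mem hts.le hv]
  have hw : Continuous w :=
    (((S.continuousOn_snrRate hδ hσδ).mono hsubδ).comp_continuous
      (continuous_subtype_val.comp continuous_projIcc) fun v => (projIcc t s hts.le v).2).const_mul _
  have hwB : ∀ v ∈ Icc t s, |w v| ≤ A * A := fun v hv => by
    rw [hwv v hv, abs_mul, abs_of_nonneg (S.snrRate_nonneg v)]
    exact mul_le_mul (hA.div_snr_le t htδ) (hA.snrRate_le v (hsubδ hv)) (S.snrRate_nonneg v) hA0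
  have hR0 : 0 ≤ Cp * (1 + ∫ ω, ‖Y s ω‖ ^ 2 ∂μ) := by rw [hMY]; positivity
  obtain ⟨he2, hele⟩ := integral_norm_error_sq_le hP hw hwB hts.le hR0 hPi
  have hele' : ∫ ω, ‖∫ v in t..s, w v • (P v ω - P s ω)‖ ^ 2 ∂μ
      ≤ Ce * (1 + ∫ ω, ‖Y s ω‖ ^ 2 ∂μ) * (s - t) ^ 3 := by
    rw [hCe, mul_assoc ((A * A) ^ 2)]; exact hele
  have herr : ∀ᵐ ω ∂μ, (∫ v in t..s, w v • (P v ω - P s ω))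
      = X t ω - S.firstOrderStep t s (X s ω) (D (X s ω) s xT S.T) (z ω) := by
    filter_upwards [hexact, hYX] with ω hω hω'
    rw [sub_firstOrderStep_eq ht hσ hts hs (p := fun u => D (X u ω) u xT S.T)
      (continuousOn_predictor hD ht hs hω'.1) hω]
    refine intervalIntegral.integral_congr fun v hv => ?_
    rw [uIcc_of_le hts.le] at hv
    simp only [hwv v hv, hPY v hv, hPY s hsm, hω'.2 v hv, hω'.2 s hsm]
  have hYt : ∀ᵐ ω ∂μ, Y t ω = X t ω := by
    filter_upwards [hYX] with ω hω using hω.2 t htm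
  refine ⟨⟨he2.ae_eq herr, ?_⟩, ?_⟩
  · have h1 : ∫ ω, ‖X t ω - S.firstOrderStep t s (X s ω) (D (X s ω) s xT S.T) (z ω)‖ ^ 2 ∂μ
        = ∫ ω, ‖∫ v in t..s, w v • (P v ω - P s ω)‖ ^ 2 ∂μ := by
      refine integral_congr_ae ?_
      filter_upwards [herr] with ω hω
      rw [hω]
    rw [h1]
    refine hele'.trans ?_
    rw [hMY]
    gcongr
    linarith
  · intro hder φ K hφ hφK hφL
    have hK : 0 ≤ K := (norm_nonneg _).trans (hφK 0)
    have hXm : StronglyMeasurable[ℱ (OrderDual.toDual s)] (Y s) := by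
      rw [hYs]; exact hX.adapted s hsm
    obtain ⟨hi1, hi2, hle⟩ := weak_error_le (ℱ.le (OrderDual.toDual s)) hP (hY.meas t) hXm hYs2 hw
      hwB hts hsT hL' hCe0 (p := fun x u => D x u xT S.T) (J := fun v ω => ∫ r in s..v, β r ω)
      (L := L) hPY
      (fun v hv x => by
        have := hpL s (hsub hsm) v (hsub hv) x x
        rwa [norm_sub_rev, sub_self, norm_zero, zero_add,
          abs_of_nonneg (sub_nonneg.2 hv.2)] at this)
      (fun v hv => ⟨(hder v (hsub hv)).1, fun x => by
        refine norm_fderiv_le_of_lip' ℝ hL (Eventually.of_forall fun y => ?_)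
        have := hpL v (hsub hv) v (hsub hv) y x
        rwa [sub_self v, abs_zero, mul_zero, add_zero] at this, (hder v (hsub hv)).2⟩)
      hinc
      (fun v hv => integral_norm_drift_le hY hβ hβle hc0 hsT hCi0 hYs2 hinc hv)
      (fun v hv => ⟨_, (hgle v hv).1, hI v hv⟩) hR0 hPi (fun _ => rfl) he2 hele' hφ hφK hφL
    have ha1 : (fun ω => φ (Y t ω)) =ᵐ[μ] fun ω => φ (X t ω) := by
      filter_upwards [hYt] with ω hω
      rw [hω]
    have ha2 : (fun ω => φ (Y t ω - ∫ v in t..s, w v • (P v ω - P s ω))) =ᵐ[μ]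
        fun ω => φ (S.firstOrderStep t s (X s ω) (D (X s ω) s xT S.T) (z ω)) := by
      filter_upwards [hYt, herr] with ω hω hω'
      rw [hω, hω', sub_sub_cancel]
    refine ⟨hi1.congr ha1, hi2.congr ha2, ?_⟩
    rw [← integral_congr_ae ha1, ← integral_congr_ae ha2]
    rw [hMY] at hle
    refine hle.trans ?_
    have hCle : Cw ≤ Ce + Cw := by linarith
    rw [← hCw]
    gcongr

end

theorem proposition1 {d : ℕ} (S : BridgeSchedule)
    (D : EuclideanSpace ℝ (Fin d) → ℝ → EuclideanSpace ℝ (Fin d) → ℝ → EuclideanSpace ℝ (Fin d))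
    (xT : EuclideanSpace ℝ (Fin d))
    (hD : ContinuousOn (fun q : EuclideanSpace ℝ (Fin d) × ℝ => D q.1 q.2 xT S.T)
      (Set.univ ×ˢ Set.Icc 0 S.T))
    (δ : ℝ) (hδ : δ ∈ Set.Icc 0 S.T) (hσδ : 0 < S.σ δ) :
    ∃ C : ℝ, ∀ t s : ℝ, 0 ≤ t → t < s → s ≤ S.T →
      -- freezing the predictions in the exponential-integrator solution gives the first-order step
      (∀ x0 : EuclideanSpace ℝ (Fin d),
        S.eiDataTerm t s (fun _ => x0) = (S.α t * (1 - S.snr s / S.snr t)) • x0) ∧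
      ∀ (Ω : Type w) (mΩ : MeasurableSpace Ω) (μ : Measure Ω) [IsProbabilityMeasure μ]
        (ℱ : Filtration ℝᵒᵈ mΩ) (W X : ℝ → Ω → EuclideanSpace ℝ (Fin d)),
        IsBridgeSDESolution μ S D xT ℱ t s W X →
        ∃ z : Ω → EuclideanSpace ℝ (Fin d),
          HasLaw z (stdGaussian (EuclideanSpace ℝ (Fin d))) μ ∧
          Indep (MeasurableSpace.comap z inferInstance) (ℱ (OrderDual.toDual s)) μ ∧
          -- the exact exponential-integrator solution
          (∀ᵐ ω ∂μ, X t ω = (S.snr s / S.snr t * (S.α t / S.α s)) • X s ω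
            + S.eiDataTerm t s (fun u => D (X u ω) u xT S.T)
            + (S.σ t * Real.sqrt (1 - S.snr s / S.snr t)) • z ω) ∧
          (δ ≤ t →
            -- pathwise error, if the predictions vary at most linearly along the path
            (∀ᵐ ω ∂μ, ∀ M : ℝ,
              (∀ u ∈ Set.Icc t s, ‖D (X u ω) u xT S.T - D (X s ω) s xT S.T‖ ≤ M * (s - u)) →
              ‖X t ω - S.firstOrderStep t s (X s ω) (D (X s ω) s xT S.T) (z ω)‖
                ≤ C * M * (s - t) ^ 2) ∧
            (MemLp (X s) 2 μ → IsLipschitzPredictor S.T (fun x u => D x u xT S.T) →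
              -- mean-square error
              (MemLp (fun ω => X t ω
                  - S.firstOrderStep t s (X s ω) (D (X s ω) s xT S.T) (z ω)) 2 μ ∧
                ∫ ω, ‖X t ω
                  - S.firstOrderStep t s (X s ω) (D (X s ω) s xT S.T) (z ω)‖ ^ 2 ∂μ
                  ≤ C * (1 + ∫ ω, ‖X s ω‖ ^ 2 ∂μ) * (s - t) ^ 3) ∧
              -- weak error
              (HasLipschitzDerivative S.T (fun x u => D x u xT S.T) →
                ∀ (φ : EuclideanSpace ℝ (Fin d) → ℝ) (K : ℝ), Differentiable ℝ φ →
                  (∀ x, ‖fderiv ℝ φ x‖ ≤ K) →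
                  (∀ x y, ‖fderiv ℝ φ x - fderiv ℝ φ y‖ ≤ K * ‖x - y‖) →
                  Integrable (fun ω => φ (X t ω)) μ ∧
                  Integrable (fun ω => φ (S.firstOrderStep t s (X s ω)
                    (D (X s ω) s xT S.T) (z ω))) μ ∧
                  |∫ ω, φ (X t ω) ∂μ - ∫ ω, φ (S.firstOrderStep t s (X s ω)
                    (D (X s ω) s xT S.T) (z ω)) ∂μ|
                    ≤ C * K * (1 + ∫ ω, ‖X s ω‖ ^ 2 ∂μ) * (s - t) ^ 2))) := by
  obtain ⟨A, hA⟩ := S.exists_isCoeffBound hδ hσδ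
  have hA0 := hA.nonneg
  -- C must be chosen before the regularity of D is assumed. That regularity concerns D alone, so it
  -- can be decided here; if it fails, any constant serves.
  obtain ⟨L', hL', hder⟩ : ∃ L' : ℝ, 0 ≤ L' ∧
      (HasLipschitzDerivative S.T (fun x u => D x u xT S.T) →
        ∀ u ∈ Icc 0 S.T, Differentiable ℝ (fun x => D x u xT S.T) ∧
          ∀ x y, ‖fderiv ℝ (fun x => D x u xT S.T) x - fderiv ℝ (fun x => D x u xT S.T) y‖
            ≤ L' * ‖x - y‖) := by
    by_cases h : HasLipschitzDerivative S.T (fun x u => D x u xT S.T)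
    · obtain ⟨L', h⟩ := h
      refine ⟨max L' 0, le_max_right _ _, fun _ u hu => ⟨(h u hu).1, fun x y => ?_⟩⟩
      exact ((h u hu).2 x y).trans
        (mul_le_mul_of_nonneg_right (le_max_left _ _) (norm_nonneg _))
    · exact ⟨0, le_rfl, fun h' => (h h').elim⟩
  obtain ⟨C, hC0, hC⟩ : ∃ C : ℝ, 0 ≤ C ∧
      (IsLipschitzPredictor S.T (fun x u => D x u xT S.T) → _) := by
    by_cases h : IsLipschitzPredictor S.T (fun x u => D x u xT S.T)
    · obtain ⟨C, hC0, hC⟩ := exists_error_const hD hδ hσδ h hL'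
      exact ⟨C, hC0, fun _ => hC⟩
    · exact ⟨0, le_rfl, fun h' => (h h').elim⟩
  -- A * A serves the pathwise bound and C the two bounds in expectation; both are nonnegative, so
  -- their sum serves all three.
  refine ⟨A * A + C, fun t s ht hts hs => ⟨S.eiDataTerm_const ht hts hs, ?_⟩⟩
  intro Ω mΩ μ _ ℱ W X hX
  obtain ⟨z, hz, hexact⟩ := exists_exact_solution hD ht hts hs hX
  have hlaw := hz.hasLaw zero_le_one
  simp only [Real.sqrt_one, one_smul, Measure.map_id'] at hlaw
  refine ⟨z, hlaw, hz.indep (ℱ.le _) zero_le_one, hexact, fun hδt => ⟨?_, fun hXs hLip => ?_⟩⟩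
  · have hσ : 0 < S.σ t := S.σ_pos_of_le hδ hσδ ⟨hδt, hts.le.trans hs⟩
    filter_upwards [hexact, hX.cont] with ω hω hcont M hM
    have h := norm_sub_firstOrderStep_le hA ht hδt hσ hts hs
      (continuousOn_predictor hD ht hs hcont) hω hM
    refine h.trans ?_
    have hM0 : 0 ≤ M := nonneg_of_mul_nonneg_left
      ((norm_nonneg _).trans (hM t ⟨le_rfl, hts.le⟩)) (sub_pos.2 hts)
    gcongr
    linarith
  · obtain ⟨⟨h1, h2⟩, h3⟩ := hC hLip t s hδt hts hs Ω mΩ μ ℱ W X z hX hexact hXs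
    have hM0 : 0 ≤ ∫ ω, ‖X s ω‖ ^ 2 ∂μ := integral_nonneg fun _ => by positivity
    have hst : 0 ≤ s - t := sub_nonneg.2 hts.le
    have hle : C ≤ A * A + C := by nlinarith
    refine ⟨⟨h1, h2.trans (by gcongr)⟩, fun hd φ K hφ hφK hφL => ?_⟩
    obtain ⟨h4, h5, h6⟩ := h3 (hder hd) φ K hφ hφK hφL
    have hK : 0 ≤ K := (norm_nonneg _).trans (hφK 0)
    exact ⟨h4, h5, h6.trans (by gcongr)⟩
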